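/- Let $f:\mathbb R\to\mathbb R$ be of class $C^2$ with $0<f'<1$, and let $\varepsilon>0$. For an interval $[a,b]$ let $\operatorname{conv}_{[a,b]}g$ and $\operatorname{conc}_{[a,b]}g$ be the convex and concave envelopes of a continuous function $g$ on $[a,b]$. A shock interval of $\operatorname{conv}_{[a,b]}g$ (resp. $\operatorname{conc}_{[a,b]}g$) is an open interval $J\subseteq[a,b]$ on which $\operatorname{conv}_{[a,b]}g<g$ (resp. $\operatorname{conc}_{[a,b]}g>g$). If $I$ is a bounded interval, the envelopes on $I$ are those on $[\inf I,\sup I]$. Profiles are right continuous in $x$. Waves. Let $v$ be the initial profile of an approximate solution, $U(x)$ its total variation on $(-\infty,x]$. A wave with label $r\in(0,\mathrm{Tot.Var.}(v)]$ has initial position $\mathtt x_0=\inf\{x: r\le U(x)\}\in(-\infty,+\infty]$, sign $\mathcal S=\operatorname{sign}(v(\mathtt x_0)-v(\mathtt x_0-))$ and state $\hat u=v(\mathtt x_0-)+\mathcal S\,(r-U(\mathtt x_0-))$; sign and state do not depend on time. A wave $s$ has at time $t$ a position $\mathtt x(t,s)\in(-\infty,+\infty]$ ($+\infty$: removed) and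 a speed $\sigma(t,s)$, described below; $\mathcal W(t)$ is the set of the waves with $\mathtt x(t,s)<+\infty$. Two waves $s,s'\in\mathcal W(t)$ have already interacted at time $t$ if $\mathtt x(\tau,s)=\mathtt x(\tau,s')$ for some $0\le\tau\le t$. In that case $\mathcal I(t,s,s')$ is the set of all $p\in\mathcal W(t)$ that have already interacted at time $t$ with both $s$ and $s'$; all its waves have the same sign. Two waves $s,s'\in\mathcal W(t)$ are divided in the real solution at time $t$ if $(\mathtt x(t,s),\sigma(t,s))\ne(\mathtt x(t,s'),\sigma(t,s'))$. (1) Wavefront tracking. Let $f_\varepsilon$ be the piecewise affine interpolation of $f$ at the points of $\mathbb Z\varepsilon$. Let $u_\varepsilon$ be the wavefront tracking solution with flux $f_\varepsilon$ and a right continuous, compactly supported initial datum $v$ of bounded variation with values in $\mathbb Z\varepsilon$: the Riemann problems at the jumps are solved and pieced together until wavefronts meet, the new Riemann problems are then solved, and so on. Let $0=t_0<t_1<t_2<\dots$ be the collision times, and assume that at each $t_j$, $j\ge1$, there is exactly one collision point $x_j$ and exactly two wavefronts meet there. The waves are $s\in\{1,\dots,\mathrm{Tot.Var.}(v)/\varepsilon\}$,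 the wave $s$ having label $r=\varepsilon s$. A wave $s\in\mathcal W(t)$ occupies the cell $(\hat u(s)-\varepsilon,\hat u(s))$ if positive, $(\hat u(s),\hat u(s)+\varepsilon)$ if negative. Its speed $\sigma(t,s)$ is the derivative on its cell of $\operatorname{conv}f_\varepsilon$ (positive waves) or $\operatorname{conc}f_\varepsilon$ (negative waves) on the interval between $u_\varepsilon(t,\mathtt x(t,s)-)$ and $u_\varepsilon(t,\mathtt x(t,s))$. It moves with speed $\sigma(t_j,s)$ on $[t_j,t_{j+1})$ and its position is continuous at $t_{j+1}$, except that a wave arriving at the collision point $x_{j+1}$ is removed at time $t_{j+1}$ unless $\mathcal S(s)u_\varepsilon(t_{j+1},x_{j+1}-)\le\mathcal S(s)\hat u(s)-\varepsilon\le\mathcal S(s)\hat u(s)\le\mathcal S(s)u_\varepsilon(t_{j+1},x_{j+1})$. The Riemann problem $\mathcal I(t,s,s')$ is the interval $I=\bigcup_{p\in\mathcal I(t,s,s')}(\hat u(p)-\varepsilon,\hat u(p)]$ (positive waves) or $\bigcup_{p\in\mathcal I(t,s,s')}[\hat u(p),\hat u(p)+\varepsilon)$ (negative waves). It divides $p,p'\in\mathcal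 I(t,s,s')$ if no shock interval of $\operatorname{conv}_If_\varepsilon$ (resp. $\operatorname{conc}_If_\varepsilon$) contains both their cells. Then, for every $t\ge0$: if $s,s'\in\mathcal W(t)$ have already interacted at time $t$ and are divided in the real solution at time $t$, and if $p,p'\in\mathcal I(t,s,s')$ are divided in the real solution at time $t$, then the Riemann problem $\mathcal I(t,s,s')$ divides $p,p'$. (2) Glimm scheme. Let $\bar u:\mathbb R\to\mathbb R$ be right continuous and of bounded variation, and let $(\vartheta_n)_{n\ge1}$ be any sequence in $[0,1]$ (in particular a uniformly distributed one). The Glimm solution is given by $u_{0,m}=\bar u(m\varepsilon)$ and by letting $u_{n+1,m}$ be the value at $x/t=\vartheta_{n+1}$ (right continuous version) of the entropy solution of the Riemann problem with flux $f$, left state $u_{n,m-1}$ and right state $u_{n,m}$; here $u_{n,m}$ is the value of $u_\varepsilon(n\varepsilon,\cdot)$ on $[m\varepsilon,(m+1)\varepsilon)$. The waves are the labels $s\in(0,\mathrm{Tot.Var.}(u_\varepsilon(0,\cdot))]$ of the profile $v=u_\varepsilon(0,\cdot)$. If $\mathtt x(n\varepsilon,s)=m\varepsilon$, then for $t\in[n\varepsilon,(n+1)\varepsilon)$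 the speed $\sigma(t,s)$ is the derivative at $\hat u(s)$ of $\operatorname{conv}_{[u_{n,m-1},u_{n,m}]}f$ (positive waves) or $\operatorname{conc}_{[u_{n,m},u_{n,m-1}]}f$ (negative waves), one-sided at the end points. On this time interval $\mathtt x(t,s)=m\varepsilon$ if $\sigma(n\varepsilon,s)\le\vartheta_{n+1}$, and $\mathtt x(t,s)=m\varepsilon+t-n\varepsilon$ if $\sigma(n\varepsilon,s)>\vartheta_{n+1}$. The position at time $(n+1)\varepsilon$ is $m'\varepsilon$ with $m'=m$ in the first case and $m'=m+1$ in the second, if $\mathcal S(s)=\operatorname{sign}(u_{n+1,m'}-u_{n+1,m'-1})$ and $\mathcal S(s)u_{n+1,m'-1}<\mathcal S(s)\hat u(s)\le\mathcal S(s)u_{n+1,m'}$; otherwise the wave is removed. The Riemann problem $\mathcal I(t,s,s')$ is the interval $I=\hat u(\mathcal I(t,s,s'))$. It divides $p,p'\in\mathcal I(t,s,s')$ if their states do not belong to the same wavefront, i.e. if there is no shock interval $(c,d)$ of $\operatorname{conv}_If$ with $\hat u(p),\hat u(p')\in(c,d]$ (positive waves), resp. of $\operatorname{conc}_If$ with $\hat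 u(p),\hat u(p')\in[c,d)$ (negative waves). Then, for every $t=n\varepsilon$, $n\in\mathbb N$: if $s,s'\in\mathcal W(t)$ have already interacted at time $t$ and are divided in the real solution at time $t$, and if $p,p'\in\mathcal I(t,s,s')$ are divided in the real solution at time $t$, then the Riemann problem $\mathcal I(t,s,s')$ divides $p,p'$. -/

import Mathlib

open Set Function

noncomputable section

namespace ScalarWaves

/-! ### Convex envelopes and the Riemann solver -/

/-- Convex envelope of `f` on `[a, b]`: the supremum of the convex functions below `f`. -/
def convEnv (f : ℝ → ℝ) (a b u : ℝ) : ℝ :=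
  sSup {y | ∃ g : ℝ → ℝ, ConvexOn ℝ (Icc a b) g ∧ (∀ v ∈ Icc a b, g v ≤ f v) ∧ g u = y}

/-- Concave envelope of `f` on `[a, b]`: the infimum of the concave functions above `f`. -/
def concEnv (f : ℝ → ℝ) (a b u : ℝ) : ℝ :=
  sInf {y | ∃ g : ℝ → ℝ, ConcaveOn ℝ (Icc a b) g ∧ (∀ v ∈ Icc a b, f v ≤ g v) ∧ g u = y}

/-- `J` is a shock interval of the convex envelope of `f` on `[a, b]`. -/
def IsConvShock (f : ℝ → ℝ) (a b : ℝ) (J : Set ℝ) : Prop :=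
  IsOpen J ∧ J.OrdConnected ∧ J ⊆ Icc a b ∧ ∀ u ∈ J, convEnv f a b u < f u

/-- `J` is a shock interval of the concave envelope of `f` on `[a, b]`. -/
def IsConcShock (f : ℝ → ℝ) (a b : ℝ) (J : Set ℝ) : Prop :=
  IsOpen J ∧ J.OrdConnected ∧ J ⊆ Icc a b ∧ ∀ u ∈ J, f u < concEnv f a b u

/-- The entropy solution of the Riemann problem with flux `f`, left state `a` and right state `b`,
as a function of the self-similar variable `c = x / t`. It is the right continuous inverse of the
derivative of the convex envelope of `f` on `[a, b]` if `a ≤ b` (of the concave envelope of `f` on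
`[b, a]` if `b < a`). The one-sided derivatives make the formula meaningful for piecewise affine
fluxes too; for a `C¹` flux they are the derivatives. -/
def riemann (f : ℝ → ℝ) (a b c : ℝ) : ℝ :=
  if a ≤ b then sSup ({a} ∪ {v | v ∈ Ioc a b ∧ derivWithin (convEnv f a b) (Iic v) v ≤ c})
  else sInf ({a} ∪ {v | v ∈ Ico b a ∧ derivWithin (concEnv f b a) (Ici v) v ≤ c})

/-! ### Enumeration of the waves of a profile -/

/-- Total variation of `v`. -/
def totVar (v : ℝ → ℝ) : ℝ := (eVariationOn v univ).toReal

/-- Total variation of `v` on `(-∞, x]`. -/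
def varUpTo (v : ℝ → ℝ) (x : ℝ) : ℝ := (eVariationOn v (Iic x)).toReal

open Classical in
/-- Position `inf {x ∈ (-∞, +∞] | r ≤ varUpTo v x}` of the wave with label `r ∈ (0, totVar v]`. -/
def initPos (v : ℝ → ℝ) (r : ℝ) : WithTop ℝ :=
  if ∃ x, r ≤ varUpTo v x then ((sInf {x | r ≤ varUpTo v x} : ℝ) : WithTop ℝ) else ⊤

/-- Sign of the wave with label `r`: the sign of the jump at its position. -/
def initSign (v : ℝ → ℝ) (r : ℝ) : ℝ :=
  Real.sign (v ((initPos v r).untopD 0) - leftLim v ((initPos v r).untopD 0))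

/-- The state carried by the wave with label `r`. -/
def initState (v : ℝ → ℝ) (r : ℝ) : ℝ :=
  leftLim v ((initPos v r).untopD 0) +
    initSign v r * (r - leftLim (varUpTo v) ((initPos v r).untopD 0))

/-! ### Interaction history

Here `W` is the set of waves, `x t s` the position and `σ t s` the speed of the wave `s` at
time `t`; the value `⊤` means that `s` has been removed. -/

section History

variable {ι : Type} (W : Set ι) (x σ : ℝ → ι → WithTop ℝ) (t : ℝ)

/-- The waves that are present at time `t`. -/
def realWaves : Set ι := {s | s ∈ W ∧ x t s ≠ ⊤}

/-- `s` and `s'` have already interacted at time `t`. -/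
def HaveInteracted (s s' : ι) : Prop := ∃ τ, 0 ≤ τ ∧ τ ≤ t ∧ x τ s = x τ s'

/-- The waves present at time `t` that have already interacted with `s`. -/
def interactedWith (s : ι) : Set ι := {p | p ∈ realWaves W x t ∧ HaveInteracted x t p s}

/-- The common history of `s` and `s'` at time `t`. -/
def commonHistory (s s' : ι) : Set ι := interactedWith W x t s ∩ interactedWith W x t s'

/-- `s` and `s'` differ in position or in speed at time `t`. -/
def DividedInSolution (s s' : ι) : Prop := (x t s, σ t s) ≠ (x t s', σ t s')

end History

/-! ### Wavefront tracking -/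

/-- Piecewise affine interpolation of `f` at the points of `ε ℤ`. -/
def pwAffine (f : ℝ → ℝ) (ε u : ℝ) : ℝ :=
  f (⌊u / ε⌋ * ε) +
    (f ((⌊u / ε⌋ + 1) * ε) - f (⌊u / ε⌋ * ε)) / ε * (u - ⌊u / ε⌋ * ε)

/-- Admissible initial data: compactly supported, right continuous, of bounded variation, with
values in `ε ℤ` (hence piecewise constant, with finitely many jumps). -/
structure IsFrontDatum (ε : ℝ) (v : ℝ → ℝ) : Prop where
  compactSupport : HasCompactSupport v
  rightCont : ∀ x, ContinuousWithinAt v (Ici x) x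
  boundedVar : BoundedVariationOn v univ
  values : ∀ x, ∃ m : ℤ, v x = m * ε

/-- The Riemann problems at the jumps of the piecewise constant profile `v` (zero near `-∞`),
solved for a time `τ` up to which their fans do not cross, and pieced together: the fan issued from
`ξ` contributes nothing on its left and the whole jump of `v` at `ξ` on its right. -/
def evolve (F v : ℝ → ℝ) (τ x : ℝ) : ℝ :=
  if τ = 0 then v x
  else ∑ᶠ ξ : ℝ, (riemann F (leftLim v ξ) (v ξ) ((x - ξ) / τ) - leftLim v ξ)

/-- The wavefronts `(ξ, c)` issued from the profile `v` (a discontinuity of speed `c` starting at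
`ξ`) which are at `y` after time `τ`. -/
def frontsThrough (F v : ℝ → ℝ) (τ y : ℝ) : Set (ℝ × ℝ) :=
  {p | leftLim (riemann F (leftLim v p.1) (v p.1)) p.2 ≠ riemann F (leftLim v p.1) (v p.1) p.2 ∧
    p.1 + p.2 * τ = y}

/-- The positive times after which wavefronts issued from `v` would meet. -/
def collisionDelays (F v : ℝ → ℝ) : Set ℝ := {τ | 0 < τ ∧ ∃ y, (frontsThrough F v τ y).Nontrivial}

/-- The time to the first collision. -/
def delay (F v : ℝ → ℝ) : ℝ := sInf (collisionDelays F v)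

/-- The profile of the wavefront solution at the `j`-th collision time (at time `0` if `j = 0`). -/
def frontProfile (F v : ℝ → ℝ) : ℕ → ℝ → ℝ
  | 0 => v
  | j + 1 => evolve F (frontProfile F v j) (delay F (frontProfile F v j))

open Classical in
/-- The `j`-th collision time, with `t₀ = 0`; it is `⊤` if there are fewer than `j` collisions. -/
def frontTime (F v : ℝ → ℝ) : ℕ → WithTop ℝ
  | 0 => 0
  | j + 1 => if (collisionDelays F (frontProfile F v j)).Nonempty
      then frontTime F v j + ((delay F (frontProfile F v j) : ℝ) : WithTop ℝ) else ⊤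

/-- At every collision time there is exactly one point where wavefronts meet, and exactly two
wavefronts meet there. -/
def BinaryCollisions (F v : ℝ → ℝ) : Prop :=
  ∀ j, frontTime F v (j + 1) ≠ ⊤ →
    ∃ y, (frontsThrough F (frontProfile F v j) (delay F (frontProfile F v j)) y).ncard = 2 ∧
      ∀ z, z ≠ y →
        (frontsThrough F (frontProfile F v j) (delay F (frontProfile F v j)) z).Subsingleton

/-- The indices `j` with `t_j ≤ t < t_{j+1}`; there is at most one. -/
def frontStages (F v : ℝ → ℝ) (t : ℝ) : Set ℕ :=
  {j | frontTime F v j ≤ (t : WithTop ℝ) ∧ (t : WithTop ℝ) < frontTime F v (j + 1)}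

/-- The time elapsed at time `t` since the last collision. -/
def frontElapsed (F v : ℝ → ℝ) (t : ℝ) : ℝ :=
  t - (frontTime F v (sInf (frontStages F v t))).untopD 0

/-- The wavefront solution with initial datum `v`. -/
def frontSolution (F v : ℝ → ℝ) (t x : ℝ) : ℝ :=
  evolve F (frontProfile F v (sInf (frontStages F v t))) (frontElapsed F v t) x

/-- The set of waves `{1, …, totVar v / ε}`. -/
def frontWaves (ε : ℝ) (v : ℝ → ℝ) : Set ℕ := {s | 1 ≤ s ∧ s * ε ≤ totVar v}

/-- Sign of the wave `s`. -/
def frontSign (ε : ℝ) (v : ℝ → ℝ) (s : ℕ) : ℝ := initSign v (s * ε)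

/-- Right state of the wave `s`. -/
def frontState (ε : ℝ) (v : ℝ → ℝ) (s : ℕ) : ℝ := initState v (s * ε)

/-- Speed given by the Riemann problem of the profile `w` at `y` to a wave with right state `u`:
the derivative of the envelope on the open cell of length `ε` of the wave, on which the envelope
is affine. -/
def frontSpeedAt (F : ℝ → ℝ) (ε : ℝ) (w : ℝ → ℝ) (y u : ℝ) : ℝ :=
  if leftLim w y < w y then deriv (convEnv F (leftLim w y) (w y)) (u - ε / 2)
  else deriv (concEnv F (w y) (leftLim w y)) (u + ε / 2)

open Classical in
/-- Position of the wave `s` at the `j`-th collision time. A wave that reaches the collision point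
is removed if it does not survive a cancellation there. -/
def frontPosAt (F : ℝ → ℝ) (ε : ℝ) (v : ℝ → ℝ) : ℕ → ℕ → WithTop ℝ
  | 0, s => initPos v (s * ε)
  | j + 1, s =>
    if frontPosAt F ε v j s = ⊤ then ⊤ else
      let w := frontProfile F v j
      let w' := frontProfile F v (j + 1)
      let y := (frontPosAt F ε v j s).untopD 0
      let z := y + frontSpeedAt F ε w y (frontState ε v s) * delay F w
      if (frontsThrough F w (delay F w) z).Nontrivial ∧
          ¬ (frontSign ε v s * leftLim w' z ≤ frontSign ε v s * frontState ε v s - ε ∧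
            frontSign ε v s * frontState ε v s ≤ frontSign ε v s * w' z)
      then ⊤ else (z : WithTop ℝ)

open Classical in
/-- Position of the wave `s` at time `t`. -/
def frontPos (F : ℝ → ℝ) (ε : ℝ) (v : ℝ → ℝ) (t : ℝ) (s : ℕ) : WithTop ℝ :=
  if (frontStages F v t).Nonempty then
    (frontPosAt F ε v (sInf (frontStages F v t)) s).map fun y =>
      y + frontSpeedAt F ε (frontProfile F v (sInf (frontStages F v t))) y (frontState ε v s) *
        frontElapsed F v t
  else ⊤

/-- Speed of the wave `s` at time `t`. -/
def frontSpeed (F : ℝ → ℝ) (ε : ℝ) (v : ℝ → ℝ) (t : ℝ) (s : ℕ) : WithTop ℝ :=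
  (frontPos F ε v t s).map fun y => frontSpeedAt F ε (frontSolution F v t) y (frontState ε v s)

/-- The interval of values of a homogeneous interval of waves. -/
def frontInterval (ε : ℝ) (v : ℝ → ℝ) (A : Set ℕ) : Set ℝ :=
  ⋃ s ∈ A, if 0 < frontSign ε v s then Ioc (frontState ε v s - ε) (frontState ε v s)
    else Ico (frontState ε v s) (frontState ε v s + ε)

/-- The Riemann problem `I` divides the waves `s` and `s'` (which have the same sign): their open
cells do not lie in a common shock interval of the envelope of the flux. -/
def FrontRiemannDivides (F : ℝ → ℝ) (ε : ℝ) (v : ℝ → ℝ) (I : Set ℝ) (s s' : ℕ) : Prop :=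
  if 0 < frontSign ε v s then
    ¬ ∃ J, IsConvShock F (sInf I) (sSup I) J ∧
      Ioo (frontState ε v s - ε) (frontState ε v s) ⊆ J ∧
      Ioo (frontState ε v s' - ε) (frontState ε v s') ⊆ J
  else
    ¬ ∃ J, IsConcShock F (sInf I) (sSup I) J ∧
      Ioo (frontState ε v s) (frontState ε v s + ε) ⊆ J ∧
      Ioo (frontState ε v s') (frontState ε v s' + ε) ⊆ J

/-! ### The Glimm scheme -/

/-- The discretized initial datum, constant on each `[mε, (m+1)ε)`. -/
def glimmDatum (ε : ℝ) (v : ℝ → ℝ) (x : ℝ) : ℝ := v (⌊x / ε⌋ * ε)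

/-- The value `u_{n,m}` on `[mε, (m+1)ε)` of the Glimm solution at time `nε`. Speeds lie in
`(0, 1)`, so the solution just before time `(n+1)ε` is given on that cell by the Riemann problem
issued from the node `mε`; it is sampled at the point `mε + θ_{n+1} ε`. -/
def glimmValue (f : ℝ → ℝ) (ε : ℝ) (v : ℝ → ℝ) (θ : ℕ → ℝ) : ℕ → ℤ → ℝ
  | 0, m => v (m * ε)
  | n + 1, m => riemann f (glimmValue f ε v θ n (m - 1)) (glimmValue f ε v θ n m) (θ (n + 1))

/-- The set of waves `(0, totVar]`. -/
def glimmWaves (ε : ℝ) (v : ℝ → ℝ) : Set ℝ := Ioc 0 (totVar (glimmDatum ε v))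

/-- Sign of the wave `s`. -/
def glimmSign (ε : ℝ) (v : ℝ → ℝ) (s : ℝ) : ℝ := initSign (glimmDatum ε v) s

/-- State of the wave `s`. -/
def glimmState (ε : ℝ) (v : ℝ → ℝ) (s : ℝ) : ℝ := initState (glimmDatum ε v) s

/-- Speed given at time `nε` by the Riemann problem at the node `mε` to a wave with state `u`. -/
def glimmSpeedAt (f : ℝ → ℝ) (ε : ℝ) (v : ℝ → ℝ) (θ : ℕ → ℝ) (n : ℕ) (m : ℤ) (u : ℝ) : ℝ :=
  let a := glimmValue f ε v θ n (m - 1)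
  let b := glimmValue f ε v θ n m
  if a < b then derivWithin (convEnv f a b) (Icc a b) u
  else derivWithin (concEnv f b a) (Icc b a) u

open Classical in
/-- The node index `m` of the wave `s` at time `nε` (its position is `mε`). The wave moves to the
next node if its speed exceeds `θ_{n+1}`, and is removed unless the jump at the node where it
arrives has its sign and contains its state. -/
def glimmNode (f : ℝ → ℝ) (ε : ℝ) (v : ℝ → ℝ) (θ : ℕ → ℝ) : ℕ → ℝ → WithTop ℤ
  | 0, s => (initPos (glimmDatum ε v) s).map fun y => ⌊y / ε⌋
  | n + 1, s =>
    if glimmNode f ε v θ n s = ⊤ then ⊤ else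
      let m := (glimmNode f ε v θ n s).untopD 0
      let m' := if θ (n + 1) < glimmSpeedAt f ε v θ n m (glimmState ε v s) then m + 1 else m
      let a := glimmValue f ε v θ (n + 1) (m' - 1)
      let b := glimmValue f ε v θ (n + 1) m'
      if glimmSign ε v s = Real.sign (b - a) ∧
          glimmSign ε v s * a < glimmSign ε v s * glimmState ε v s ∧
          glimmSign ε v s * glimmState ε v s ≤ glimmSign ε v s * b
      then (m' : WithTop ℤ) else ⊤

/-- Position of the wave `s` at time `t`. -/
def glimmPos (f : ℝ → ℝ) (ε : ℝ) (v : ℝ → ℝ) (θ : ℕ → ℝ) (t : ℝ) (s : ℝ) : WithTop ℝ :=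
  (glimmNode f ε v θ ⌊t / ε⌋₊ s).map fun m =>
    m * ε + if θ (⌊t / ε⌋₊ + 1) < glimmSpeedAt f ε v θ ⌊t / ε⌋₊ m (glimmState ε v s)
      then t - ⌊t / ε⌋₊ * ε else 0

/-- Speed of the wave `s` at time `t`. -/
def glimmSpeed (f : ℝ → ℝ) (ε : ℝ) (v : ℝ → ℝ) (θ : ℕ → ℝ) (t : ℝ) (s : ℝ) : WithTop ℝ :=
  (glimmNode f ε v θ ⌊t / ε⌋₊ s).map fun m =>
    glimmSpeedAt f ε v θ ⌊t / ε⌋₊ m (glimmState ε v s)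

/-- The Riemann problem `I` divides the waves `s` and `s'` (which have the same sign): their states
do not belong to the same wavefront. The wavefront of a shock interval `(c, d)` consists of the
states in `(c, d]` for positive waves, in `[c, d)` for negative waves. -/
def GlimmRiemannDivides (f : ℝ → ℝ) (ε : ℝ) (v : ℝ → ℝ) (I : Set ℝ) (s s' : ℝ) : Prop :=
  if 0 < glimmSign ε v s then
    ¬ ∃ c d, IsConvShock f (sInf I) (sSup I) (Ioo c d) ∧
      glimmState ε v s ∈ Ioc c d ∧ glimmState ε v s' ∈ Ioc c d
  else
    ¬ ∃ c d, IsConcShock f (sInf I) (sSup I) (Ioo c d) ∧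
      glimmState ε v s ∈ Ico c d ∧ glimmState ε v s' ∈ Ico c d

end ScalarWaves

end

open ScalarWaves

/-!
Both schemes are treated as instances of one combinatorial structure. Fix the waves of one sign; the
negative ones are reduced to the positive ones by the reflection `u ↦ -u`, under which `f` becomes
`reflect f` and concave envelopes become convex ones. A point `y` of `[a, b]` is a *touching point*
if the flux meets its convex envelope on `[a, b]` at `y` (`Touches`). Two states in `(a, b]` have
different speeds in the Riemann problem `(a, b)` only if a touching point of `[a, b]` lies between
them (`leftSlope_eq_of_gap`), and a Riemann problem divides two waves as soon as it has a touching
point between them. The claim is therefore about touching points: if `s < s'` have met and are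
divided, and `p < p'` in their common history are divided, then the interval of values of that
history has a touching point between the states of `p` and `p'`.

`IsWaveSystem` collects what this uses about the waves at discrete times: their order is
preserved, the waves at a node carry exactly the states of the jump there, the states vary without
gaps between nodes, and waves leave a node at different speeds only across a touching point of its
jump. The claim then follows by induction on time (`IsWaveSystem.historySeparates`).

* If `s` and `s'` are at different nodes, they were already divided at the previous time, and since
  then their common history has only lost waves, while the touching points of an interval remain
  touching points of its subintervals. The only new divisions are those between waves that have
  just arrived at the same node `z`. The waves between two consecutive touching points of the old
  history were not divided, so those still present are all at `z`, whose jump therefore contains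
  what is left of that gap; hence the touching point of the jump at `z` that divides `p` and `p'`
  is one of the whole history (`historySeparates_succ`).
* If `s` and `s'` are at the same node, a touching point `d` of its jump lies between them. The
  common history is covered by that of `s'` with a wave on the left of the node, that of `s` with
  a wave on the right, and the jump at the node. These intervals overlap on both sides of `d`, and
  the previous case for the first two shows that the end points of the jump are touching points of
  the whole history; the touching points of the three parts that do the dividing then are so too
  (`historySeparates_of_same_node`).

For the Glimm scheme `isWaveSystem_glimm` verifies the axioms from the fact that the Riemann solver
is the inverse of the slope of the envelope (`le_riemann_iff`). For wavefront tracking each integer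
wave is replaced by the real labels of its cell. The profiles are piecewise constant and fronts do
not cross before the next collision (`IsSafe.le`), so the values of the evolved profile on the two
sides of a point are those of the outermost fronts arriving there (`evolve_eq_of_rightmost`,
`leftLim_evolve_eq_of_leftmost`), and since only two fronts meet at a collision they share the state
between them (`fan_eq_leftLim_fan`); this gives `isWaveSystem_front`. Between collision times fronts
stay apart, so nothing new happens there (`haveInteracted_front_iff`, `separated_of_divided_front`).
-/

namespace ScalarWaves

/-! ### Touching points -/

/-- The slopes of the chords of `F` over `[a, b]` ending at `y` do not exceed the slopes of those
starting at `y`. For Lipschitz `F` this says that the graph has a supporting line from below at `y`,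
i.e. that the convex envelope of `F` on `[a, b]` agrees with `F` at `y`. -/
def Touches (F : ℝ → ℝ) (a b y : ℝ) : Prop :=
  ∀ x ∈ Icc a y, ∀ z ∈ Icc y b, (F y - F x) * (z - y) ≤ (F z - F y) * (y - x)

variable {F : ℝ → ℝ} {a b : ℝ}

lemma Touches.mono {a' b' y : ℝ} (h : Touches F a b y) (ha : a ≤ a') (hb : b' ≤ b) :
    Touches F a' b' y :=
  fun x hx z hz => h x ⟨ha.trans hx.1, hx.2⟩ z ⟨hz.1, hz.2.trans hb⟩

lemma touches_left (F : ℝ → ℝ) (a b : ℝ) : Touches F a b a := by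
  intro x hx z hz
  have : x = a := le_antisymm hx.2 hx.1
  simp [this]

lemma touches_right (F : ℝ → ℝ) (a b : ℝ) : Touches F a b b := by
  intro x hx z hz
  have : z = b := le_antisymm hz.2 hz.1
  simp [this]

/-- Three consecutive chords with increasing slopes, written without divisions. -/
lemma chord_chain {X M N Z x m n z : ℝ} (hx : x ≤ m) (hm : m < n) (hz : n ≤ z)
    (h1 : (M - X) * (n - m) ≤ (N - M) * (m - x)) (h2 : (N - M) * (z - n) ≤ (Z - N) * (n - m)) :
    (M - X) * (z - m) ≤ (Z - M) * (m - x) ∧ (N - X) * (z - n) ≤ (Z - N) * (n - x) := by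
  have hnm : 0 < n - m := sub_pos.2 hm
  constructor
  · refine le_of_mul_le_mul_right ?_ hnm
    nlinarith [mul_le_mul_of_nonneg_right h1 (by linarith : 0 ≤ z - m),
      mul_le_mul_of_nonneg_right h2 (by linarith : 0 ≤ m - x)]
  · refine le_of_mul_le_mul_right ?_ hnm
    nlinarith [mul_le_mul_of_nonneg_right h1 (by linarith : 0 ≤ z - n),
      mul_le_mul_of_nonneg_right h2 (by linarith : 0 ≤ n - x)]

/-- A touching point of `[a, b]` stays one when the interval is enlarged on the right up to `c`,
provided the enlarged part lies beyond a touching point `d ≤ b` of `[y, c]`. -/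
lemma Touches.extend_right {c d y : ℝ} (h : Touches F a b y) (hd : Touches F y c d) (hyd : y < d)
    (hdb : d ≤ b) : Touches F a c y := by
  intro x hx z hz
  rcases le_total z b with hzb | hzb
  · exact h x hx z ⟨hz.1, hzb⟩
  · exact (chord_chain hx.2 hyd (hdb.trans hzb) (h x hx d ⟨hyd.le, hdb⟩)
      (hd y ⟨le_rfl, hyd.le⟩ z ⟨hdb.trans hzb, hz.2⟩)).1

lemma Touches.extend_left {c d y : ℝ} (h : Touches F a b y) (hd : Touches F c y d) (hdy : d < y)
    (had : a ≤ d) : Touches F c b y := by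
  intro x hx z hz
  rcases le_total a x with hax | hax
  · exact h x ⟨hax, hx.2⟩ z hz
  · exact (chord_chain (hax.trans had) hdy hz.1
      (hd x ⟨hx.1, hax.trans had⟩ y ⟨hdy.le, le_rfl⟩) (h d ⟨had, hdy.le⟩ z hz)).2

lemma Touches.glue_left {c y : ℝ} (hc : Touches F a b c) (hy : Touches F a c y) (hyc : y ≤ c) :
    Touches F a b y := by
  rcases hyc.eq_or_lt with rfl | hyc
  · exact hc
  intro x hx z hz
  rcases le_total z c with hzc | hzc
  · exact hy x hx z ⟨hz.1, hzc⟩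
  · exact (chord_chain hx.2 hyc hzc (hy x hx c ⟨hyc.le, le_rfl⟩)
      (hc y ⟨hx.1.trans hx.2, hyc.le⟩ z ⟨hzc, hz.2⟩)).1

lemma Touches.glue_right {c y : ℝ} (hc : Touches F a b c) (hy : Touches F c b y) (hyc : c ≤ y) :
    Touches F a b y := by
  rcases hyc.eq_or_lt with rfl | hyc
  · exact hc
  intro x hx z hz
  rcases le_total c x with hxc | hxc
  · exact hy x ⟨hxc, hx.2⟩ z hz
  · exact (chord_chain hxc hyc hz.1 (hc x ⟨hx.1, hxc⟩ y ⟨hyc.le, hz.1.trans hz.2⟩)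
      (hy c ⟨le_rfl, hyc.le⟩ z hz)).2

/-- A touching point of an interval between two touching points of `[a, b]` is a touching point of
`[a, b]`. -/
lemma Touches.glue {c d y : ℝ} (hc : Touches F a b c) (hd : Touches F a b d) (hac : a ≤ c)
    (hy : Touches F c d y) (hcy : c ≤ y) (hyd : y ≤ d) : Touches F a b y :=
  hc.glue_right ((hd.mono hac le_rfl).glue_left hy hyd) hcy

lemma isClosed_touches (hF : Continuous F) (a b : ℝ) : IsClosed {y | Touches F a b y} := by
  rw [isClosed_iff_frequently]
  intro y hy x hx z hz
  rcases hx.2.eq_or_lt with rfl | hxy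
  · simp
  rcases hz.1.eq_or_lt with rfl | hyz
  · simp
  by_contra! hlt
  have h1 : ∀ᶠ w in nhds y, (F z - F w) * (w - x) < (F w - F x) * (z - w) := by
    apply Filter.Tendsto.eventually_lt _ _ hlt
    · exact Continuous.tendsto (by fun_prop) y
    · exact Continuous.tendsto (by fun_prop) y
  obtain ⟨w, hw, h, hxw, hwz⟩ :=
    (hy.and_eventually (h1.and ((lt_mem_nhds hxy).and (gt_mem_nhds hyz)))).exists
  exact absurd (hw x ⟨hx.1, hxw.le⟩ z ⟨hwz.le, hz.2⟩) (not_le.2 h)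

/-- A limit of touching points from the right is a touching point. -/
lemma touches_of_forall_gt (hF : Continuous F) {y c : ℝ} (hc : y < c)
    (h : ∀ w, y < w → w < c → ∃ y' ∈ Ico y w, Touches F a b y') : Touches F a b y := by
  have := isClosed_touches hF a b
  refine this.closure_subset (Metric.mem_closure_iff.2 fun η hη => ?_)
  obtain ⟨y', hy', ht⟩ := h (min (y + η) ((y + c) / 2)) (lt_min (by linarith) (by linarith))
    ((min_le_right _ _).trans_lt (by linarith))
  refine ⟨y', ht, ?_⟩
  have h2 := hy'.2.trans_le (min_le_left _ _)
  rw [Real.dist_eq, abs_sub_lt_iff]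
  constructor <;> linarith [hy'.1]

/-! ### Systems of waves and their interaction history -/

variable {P : Type*}

/-- The waves `s` and `s'` have shared a node at some time up to `n`. -/
def Met (pos : ℕ → ℝ → WithTop P) (n : ℕ) (s s' : ℝ) : Prop := ∃ k ≤ n, pos k s = pos k s'

/-- The waves present at time `n` that have met both `s` and `s'`. -/
def history (W : Set ℝ) (pos : ℕ → ℝ → WithTop P) (n : ℕ) (s s' : ℝ) : Set ℝ :=
  {p | p ∈ W ∧ pos n p ≠ ⊤ ∧ Met pos n p s ∧ Met pos n p s'}

/-- The waves `s < s'` sit at different nodes at time `n`, or at a node whose interval has a touching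
point between their states. -/
def Separated (F : ℝ → ℝ) (pos : ℕ → ℝ → WithTop P) (st : ℝ → ℝ) (lo hi : ℕ → P → ℝ) (n : ℕ)
    (s s' : ℝ) : Prop :=
  pos n s ≠ pos n s' ∨
    ∃ y : P, pos n s = y ∧ ∃ w ∈ Ico (st s) (st s'), Touches F (lo n y) (hi n y) w

/-- The interval spanned by the common history of `s` and `s'` has a touching point between any two
separated waves of that history. -/
def HistorySeparates (F : ℝ → ℝ) (W : Set ℝ) (pos : ℕ → ℝ → WithTop P) (st : ℝ → ℝ)
    (lo hi : ℕ → P → ℝ) (n : ℕ) (s s' : ℝ) : Prop :=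
  ∀ p ∈ history W pos n s s', ∀ p' ∈ history W pos n s s', p < p' →
    Separated F pos st lo hi n p p' → ∃ y ∈ Ico (st p) (st p'),
      Touches F (sInf (st '' history W pos n s s')) (sSup (st '' history W pos n s s')) y

variable {N : ℕ} {W : Set ℝ} {pos : ℕ → ℝ → WithTop P} {st : ℝ → ℝ} {lo hi : ℕ → P → ℝ}
  {n : ℕ} {s s' p p' q : ℝ}

lemma Met.symm (h : Met pos n s s') : Met pos n s' s :=
  let ⟨k, hk, h⟩ := h; ⟨k, hk, h.symm⟩

lemma Met.refl (pos : ℕ → ℝ → WithTop P) (n : ℕ) (s : ℝ) : Met pos n s s :=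
  ⟨n, le_rfl, rfl⟩

lemma left_mem_history (hs : s ∈ W) (as : pos n s ≠ ⊤) (hm : Met pos n s s') :
    s ∈ history W pos n s s' := ⟨hs, as, Met.refl pos n s, hm⟩

lemma right_mem_history (hs : s' ∈ W) (as : pos n s' ≠ ⊤)
    (hm : Met pos n s s') : s' ∈ history W pos n s s' := ⟨hs, as, hm.symm, Met.refl pos n s'⟩

variable [LinearOrder P]

/-- The waves of one sign of a front tracking or Glimm approximation, observed at the discrete
times `0, …, N`. Waves are labelled by reals; the wave `s` carries the state `st s` and sits at time
`n` at the node `pos n s` (`⊤` once it has been removed); the node `y` is occupied by the states in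
`(lo n y, hi n y]`. The field `step` says that waves leaving a node are separated only by a touching
point of the flux on the interval of the node, and `exists_node` is an intermediate value property
of the profile. -/
structure IsWaveSystem (F : ℝ → ℝ) (N : ℕ) (W : Set ℝ) (pos : ℕ → ℝ → WithTop P) (st : ℝ → ℝ)
    (lo hi : ℕ → P → ℝ) : Prop where
  continuous : Continuous F
  alive_of_succ : ∀ n < N, ∀ s ∈ W, pos (n + 1) s ≠ ⊤ → pos n s ≠ ⊤
  mono : ∀ n ≤ N, ∀ s ∈ W, ∀ s' ∈ W, pos n s ≠ ⊤ → pos n s' ≠ ⊤ → s ≤ s' → pos n s ≤ pos n s'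
  mem : ∀ n ≤ N, ∀ s ∈ W, ∀ y : P, pos n s = y → st s ∈ Ioc (lo n y) (hi n y)
  fill : ∀ n ≤ N, ∀ y : P, ∀ w ∈ Ioc (lo n y) (hi n y), ∃ s ∈ W, pos n s = y ∧ st s = w
  strict : ∀ n ≤ N, ∀ s ∈ W, ∀ s' ∈ W, s < s' → ∀ y : P, pos n s = y → pos n s' = y → st s < st s'
  exists_node : ∀ n ≤ N, ∀ y y' : P, ∀ w, y < y' → hi n y < w → w ≤ lo n y' →
    ∃ z ∈ Ioo y y', w ∈ Ioc (lo n z) (hi n z)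
  step : ∀ n < N, ∀ s ∈ W, ∀ s' ∈ W, s < s' → ∀ y : P, pos n s = y → pos n s' = y →
    pos (n + 1) s ≠ ⊤ → pos (n + 1) s' ≠ ⊤ →
    (∀ w ∈ Ico (st s) (st s'), ¬ Touches F (lo n y) (hi n y) w) → pos (n + 1) s = pos (n + 1) s'
  bdd : ∃ M, ∀ s ∈ W, |st s| ≤ M

namespace IsWaveSystem

lemma alive_of_le (H : IsWaveSystem F N W pos st lo hi) {k : ℕ} (hk : k ≤ n) (hn : n ≤ N)
    (hs : s ∈ W) (h : pos n s ≠ ⊤) : pos k s ≠ ⊤ := by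
  induction n, hk using Nat.le_induction with
  | base => exact h
  | succ n hk ih => exact ih (by omega) (H.alive_of_succ n (by omega) s hs h)

lemma met_between (H : IsWaveSystem F N W pos st lo hi) (hn : n ≤ N) (hs : s ∈ W) (hs' : s' ∈ W)
    (hq : q ∈ W) (as : pos n s ≠ ⊤) (as' : pos n s' ≠ ⊤) (aq : pos n q ≠ ⊤) (hsq : s ≤ q)
    (hqs : q ≤ s') (h : Met pos n s s') : Met pos n s q ∧ Met pos n q s' := by
  obtain ⟨k, hk, h⟩ := h
  have hkN := hk.trans hn
  have h1 := H.mono k hkN s hs q hq (H.alive_of_le hk hn hs as) (H.alive_of_le hk hn hq aq) hsq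
  have h2 := H.mono k hkN q hq s' hs' (H.alive_of_le hk hn hq aq) (H.alive_of_le hk hn hs' as') hqs
  exact ⟨⟨k, hk, le_antisymm h1 (h ▸ h2)⟩, ⟨k, hk, le_antisymm h2 (h ▸ h1)⟩⟩

lemma met_strict (H : IsWaveSystem F N W pos st lo hi) (hn : n ≤ N) (hs : s ∈ W) (hs' : s' ∈ W)
    (as : pos n s ≠ ⊤) (hss : s < s') (h : Met pos n s s') : st s < st s' := by
  obtain ⟨k, hk, h⟩ := h
  obtain ⟨y, hy⟩ := WithTop.ne_top_iff_exists.1 (H.alive_of_le hk hn hs as)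
  exact H.strict k (hk.trans hn) s hs s' hs' hss y hy.symm (h ▸ hy.symm)

lemma history_strict (H : IsWaveSystem F N W pos st lo hi) (hn : n ≤ N) (hs : s ∈ W)
    (hs' : s' ∈ W) (as : pos n s ≠ ⊤) (as' : pos n s' ≠ ⊤) (hss : s < s')
    (hp : p ∈ history W pos n s s')
    (hp' : p' ∈ history W pos n s s') (hpp : p < p') : st p < st p' := by
  obtain ⟨pW, ap, m1, m2⟩ := hp
  obtain ⟨pW', ap', m1', m2'⟩ := hp'
  rcases le_or_gt p' s' with h | h
  · exact H.met_strict hn pW pW' ap hpp (H.met_between hn pW hs' pW' ap as' ap' hpp.le h m2).1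
  rcases le_or_gt s p with h1 | h1
  · exact H.met_strict hn pW pW' ap hpp (H.met_between hn hs pW' pW as ap' ap h1 hpp.le m1'.symm).2
  · exact (H.met_strict hn pW hs' ap (h1.trans hss) m2).trans
      (H.met_strict hn hs' pW' as' h m2'.symm)

lemma history_convex (H : IsWaveSystem F N W pos st lo hi) (hn : n ≤ N) (hs : s ∈ W)
    (hs' : s' ∈ W) (as : pos n s ≠ ⊤) (as' : pos n s' ≠ ⊤)
    (hp : p ∈ history W pos n s s') (hp' : p' ∈ history W pos n s s')
    (hq : q ∈ W) (aq : pos n q ≠ ⊤) (hpq : p ≤ q) (hqp : q ≤ p') : q ∈ history W pos n s s' := by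
  obtain ⟨pW, ap, m1, m2⟩ := hp
  obtain ⟨pW', ap', m1', m2'⟩ := hp'
  refine ⟨hq, aq, ?_, ?_⟩
  · rcases le_total q s with h | h
    · exact (H.met_between hn pW hs hq ap as aq hpq h m1).2
    · exact (H.met_between hn hs pW' hq as ap' aq h hqp m1'.symm).1.symm
  · rcases le_total q s' with h | h
    · exact (H.met_between hn pW hs' hq ap as' aq hpq h m2).2
    · exact (H.met_between hn hs' pW' hq as' ap' aq h hqp m2'.symm).1.symm

/-- Every state between those of two present waves is carried by a present wave between them. -/
lemma exists_wave (H : IsWaveSystem F N W pos st lo hi) (hn : n ≤ N) (hs : s ∈ W)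
    (hs' : s' ∈ W) (as : pos n s ≠ ⊤) (as' : pos n s' ≠ ⊤) (hss : s < s') {w : ℝ}
    (hw : st s < w) (hw' : w < st s') : ∃ q ∈ W, pos n q ≠ ⊤ ∧ s < q ∧ q < s' ∧ st q = w := by
  obtain ⟨y, hy⟩ := WithTop.ne_top_iff_exists.1 as
  obtain ⟨y', hy'⟩ := WithTop.ne_top_iff_exists.1 as'
  have hyy : y ≤ y' := by
    have := H.mono n hn s hs s' hs' as as' hss.le
    rwa [← hy, ← hy', WithTop.coe_le_coe] at this
  have hm := H.mem n hn s hs y hy.symm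
  have hm' := H.mem n hn s' hs' y' hy'.symm
  -- a wave with state `w` at a node between those of `s` and `s'` has its label between theirs
  have key : ∀ z, y ≤ z → z ≤ y' → w ∈ Ioc (lo n z) (hi n z) →
      ∃ q ∈ W, pos n q ≠ ⊤ ∧ s < q ∧ q < s' ∧ st q = w := by
    intro z hz hz' hwz
    obtain ⟨q, qW, qz, qw⟩ := H.fill n hn z w hwz
    have aq : pos n q ≠ ⊤ := by simp [qz]
    refine ⟨q, qW, aq, ?_, ?_, qw⟩
    · by_contra! hqs
      have h1 := H.mono n hn q qW s hs aq as hqs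
      rw [qz, ← hy, WithTop.coe_le_coe] at h1
      have hzy : z = y := le_antisymm h1 hz
      rcases hqs.eq_or_lt with h | h
      · rw [h] at qw; linarith
      · have := H.strict n hn q qW s hs h y (hzy ▸ qz) hy.symm
        linarith
    · by_contra! hqs
      have h1 := H.mono n hn s' hs' q qW as' aq hqs
      rw [qz, ← hy', WithTop.coe_le_coe] at h1
      have hzy : z = y' := le_antisymm hz' h1
      rcases hqs.eq_or_lt with h | h
      · rw [h] at hw'; linarith
      · have := H.strict n hn s' hs' q qW h y' hy'.symm (hzy ▸ qz)
        linarith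
  rcases le_or_gt w (hi n y) with h1 | h1
  · exact key y le_rfl hyy ⟨hm.1.trans hw, h1⟩
  rcases le_or_gt w (lo n y') with h2 | h2
  · have hlt : y < y' := by
      refine lt_of_le_of_ne hyy ?_
      rintro rfl
      linarith [hm'.1, hm'.2]
    obtain ⟨z, hz, hzw⟩ := H.exists_node n hn y y' w hlt h1 h2
    exact key z hz.1.le hz.2.le hzw
  · exact key y' hyy le_rfl ⟨h2, hw'.le.trans hm'.2⟩

lemma history_fill (H : IsWaveSystem F N W pos st lo hi) (hn : n ≤ N) (hs : s ∈ W)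
    (hs' : s' ∈ W) (as : pos n s ≠ ⊤) (as' : pos n s' ≠ ⊤) (hss : s < s')
    (hp : p ∈ history W pos n s s') (hp' : p' ∈ history W pos n s s') {w : ℝ}
    (hw : st p < w) (hw' : w < st p') :
    ∃ q ∈ history W pos n s s', p < q ∧ q < p' ∧ st q = w := by
  have hpp : p < p' := by
    by_contra! h
    rcases h.eq_or_lt with rfl | h
    · linarith
    · linarith [H.history_strict hn hs hs' as as' hss hp' hp h]
  obtain ⟨q, qW, aq, h1, h2, h3⟩ := H.exists_wave hn hp.1 hp'.1 hp.2.1 hp'.2.1 hpp hw hw'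
  exact ⟨q, H.history_convex hn hs hs' as as' hp hp' qW aq h1.le h2.le, h1, h2, h3⟩

lemma bddBelow_image (H : IsWaveSystem F N W pos st lo hi) : BddBelow (st '' history W pos n s s') := by
  obtain ⟨M, hM⟩ := H.bdd
  refine ⟨-M, ?_⟩
  rintro _ ⟨p, hp, rfl⟩
  exact (abs_le.1 (hM p hp.1)).1

lemma bddAbove_image (H : IsWaveSystem F N W pos st lo hi) : BddAbove (st '' history W pos n s s') := by
  obtain ⟨M, hM⟩ := H.bdd
  refine ⟨M, ?_⟩
  rintro _ ⟨p, hp, rfl⟩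
  exact (abs_le.1 (hM p hp.1)).2

lemma sInf_le (H : IsWaveSystem F N W pos st lo hi) (hp : p ∈ history W pos n s s') :
    sInf (st '' history W pos n s s') ≤ st p := csInf_le H.bddBelow_image ⟨p, hp, rfl⟩

lemma le_sSup (H : IsWaveSystem F N W pos st lo hi) (hp : p ∈ history W pos n s s') :
    st p ≤ sSup (st '' history W pos n s s') := le_csSup H.bddAbove_image ⟨p, hp, rfl⟩

/-- Two waves that have met and now sit at different nodes were separated already at the previous
time, and their common history has only lost waves since then. -/
lemma historySeparates_succ (H : IsWaveSystem F N W pos st lo hi) (hn : n < N) (hs : s ∈ W)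
    (hs' : s' ∈ W) (as : pos (n + 1) s ≠ ⊤) (as' : pos (n + 1) s' ≠ ⊤) (hss : s < s')
    (hm : Met pos (n + 1) s s') (hne : pos (n + 1) s ≠ pos (n + 1) s')
    (IH : Met pos n s s' → Separated F pos st lo hi n s s' →
      HistorySeparates F W pos st lo hi n s s') :
    HistorySeparates F W pos st lo hi (n + 1) s s' := by
  have bs := H.alive_of_succ n hn s hs as
  have bs' := H.alive_of_succ n hn s' hs' as'
  have down : ∀ {u u'}, Met pos (n + 1) u u' → pos (n + 1) u ≠ pos (n + 1) u' → Met pos n u u' := by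
    rintro u u' ⟨k, hk, h⟩ hu
    refine ⟨k, ?_, h⟩
    rcases hk.eq_or_lt with rfl | h'
    · exact absurd h hu
    · omega
  have hm0 : Met pos n s s' := down hm hne
  have hlt : pos (n + 1) s < pos (n + 1) s' :=
    lt_of_le_of_ne (H.mono _ hn s hs s' hs' as as' hss.le) hne
  -- waves not separated at time `n` stay together
  have stay : ∀ {u u'}, u ∈ W → u' ∈ W → pos (n + 1) u ≠ ⊤ → pos (n + 1) u' ≠ ⊤ → u < u' →
      ¬ Separated F pos st lo hi n u u' → pos (n + 1) u = pos (n + 1) u' := by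
    intro u u' hu hu' au au' huu hsep
    obtain ⟨y, hy⟩ := WithTop.ne_top_iff_exists.1 (H.alive_of_succ n hn u hu au)
    unfold Separated at hsep
    push Not at hsep
    exact H.step n hn u hu u' hu' huu y hy.symm (hsep.1 ▸ hy.symm) au au' (hsep.2 y hy.symm)
  have hsep : Separated F pos st lo hi n s s' := by
    by_contra h
    exact hne (stay hs hs' as as' hss h)
  have C := IH hm0 hsep
  have sub : history W pos (n + 1) s s' ⊆ history W pos n s s' := by
    intro p hp
    obtain ⟨pW, ap, m1, m2⟩ := hp
    have bp := H.alive_of_succ n hn p pW ap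
    rcases le_or_gt p s with h | h
    · have h1 : Met pos n p s' := down m2
        ((H.mono _ hn p pW s hs ap as h).trans_lt hlt).ne
      exact ⟨pW, bp, (H.met_between hn.le pW hs' hs bp bs' bs h hss.le h1).1, h1⟩
    rcases le_or_gt s' p with h' | h'
    · have h1 : Met pos n p s := (down m1.symm
        (hlt.trans_le (H.mono _ hn s' hs' p pW as' ap h')).ne).symm
      exact ⟨pW, bp, h1, (H.met_between hn.le hs pW hs' bs bp bs' hss.le h' h1.symm).2.symm⟩
    · have := H.met_between hn.le hs hs' pW bs bs' bp h.le h'.le hm0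
      exact ⟨pW, bp, this.1.symm, this.2⟩
  intro p hp p' hp' hpp hdiv
  set A := st '' history W pos n s s' with hA
  set A' := st '' history W pos (n + 1) s s' with hA'
  have hne' : A'.Nonempty := ⟨st p, p, hp, rfl⟩
  have hα : sInf A ≤ sInf A' := csInf_le_csInf H.bddBelow_image hne' (image_mono sub)
  have hγ : sSup A' ≤ sSup A := csSup_le_csSup H.bddAbove_image hne' (image_mono sub)
  by_cases ht : ∃ y ∈ Ico (st p) (st p'), Touches F (sInf A) (sSup A) y
  · obtain ⟨y, hy, ht⟩ := ht
    exact ⟨y, hy, ht.mono hα hγ⟩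
  -- otherwise the waves between two consecutive touching points of the old interval stay together
  push Not at ht
  have strict : ∀ {u u'}, u ∈ history W pos (n + 1) s s' → u' ∈ history W pos (n + 1) s s' →
      u < u' → st u < st u' := fun hu hu' h =>
    H.history_strict hn hs hs' as as' hss hu hu' h
  have strict' : ∀ {u u'}, u ∈ history W pos (n + 1) s s' → u' ∈ history W pos (n + 1) s s' →
      st u < st u' → u < u' := by
    intro u u' hu hu' h
    by_contra! h'
    rcases h'.eq_or_lt with rfl | h'
    · exact lt_irrefl _ h
    · exact lt_asymm h (strict hu' hu h')
  have hstpp := strict hp hp' hpp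
  have cl := isClosed_touches H.continuous (sInf A) (sSup A)
  have αp : sInf A ≤ st p := H.sInf_le (sub hp)
  have γp : st p' ≤ sSup A := H.le_sSup (sub hp')
  obtain ⟨e₁, he₁, hmax⟩ : ∃ e, (Touches F (sInf A) (sSup A) e ∧ e ∈ Icc (sInf A) (st p)) ∧
      ∀ w, Touches F (sInf A) (sSup A) w → w ∈ Icc (sInf A) (st p) → w ≤ e := by
    obtain ⟨e, he⟩ := ((isCompact_Icc.inter_left cl).exists_isGreatest
      ⟨sInf A, touches_left F _ _, le_rfl, αp⟩ : ∃ e, IsGreatest _ e)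
    exact ⟨e, he.1, fun w h1 h2 => he.2 ⟨h1, h2⟩⟩
  obtain ⟨e₂, he₂, hmin⟩ : ∃ e, (Touches F (sInf A) (sSup A) e ∧ e ∈ Icc (st p') (sSup A)) ∧
      ∀ w, Touches F (sInf A) (sSup A) w → w ∈ Icc (st p') (sSup A) → e ≤ w := by
    obtain ⟨e, he⟩ := ((isCompact_Icc.inter_left cl).exists_isLeast
      ⟨sSup A, touches_right F _ _, γp, le_rfl⟩ : ∃ e, IsLeast _ e)
    exact ⟨e, he.1, fun w h1 h2 => he.2 ⟨h1, h2⟩⟩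
  have gap : ∀ w, e₁ < w → w < e₂ → ¬ Touches F (sInf A) (sSup A) w := by
    intro w h1 h2 h3
    rcases le_or_gt w (st p) with h | h
    · exact absurd (hmax w h3 ⟨he₁.2.1.trans h1.le, h⟩) (not_le.2 h1)
    rcases lt_or_ge w (st p') with h' | h'
    · exact ht w ⟨h.le, h'⟩ h3
    · exact absurd (hmin w h3 ⟨h', h2.le.trans he₂.2.2⟩) (not_le.2 h2)
  have e₁p : e₁ < st p := lt_of_le_of_ne he₁.2.2 fun h => ht _ ⟨le_rfl, hstpp⟩ (h ▸ he₁.1)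
  have together : ∀ {u u'}, u ∈ history W pos (n + 1) s s' → u' ∈ history W pos (n + 1) s s' →
      u < u' → e₁ < st u → st u' ≤ e₂ → pos (n + 1) u = pos (n + 1) u' := by
    intro u u' hu hu' huu h1 h2
    refine stay hu.1 hu'.1 hu.2.1 hu'.2.1 huu fun hd => ?_
    obtain ⟨w, hw, hwt⟩ := C u (sub hu) u' (sub hu') huu hd
    exact gap w (h1.trans_le hw.1) (hw.2.trans_le h2) hwt
  have hpos := together hp hp' hpp e₁p he₂.2.1
  obtain ⟨z, hz⟩ := WithTop.ne_top_iff_exists.1 hp.2.1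
  obtain ⟨d, hd, hdt⟩ : ∃ w ∈ Ico (st p) (st p'), Touches F (lo (n + 1) z) (hi (n + 1) z) w := by
    rcases hdiv with h | ⟨y, hy, h⟩
    · exact absurd hpos h
    · rw [← hz, WithTop.coe_inj] at hy
      exact hy ▸ h
  have fill : ∀ {u u' w}, u ∈ history W pos (n + 1) s s' → u' ∈ history W pos (n + 1) s s' →
      st u < w → w < st u' → ∃ q ∈ history W pos (n + 1) s s', u < q ∧ q < u' ∧ st q = w :=
    fun hu hu' h1 h2 => H.history_fill hn hs hs' as as' hss hu hu' h1 h2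
  have mp := H.mem (n + 1) hn p hp.1 z hz.symm
  have mp' := H.mem (n + 1) hn p' hp'.1 z (hpos ▸ hz.symm)
  -- the jump at `z` contains the part of the gap that the new history covers
  have hlo : lo (n + 1) z ≤ max e₁ (sInf A') := by
    by_contra! h
    obtain ⟨w, hw1, hw2⟩ := exists_between h
    obtain ⟨_, ⟨u, hu, rfl⟩, huw⟩ := exists_lt_of_csInf_lt hne' ((le_max_right _ _).trans_lt hw1)
    obtain ⟨q, hq, -, hqp, rfl⟩ := fill hu hp huw (hw2.trans mp.1)
    have := H.mem (n + 1) hn q hq.1 z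
      (together hq hp hqp ((le_max_left _ _).trans_lt hw1) (hstpp.le.trans he₂.2.1) ▸ hz.symm)
    exact lt_asymm hw2 this.1
  have hhi : min e₂ (sSup A') ≤ hi (n + 1) z := by
    by_contra! h
    obtain ⟨w, hw1, hw2⟩ := exists_between h
    obtain ⟨_, ⟨u, hu, rfl⟩, huw⟩ := exists_lt_of_lt_csSup hne' (hw2.trans_le (min_le_right _ _))
    obtain ⟨q, hq, hqp, -, rfl⟩ := fill hp' hu (mp'.2.trans_lt hw1) huw
    have := H.mem (n + 1) hn q hq.1 z
      (together hp' hq hqp (e₁p.trans hstpp) (hw2.le.trans (min_le_left _ _)) ▸ hpos ▸ hz.symm)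
    exact absurd this.2 (not_le.2 hw1)
  refine ⟨d, hd, ?_⟩
  have t₁ : Touches F (sInf A') (sSup A') (max e₁ (sInf A')) := by
    rcases max_choice e₁ (sInf A') with h | h <;> rw [h]
    · exact he₁.1.mono hα hγ
    · exact touches_left _ _ _
  have t₂ : Touches F (sInf A') (sSup A') (min e₂ (sSup A')) := by
    rcases min_choice e₂ (sSup A') with h | h <;> rw [h]
    · exact he₂.1.mono hα hγ
    · exact touches_right _ _ _
  exact t₁.glue t₂ (le_max_right _ _) (hdt.mono hlo hhi)
    (max_le (e₁p.le.trans hd.1) ((H.sInf_le hp).trans hd.1))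
    (le_min (hd.2.le.trans he₂.2.1) (hd.2.le.trans (H.le_sSup hp')))

/-- Two waves at the same node, divided by a touching point `d` of its interval. The history of a
wave on the left of the node and `s'`, that of `s` and a wave on its right, and the touching point
`d` together make the end points of the node touching points of the whole history. -/
lemma historySeparates_of_same_node (H : IsWaveSystem F N W pos st lo hi) (hn : n ≤ N)
    (hs : s ∈ W) (hs' : s' ∈ W) (hss : s < s') {z : P} (hz : pos n s = z) (hz' : pos n s' = z)
    {d : ℝ} (hd : d ∈ Ico (st s) (st s')) (hdt : Touches F (lo n z) (hi n z) d)
    (C : ∀ u ∈ W, ∀ u' ∈ W, pos n u ≠ ⊤ → pos n u' ≠ ⊤ → u < u' → Met pos n u u' →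
      pos n u ≠ pos n u' → HistorySeparates F W pos st lo hi n u u') :
    HistorySeparates F W pos st lo hi n s s' := by
  have as : pos n s ≠ ⊤ := by simp [hz]
  have as' : pos n s' ≠ ⊤ := by simp [hz']
  have hm : Met pos n s s' := ⟨n, le_rfl, hz.trans hz'.symm⟩
  set a := lo n z with ha
  set b := hi n z with hb
  set A := st '' history W pos n s s' with hA
  have ms := H.mem n hn s hs z hz
  have ms' := H.mem n hn s' hs' z hz'
  have sA := left_mem_history hs as hm
  have sA' := right_mem_history hs' as' hm
  have had : a < d := ms.1.trans_le hd.1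
  have hdb : d < b := hd.2.trans_le ms'.2
  have neA : A.Nonempty := ⟨_, s, sA, rfl⟩
  have strict : ∀ {u u'}, u ∈ history W pos n s s' → u' ∈ history W pos n s s' →
      u < u' → st u < st u' := fun hu hu' h =>
    H.history_strict hn hs hs' as as' hss hu hu' h
  have fill : ∀ {u u' w}, u ∈ history W pos n s s' → u' ∈ history W pos n s s' →
      st u < w → w < st u' → ∃ q ∈ history W pos n s s', u < q ∧ q < u' ∧ st q = w :=
    fun hu hu' h1 h2 => H.history_fill hn hs hs' as as' hss hu hu' h1 h2
  have node : ∀ {w}, w ∈ Ioc a b → ∃ q ∈ history W pos n s s', pos n q = z ∧ st q = w := by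
    intro w hw
    obtain ⟨q, qW, qz, qw⟩ := H.fill n hn z w hw
    exact ⟨q, ⟨qW, by simp [qz], ⟨n, le_rfl, qz.trans hz.symm⟩, ⟨n, le_rfl, qz.trans hz'.symm⟩⟩,
      qz, qw⟩
  have order : ∀ {u u'}, u ∈ history W pos n s s' → u' ∈ history W pos n s s' →
      pos n u < pos n u' → u < u' := by
    intro u u' hu hu' h
    by_contra! h'
    exact absurd (H.mono n hn u' hu'.1 u hu.1 hu'.2.1 hu.2.1 h') (not_le.2 h)
  have left_le : ∀ {q}, q ∈ history W pos n s s' → pos n q < z → st q ≤ a := by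
    intro q hq hqz
    by_contra! h
    have hqs := strict hq sA (order hq sA (hz ▸ hqz))
    obtain ⟨u, hu, huz, hus⟩ := node ⟨h, hqs.le.trans ms.2⟩
    have := strict hq hu (order hq hu (huz ▸ hqz))
    linarith
  have right_gt : ∀ {q}, q ∈ history W pos n s s' → (z : WithTop P) < pos n q → b < st q := by
    intro q hq hqz
    obtain ⟨u, hu, huz, hus⟩ := node ⟨had.trans hdb, le_rfl⟩
    exact hus ▸ strict hu hq (order hu hq (huz ▸ hqz))
  have hαa : sInf A ≤ a := by
    refine le_of_forall_gt fun w hw => ?_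
    obtain ⟨w', h1, h2⟩ := exists_between (lt_min hw (had.trans hdb))
    obtain ⟨q, hq, -, hqw⟩ := node ⟨h1, (h2.trans_le (min_le_right _ _)).le⟩
    exact (H.sInf_le hq).trans_lt (hqw ▸ h2.trans_le (min_le_left _ _))
  have hbγ : b ≤ sSup A := by
    obtain ⟨q, hq, -, hqw⟩ := node ⟨had.trans hdb, le_rfl⟩
    exact hqw ▸ H.le_sSup hq
  -- the common history of a wave on the left of the node and a wave `u` of the node or beyond
  have CL : ∀ {q}, q ∈ history W pos n s s' → pos n q < z → HistorySeparates F W pos st lo hi n q s'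
      ∧ sInf (st '' history W pos n q s') ≤ sInf A ∧
      (∀ u ∈ history W pos n s s', u ≤ s' → u ∈ history W pos n q s') := by
    intro q hq hqz
    have hqs' := order hq sA' (hz' ▸ hqz)
    have hsub : ∀ u ∈ history W pos n s s', u ≤ s' → u ∈ history W pos n q s' := by
      intro u hu hus
      refine ⟨hu.1, hu.2.1, ?_, hu.2.2.2⟩
      rcases le_total u q with h | h
      · exact (H.met_between hn hu.1 hs' hq.1 hu.2.1 as' hq.2.1 h hqs'.le hu.2.2.2).1
      · exact (H.met_between hn hq.1 hs' hu.1 hq.2.1 as' hu.2.1 h hus hq.2.2.2).1.symm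
    refine ⟨C q hq.1 s' hs' hq.2.1 as' hqs' hq.2.2.2 (hz' ▸ hqz.ne), le_csInf neA ?_, hsub⟩
    rintro _ ⟨u, hu, rfl⟩
    rcases le_or_gt u s' with h | h
    · exact H.sInf_le (hsub u hu h)
    · exact (H.sInf_le (hsub q hq hqs'.le)).trans (strict hq hu (hqs'.trans h)).le
  have CR : ∀ {q}, q ∈ history W pos n s s' → (z : WithTop P) < pos n q →
      HistorySeparates F W pos st lo hi n s q
      ∧ sSup A ≤ sSup (st '' history W pos n s q) ∧
      (∀ u ∈ history W pos n s s', s ≤ u → u ∈ history W pos n s q) := by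
    intro q hq hqz
    have hqs := order sA hq (hz ▸ hqz)
    have hsub : ∀ u ∈ history W pos n s s', s ≤ u → u ∈ history W pos n s q := by
      intro u hu hus
      refine ⟨hu.1, hu.2.1, hu.2.2.1, ?_⟩
      rcases le_total u q with h | h
      · exact (H.met_between hn hs hq.1 hu.1 as hq.2.1 hu.2.1 hus h hq.2.2.1.symm).2
      · exact (H.met_between hn hs hu.1 hq.1 as hu.2.1 hq.2.1 hqs.le h hu.2.2.1.symm).2.symm
    refine ⟨C s hs q hq.1 as hq.2.1 hqs hq.2.2.1.symm (hz ▸ hqz.ne), csSup_le neA ?_, hsub⟩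
    rintro _ ⟨u, hu, rfl⟩
    rcases le_or_gt s u with h | h
    · exact H.le_sSup (hsub u hu h)
    · exact (strict hu hq (h.trans hqs)).le.trans (H.le_sSup (hsub q hq hqs.le))
  -- the left end point of the jump is touching from the left of the history up to `b`: the waves
  -- of the jump close to it are divided from those on the left of the node, so that the history of
  -- one of the latter with `s'` touches arbitrarily close to `a`; `d` then extends it to `b`
  have TL : Touches F (sInf A) b a := by
    by_cases hex : ∃ q ∈ history W pos n s s', pos n q < z
    · obtain ⟨q, hq, hqz⟩ := hex
      -- a wave on the left of the node carries the state `a`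
      obtain ⟨q, hq, hqz, hqa⟩ : ∃ q ∈ history W pos n s s', pos n q < z ∧ st q = a := by
        rcases (left_le hq hqz).eq_or_lt with h | h
        · exact ⟨q, hq, hqz, h⟩
        · obtain ⟨q', hq', h1, h2, h3⟩ := fill hq sA h ms.1
          refine ⟨q', hq', ?_, h3⟩
          refine lt_of_le_of_ne (hz ▸ H.mono n hn q' hq'.1 s hs hq'.2.1 as h2.le) fun h4 => ?_
          exact absurd (H.mem n hn q' hq'.1 z h4).1 (by rw [h3]; exact lt_irrefl _)
      obtain ⟨C1, hα, hsub⟩ := CL hq hqz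
      have hqs' := order hq sA' (hz' ▸ hqz)
      have ta : Touches F (sInf (st '' history W pos n q s')) (sSup (st '' history W pos n q s'))
          a := by
        refine touches_of_forall_gt H.continuous (had.trans hd.2) fun w hw hw' => ?_
        obtain ⟨u, hu, hu1, hu2, hus⟩ := fill hq sA' (hqa ▸ hw) hw'
        have huz : pos n q ≠ pos n u := by
          intro h
          rcases lt_or_ge (pos n u) z with h' | h'
          · have := left_le hu h'
            linarith
          · exact absurd (h ▸ hqz) (not_lt.2 h')
        have := C1 q (hsub q hq hqs'.le) u (hsub u hu hu2.le) hu1 (Or.inl huz)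
        rwa [hqa, hus] at this
      exact (ta.mono hα (H.le_sSup (hsub s' sA' le_rfl))).extend_right hdt had hd.2.le
    · push Not at hex
      have : sInf A = a := by
        refine le_antisymm hαa (le_csInf neA ?_)
        rintro _ ⟨u, hu, rfl⟩
        rcases (hex u hu).eq_or_lt with h | h
        · exact (H.mem n hn u hu.1 z h.symm).1.le
        · exact (had.trans hdb).le.trans (right_gt hu h).le
      rw [this]
      exact touches_left _ _ _
  have TR : Touches F a (sSup A) b := by
    by_cases hex : ∃ q ∈ history W pos n s s', (z : WithTop P) < pos n q
    · obtain ⟨q, hq, hqz⟩ := hex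
      obtain ⟨C1, hγ, hsub⟩ := CR hq hqz
      have hqs := order sA hq (hz ▸ hqz)
      obtain ⟨p, hp, hpz, hpb⟩ := node ⟨had.trans hdb, le_rfl⟩
      have hps : s < p := by
        by_contra! h
        rcases h.eq_or_lt with h | h
        · rw [h] at hpb; linarith [ms'.2, hd.1, hd.2]
        · linarith [strict hp sA h, hd.1]
      have tb : Touches F (sInf (st '' history W pos n s q)) (sSup (st '' history W pos n s q))
          b := by
        refine touches_of_forall_gt H.continuous (right_gt hq hqz) fun w hw hw' => ?_
        obtain ⟨u, hu, hu1, hu2, hus⟩ := fill hp hq (hpb ▸ hw) hw'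
        have huz : pos n p ≠ pos n u := by
          intro h
          have := (H.mem n hn u hu.1 z (h ▸ hpz)).2
          linarith
        have := C1 p (hsub p hp hps.le) u (hsub u hu (hps.trans hu1).le) hu1 (Or.inl huz)
        rwa [hpb, hus] at this
      exact (tb.mono ((H.sInf_le (hsub s sA le_rfl)).trans le_rfl) hγ).extend_left hdt hdb hd.1
    · push Not at hex
      have : sSup A = b := by
        refine le_antisymm (csSup_le neA ?_) hbγ
        rintro _ ⟨u, hu, rfl⟩
        rcases (hex u hu).eq_or_lt with h | h
        · exact (H.mem n hn u hu.1 z h).2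
        · exact (left_le hu h).trans (had.trans hdb).le
      rw [this]
      exact touches_right _ _ _
  have Ta : Touches F (sInf A) (sSup A) a := TL.extend_right (TR.glue_left hdt hdb.le) had hdb.le
  have Tb : Touches F (sInf A) (sSup A) b := Ta.glue_right TR (had.trans hdb).le
  -- the dividing point comes from the history on the left, the jump at `z` or the history on the
  -- right, or is an end point of the jump if `p` and `p'` belong to different parts
  intro p hp p' hp' hpp hdiv
  rcases lt_trichotomy (pos n p) z with h | h | h
  · have hpa := left_le hp h
    rcases lt_trichotomy (pos n p') z with h' | h' | h'
    · obtain ⟨C1, hα, hsub⟩ := CL hp h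
      obtain ⟨y, hy, hyt⟩ := C1 p (hsub p hp (order hp sA' (hz' ▸ h)).le) p'
        (hsub p' hp' (order hp' sA' (hz' ▸ h')).le) hpp hdiv
      have := left_le hp' h'
      exact ⟨y, hy, Ta.glue_left (hyt.mono hα
        (ms'.1.le.trans (H.le_sSup (hsub s' sA' le_rfl)))) (hy.2.le.trans this)⟩
    · exact ⟨a, ⟨hpa, (H.mem n hn p' hp'.1 z h').1⟩, Ta⟩
    · exact ⟨a, ⟨hpa, (had.trans hdb).trans (right_gt hp' h')⟩, Ta⟩
  · have mp := H.mem n hn p hp.1 z h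
    rcases lt_trichotomy (pos n p') z with h' | h' | h'
    · exact absurd (order hp' hp (h.symm ▸ h')) (not_lt.2 hpp.le)
    · have mp' := H.mem n hn p' hp'.1 z h'
      rcases hdiv with hne | ⟨y, hy, w, hw, hwt⟩
      · exact absurd (h.trans h'.symm) hne
      · rw [h, WithTop.coe_inj] at hy
        subst hy
        exact ⟨w, hw, Ta.glue Tb hαa hwt (mp.1.le.trans hw.1) (hw.2.le.trans mp'.2)⟩
    · exact ⟨b, ⟨mp.2, right_gt hp' h'⟩, Tb⟩
  · have hpb := right_gt hp h
    rcases lt_or_ge (z : WithTop P) (pos n p') with h' | h'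
    · obtain ⟨C1, hγ, hsub⟩ := CR hp' h'
      obtain ⟨y, hy, hyt⟩ := C1 p (hsub p hp (order sA hp (hz ▸ h)).le) p'
        (hsub p' hp' (order sA hp' (hz ▸ h')).le) hpp hdiv
      exact ⟨y, hy, Tb.glue_right (hyt.mono ((H.sInf_le (hsub s sA le_rfl)).trans ms.2) hγ)
        (hpb.le.trans hy.1)⟩
    · exact absurd (order hp' hp (h'.trans_lt h)) (not_lt.2 hpp.le)

/-- In a system of waves, the Riemann problem spanned by the common history of two separated waves
separates the waves of that history that are separated. -/
theorem historySeparates (H : IsWaveSystem F N W pos st lo hi) (hn : n ≤ N) (hs : s ∈ W)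
    (hs' : s' ∈ W) (as : pos n s ≠ ⊤) (as' : pos n s' ≠ ⊤) (hss : s < s') (hm : Met pos n s s')
    (hdiv : Separated F pos st lo hi n s s') : HistorySeparates F W pos st lo hi n s s' := by
  -- at any time the case of a common node follows from that of different nodes
  have same : ∀ m ≤ N, (∀ u ∈ W, ∀ u' ∈ W, pos m u ≠ ⊤ → pos m u' ≠ ⊤ → u < u' → Met pos m u u' →
      pos m u ≠ pos m u' → HistorySeparates F W pos st lo hi m u u') →
      ∀ u ∈ W, ∀ u' ∈ W, pos m u ≠ ⊤ → pos m u' ≠ ⊤ → u < u' → Met pos m u u' →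
      Separated F pos st lo hi m u u' → HistorySeparates F W pos st lo hi m u u' := by
    intro m hmN C u hu u' hu' au au' huu hmet hsep
    by_cases h : pos m u = pos m u'
    · rcases hsep with h' | ⟨y, hy, w, hw, hwt⟩
      · exact absurd h h'
      · exact H.historySeparates_of_same_node hmN hu hu' huu hy (h ▸ hy) hw hwt C
    · exact C u hu u' hu' au au' huu hmet h
  induction n generalizing s s' with
  | zero =>
    refine same 0 hn (fun u hu u' hu' au au' huu ⟨k, hk, h⟩ hne => ?_) s hs s' hs' as as' hss hm hdiv
    obtain rfl : k = 0 := by omega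
    exact absurd h hne
  | succ n ih =>
    refine same (n + 1) hn (fun u hu u' hu' au au' huu hmet hne => ?_) s hs s' hs' as as' hss hm hdiv
    exact H.historySeparates_succ hn hu hu' au au' huu hmet hne fun hm0 hsep =>
      ih (by omega) hu hu' (H.alive_of_succ n hn u hu au) (H.alive_of_succ n hn u' hu' au') huu
        hm0 hsep

end IsWaveSystem

end ScalarWaves

namespace ScalarWaves

/-! ### The convex envelope of a monotone `1`-Lipschitz flux -/

/-- A flux all of whose chords have slopes in `[0, 1]`. -/
structure IsFlux (F : ℝ → ℝ) : Prop where
  mono : Monotone F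
  lip : ∀ x y, x ≤ y → F y - F x ≤ y - x

/-- The left derivative at `v` of the convex envelope of `F` on `[a, b]`. -/
noncomputable def leftSlope (F : ℝ → ℝ) (a b v : ℝ) : ℝ := derivWithin (convEnv F a b) (Iic v) v

variable {F : ℝ → ℝ} {a b : ℝ}

lemma IsFlux.continuous (hF : IsFlux F) : Continuous F := by
  refine (LipschitzWith.of_le_add fun x y => ?_).continuous
  rcases le_total x y with h | h
  · linarith [hF.mono h, dist_nonneg (x := x) (y := y)]
  · have := hF.lip y x h
    rw [Real.dist_eq, abs_of_nonneg (sub_nonneg.2 h)]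
    linarith

lemma bddAbove_convEnv {u : ℝ} (hu : u ∈ Icc a b) :
    BddAbove {y | ∃ g : ℝ → ℝ, ConvexOn ℝ (Icc a b) g ∧ (∀ v ∈ Icc a b, g v ≤ F v) ∧ g u = y} :=
  ⟨F u, by rintro _ ⟨g, -, hg, rfl⟩; exact hg u hu⟩

lemma le_convEnv {g : ℝ → ℝ} (hg : ConvexOn ℝ (Icc a b) g) (hgF : ∀ v ∈ Icc a b, g v ≤ F v) {u : ℝ}
    (hu : u ∈ Icc a b) : g u ≤ convEnv F a b u :=
  le_csSup (bddAbove_convEnv hu) ⟨g, hg, hgF, rfl⟩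

lemma convexOn_affine (k l : ℝ) (s : Set ℝ) (hs : Convex ℝ s) : ConvexOn ℝ s fun u => k * u + l := by
  refine ⟨hs, fun x _ y _ c d _ _ hcd => le_of_eq ?_⟩
  simp only [smul_eq_mul]
  linear_combination (l * (-1 : ℝ)) * hcd

lemma affine_le_convEnv {k l : ℝ} (h : ∀ v ∈ Icc a b, k * v + l ≤ F v) {u : ℝ} (hu : u ∈ Icc a b) :
    k * u + l ≤ convEnv F a b u :=
  le_convEnv (convexOn_affine k l _ (convex_Icc a b)) h hu

lemma convEnv_le (hF : IsFlux F) {u : ℝ} (hu : u ∈ Icc a b) : convEnv F a b u ≤ F u := by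
  refine csSup_le ⟨F a, fun _ => F a, convexOn_const _ (convex_Icc a b), fun v hv => hF.mono hv.1,
    rfl⟩ ?_
  rintro _ ⟨g, -, hg, rfl⟩
  exact hg u hu

lemma convexOn_convEnv (hF : IsFlux F) (a b : ℝ) : ConvexOn ℝ (Icc a b) (convEnv F a b) := by
  refine ⟨convex_Icc a b, fun x hx y hy c d hc hd hcd => ?_⟩
  refine csSup_le ⟨F a, fun _ => F a, convexOn_const _ (convex_Icc a b), fun v hv => hF.mono hv.1,
    rfl⟩ ?_
  rintro _ ⟨g, hg, hgF, rfl⟩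
  refine (hg.2 hx hy hc hd hcd).trans ?_
  simp only [smul_eq_mul]
  exact add_le_add (mul_le_mul_of_nonneg_left (le_convEnv hg hgF hx) hc)
    (mul_le_mul_of_nonneg_left (le_convEnv hg hgF hy) hd)

/-- At a touching point the flux has a supporting line. At the end points horizontal and diagonal
lines support it, since the slopes of its chords lie in `[0, 1]`. -/
lemma Touches.exists_support (hF : IsFlux F) {y : ℝ} (hy : y ∈ Icc a b) (h : Touches F a b y) :
    ∃ k, ∀ x ∈ Icc a b, F y + k * (x - y) ≤ F x := by
  rcases hy.1.eq_or_lt with rfl | hay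
  · exact ⟨0, fun x hx => by simpa using hF.mono hx.1⟩
  set S : Set ℝ := (fun x => (F y - F x) / (y - x)) '' Ico a y with hS
  have hb : ∀ s ∈ S, s ≤ 1 := by
    rintro _ ⟨x, hx, rfl⟩
    exact (div_le_one (sub_pos.2 hx.2)).2 (hF.lip x y hx.2.le)
  have hne : S.Nonempty := ⟨_, a, ⟨le_rfl, hay⟩, rfl⟩
  refine ⟨sSup S, fun x hx => ?_⟩
  rcases lt_trichotomy x y with hxy | rfl | hxy
  · have : (F y - F x) / (y - x) ≤ sSup S := le_csSup ⟨1, hb⟩ ⟨x, ⟨hx.1, hxy⟩, rfl⟩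
    rw [div_le_iff₀ (sub_pos.2 hxy)] at this
    linarith
  · simp
  · have : sSup S ≤ (F x - F y) / (x - y) := by
      refine csSup_le hne ?_
      rintro _ ⟨w, hw, rfl⟩
      rw [div_le_div_iff₀ (sub_pos.2 hw.2) (sub_pos.2 hxy)]
      exact h w ⟨hw.1, hw.2.le⟩ x ⟨hxy.le, hx.2⟩
    rw [le_div_iff₀ (sub_pos.2 hxy)] at this
    linarith

lemma Touches.convEnv_eq (hF : IsFlux F) {y : ℝ} (hy : y ∈ Icc a b) (h : Touches F a b y) :
    convEnv F a b y = F y := by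
  refine le_antisymm (convEnv_le hF hy) ?_
  obtain ⟨k, hk⟩ := h.exists_support hF hy
  have := affine_le_convEnv (F := F) (a := a) (b := b) (k := k) (l := F y - k * y)
    (fun v hv => by linarith [hk v hv]) hy
  linarith

/-- Between two consecutive touching points the envelope is affine. -/
lemma convEnv_affine_between (hF : IsFlux F) {e₁ e₂ : ℝ} (h₁ : Touches F a b e₁)
    (h₂ : Touches F a b e₂) (ha : a ≤ e₁) (hb : e₂ ≤ b) (he : e₁ < e₂)
    (hgap : ∀ w ∈ Ioo e₁ e₂, ¬ Touches F a b w) :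
    ∃ k l, ∀ u ∈ Icc e₁ e₂, convEnv F a b u = k * u + l := by
  set k := (F e₂ - F e₁) / (e₂ - e₁) with hk
  have hpos : 0 < e₂ - e₁ := sub_pos.2 he
  have hk' : F e₂ - F e₁ = k * (e₂ - e₁) := by rw [hk]; field_simp
  obtain ⟨m, hm, hmin⟩ := isCompact_Icc.exists_isMinOn (nonempty_Icc.2 he.le)
    (f := fun x => F x - k * x) (by have := hF.continuous; fun_prop)
  have hmin' : ∀ x ∈ Icc e₁ e₂, F m - k * m ≤ F x - k * x := fun x hx => hmin hx
  -- a minimizer of `F` minus the chord is a touching point, hence an end point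
  have hD : ∀ x ∈ Icc e₁ e₂, F e₁ - k * e₁ ≤ F x - k * x := by
    have hmt : Touches F e₁ e₂ m := by
      intro x hx z hz
      have h1 := hmin' x ⟨hx.1, hx.2.trans hm.2⟩
      have h2 := hmin' z ⟨hm.1.trans hz.1, hz.2⟩
      have h3 : F m - F x ≤ k * (m - x) := by linarith
      have h4 : k * (z - m) ≤ F z - F m := by linarith
      calc (F m - F x) * (z - m) ≤ k * (m - x) * (z - m) :=
            mul_le_mul_of_nonneg_right h3 (sub_nonneg.2 hz.1)
        _ = k * (z - m) * (m - x) := by ring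
        _ ≤ _ := mul_le_mul_of_nonneg_right h4 (sub_nonneg.2 hx.2)
    have hmt' := h₁.glue h₂ ha hmt hm.1 hm.2
    rcases hm.1.eq_or_lt with h | h
    · rw [← h] at hmin'; exact hmin'
    rcases hm.2.eq_or_lt with h' | h'
    · intro x hx
      have := hmin' x hx
      rw [h'] at this
      linarith
    · exact absurd hmt' (hgap m ⟨h, h'⟩)
  have hline : ∀ x ∈ Icc a b, k * x + (F e₁ - k * e₁) ≤ F x := by
    intro x hx
    rcases lt_or_ge x e₁ with h | h
    · have := h₁ x ⟨hx.1, h.le⟩ e₂ ⟨he.le, hb⟩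
      rw [hk'] at this
      have : F e₁ - F x ≤ k * (e₁ - x) := le_of_mul_le_mul_right (by linarith) hpos
      linarith
    rcases le_or_gt x e₂ with h' | h'
    · linarith [hD x ⟨h, h'⟩]
    · have := h₂ e₁ ⟨ha, he.le⟩ x ⟨h'.le, hx.2⟩
      rw [hk'] at this
      have : k * (x - e₂) ≤ F x - F e₂ := le_of_mul_le_mul_right (by linarith) hpos
      linarith
  refine ⟨k, F e₁ - k * e₁, fun u hu => le_antisymm ?_
    (affine_le_convEnv hline ⟨ha.trans hu.1, hu.2.trans hb⟩)⟩
  have ht₁ : (e₂ - u) / (e₂ - e₁) + (u - e₁) / (e₂ - e₁) = 1 := by field_simp; ring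
  have := (convexOn_convEnv hF a b).2 (x := e₁) (y := e₂) ⟨ha, he.le.trans hb⟩ ⟨ha.trans he.le, hb⟩
    (div_nonneg (sub_nonneg.2 hu.2) hpos.le) (div_nonneg (sub_nonneg.2 hu.1) hpos.le) ht₁
  rw [h₁.convEnv_eq hF ⟨ha, he.le.trans hb⟩, h₂.convEnv_eq hF ⟨ha.trans he.le, hb⟩] at this
  simp only [smul_eq_mul] at this
  have hu' : (e₂ - u) / (e₂ - e₁) * e₁ + (u - e₁) / (e₂ - e₁) * e₂ = u := by field_simp; ring
  rw [hu'] at this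
  refine this.trans (le_of_eq ?_)
  have : F e₂ = F e₁ + k * (e₂ - e₁) := by linarith
  rw [this]
  field_simp
  ring

/-- A subinterval without touching points lies in an interval on which the envelope is affine. -/
lemma convEnv_affine_of_gap (hF : IsFlux F) {p p' : ℝ} (hp : a < p) (hpp : p ≤ p') (hp' : p' ≤ b)
    (hgap : ∀ w ∈ Ico p p', ¬ Touches F a b w) (hpt : ¬ Touches F a b p) :
    ∃ e₁ e₂ k l, a ≤ e₁ ∧ e₁ < p ∧ p' ≤ e₂ ∧ e₂ ≤ b ∧ Touches F a b e₁ ∧ Touches F a b e₂ ∧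
      ∀ u ∈ Icc e₁ e₂, convEnv F a b u = k * u + l := by
  have cl := isClosed_touches hF.continuous a b
  obtain ⟨e₁, ⟨ht₁, ha₁, hp₁⟩, hmax⟩ : ∃ e, IsGreatest ({y | Touches F a b y} ∩ Icc a p) e :=
    (isCompact_Icc.inter_left cl).exists_isGreatest ⟨a, touches_left F _ _, le_rfl, hp.le⟩
  obtain ⟨e₂, ⟨ht₂, ha₂, hp₂⟩, hmin⟩ : ∃ e, IsLeast ({y | Touches F a b y} ∩ Icc p' b) e :=
    (isCompact_Icc.inter_left cl).exists_isLeast ⟨b, touches_right F _ _, hp', le_rfl⟩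
  have hlt : e₁ < p := lt_of_le_of_ne hp₁ fun h => hpt (h ▸ ht₁)
  obtain ⟨k, l, h⟩ := convEnv_affine_between hF ht₁ ht₂ ha₁ hp₂ (hlt.trans_le (hpp.trans ha₂))
    fun w hw ht => by
      rcases le_or_gt w p with h | h
      · exact absurd (hmax ⟨ht, ha₁.trans hw.1.le, h⟩) (not_le.2 hw.1)
      rcases lt_or_ge w p' with h' | h'
      · exact hgap w ⟨h.le, h'⟩ ht
      · exact absurd (hmin ⟨ht, h', hw.2.le.trans hp₂⟩) (not_le.2 hw.2)
  exact ⟨e₁, e₂, k, l, ha₁, hlt, ha₂, hp₂, ht₁, ht₂, h⟩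

/-- On a subinterval on which the flux is affine, so is its envelope. -/
lemma convEnv_affine_of_affine (hF : IsFlux F) {c d k l : ℝ} (hc : a ≤ c) (hcd : c < d) (hd : d ≤ b)
    (h : ∀ u ∈ Icc c d, F u = k * u + l) :
    ∃ k' l', ∀ u ∈ Icc c d, convEnv F a b u = k' * u + l' := by
  by_cases ht : ∃ m ∈ Ioo c d, Touches F a b m
  · obtain ⟨m, hm, ht⟩ := ht
    obtain ⟨k', hk'⟩ := ht.exists_support hF ⟨hc.trans hm.1.le, hm.2.le.trans hd⟩
    have h1 := hk' c ⟨hc, hcd.le.trans hd⟩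
    have h2 := hk' d ⟨hc.trans hcd.le, hd⟩
    rw [h m ⟨hm.1.le, hm.2.le⟩, h c ⟨le_rfl, hcd.le⟩] at h1
    rw [h m ⟨hm.1.le, hm.2.le⟩, h d ⟨hcd.le, le_rfl⟩] at h2
    -- a line supporting an affine function at an interior point coincides with it
    have hkk : k' = k := by
      refine le_antisymm ?_ ?_
      · refine le_of_mul_le_mul_right ?_ (sub_pos.2 hm.2)
        linarith
      · refine le_of_mul_le_mul_right ?_ (sub_pos.2 hm.1)
        linarith
    subst hkk
    refine ⟨k', l, fun u hu => le_antisymm ?_ ?_⟩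
    · rw [← h u hu]; exact convEnv_le hF ⟨hc.trans hu.1, hu.2.trans hd⟩
    · refine affine_le_convEnv (fun v hv => ?_) ⟨hc.trans hu.1, hu.2.trans hd⟩
      have := hk' v hv
      rw [h m ⟨hm.1.le, hm.2.le⟩] at this
      linarith
  · push Not at ht
    obtain ⟨m, hm⟩ := exists_between hcd
    obtain ⟨e₁, e₂, k', l', -, h1, h2, -, ht₁, ht₂, haff⟩ := convEnv_affine_of_gap hF
      (hc.trans_lt hm.1) le_rfl (hm.2.le.trans hd) (by simp) (ht m hm)
    refine ⟨k', l', fun u hu => haff u ⟨?_, ?_⟩⟩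
    · refine le_trans ?_ hu.1
      by_contra! hlt
      exact ht e₁ ⟨hlt, h1.trans hm.2⟩ ht₁
    · refine hu.2.trans ?_
      by_contra! hlt
      exact ht e₂ ⟨hm.1.trans_le h2, hlt⟩ ht₂

/-! ### Slopes of the envelope -/

lemma hasDerivWithinAt_of_affine {g : ℝ → ℝ} {c d k l v : ℝ} (h : ∀ u ∈ Icc c d, g u = k * u + l)
    (hv : v ∈ Ioc c d) : HasDerivWithinAt g k (Iic v) v := by
  have h1 : HasDerivWithinAt (fun u => k * u + l) k (Iic v) v := by
    simpa using ((hasDerivAt_id v).const_mul k).add_const l |>.hasDerivWithinAt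
  refine h1.congr_of_eventuallyEq ?_ (h v ⟨hv.1.le, hv.2⟩)
  filter_upwards [Icc_mem_nhdsLE hv.1] with u hu
  exact h u ⟨hu.1, hu.2.trans hv.2⟩

lemma leftSlope_of_affine {c d k l v : ℝ} (h : ∀ u ∈ Icc c d, convEnv F a b u = k * u + l)
    (hv : v ∈ Ioc c d) : leftSlope F a b v = k :=
  (hasDerivWithinAt_of_affine h hv).derivWithin (uniqueDiffWithinAt_Iic v)

lemma deriv_of_affine {g : ℝ → ℝ} {c d k l v : ℝ} (h : ∀ u ∈ Icc c d, g u = k * u + l)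
    (hv : v ∈ Ioo c d) : HasDerivAt g k v := by
  have h1 : HasDerivAt (fun u => k * u + l) k v := by
    simpa using ((hasDerivAt_id v).const_mul k).add_const l
  refine h1.congr_of_eventuallyEq ?_
  filter_upwards [Icc_mem_nhds hv.1 hv.2] with u hu
  exact h u hu

/-- States of a Riemann problem with no touching point between them travel at the same speed. -/
lemma leftSlope_eq_of_gap (hF : IsFlux F) {p p' : ℝ} (hp : a < p) (hpp : p < p') (hp' : p' ≤ b)
    (hgap : ∀ w ∈ Ico p p', ¬ Touches F a b w) : leftSlope F a b p = leftSlope F a b p' := by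
  obtain ⟨e₁, e₂, k, l, -, h1, h2, -, -, -, h⟩ := convEnv_affine_of_gap hF hp hpp.le hp' hgap
    (hgap p ⟨le_rfl, hpp⟩)
  rw [leftSlope_of_affine h ⟨h1, hpp.le.trans h2⟩, leftSlope_of_affine h ⟨h1.trans hpp, h2⟩]

lemma slope_convEnv_le_one (hF : IsFlux F) {x v : ℝ} (hx : a ≤ x) (hxv : x < v) (hv : v ≤ b) :
    slope (convEnv F a b) v x ≤ 1 := by
  have hb : b ∈ Icc a b := ⟨hx.trans (hxv.le.trans hv), le_rfl⟩
  have h1 : slope (convEnv F a b) x v ≤ slope (convEnv F a b) x b := by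
    simp only [slope_def_field]
    exact (convexOn_convEnv hF a b).secant_mono ⟨hx, hxv.le.trans hv⟩ ⟨hx.trans hxv.le, hv⟩
      hb hxv.ne' (hxv.trans_le hv).ne' hv
  rw [slope_comm]
  refine h1.trans ?_
  rw [slope_def_field, div_le_one (sub_pos.2 (hxv.trans_le hv))]
  have h2 : convEnv F a b b = F b := (touches_right F a b).convEnv_eq hF hb
  have h3 := affine_le_convEnv (F := F) (a := a) (b := b) (k := 1) (l := F b - b) (u := x)
    (fun w hw => by linarith [hF.lip w b hw.2]) ⟨hx, hxv.le.trans hv⟩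
  linarith

lemma hasDerivWithinAt_leftSlope (hF : IsFlux F) {v : ℝ} (hv : v ∈ Ioc a b) :
    HasDerivWithinAt (convEnv F a b) (leftSlope F a b v) (Iic v) v := by
  have hv' : v ∈ Icc a b := ⟨hv.1.le, hv.2⟩
  suffices DifferentiableWithinAt ℝ (convEnv F a b) (Iio v) v by
    have h2 : DifferentiableWithinAt ℝ (convEnv F a b) (Iic v) v := by
      rw [← hasDerivWithinAt_derivWithin_iff] at this ⊢
      exact (hasDerivWithinAt_Iio_iff_Iic.1 this).differentiableWithinAt.hasDerivWithinAt
    exact h2.hasDerivWithinAt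
  refine HasDerivWithinAt.differentiableWithinAt
    (f' := sSup (slope (convEnv F a b) v '' Ioo a v)) ?_
  rw [hasDerivWithinAt_iff_tendsto_slope' self_notMem_Iio]
  refine MonotoneOn.tendsto_nhdsWithin_Ioo_left (nonempty_Ioo.2 hv.1) ?_ ⟨1, ?_⟩
  · exact ((convexOn_convEnv hF a b).monotoneOn_slope_lt hv').mono
      fun x hx => ⟨⟨hx.1.le, hx.2.le.trans hv.2⟩, hx.2⟩
  · rintro _ ⟨x, hx, rfl⟩
    exact slope_convEnv_le_one hF hx.1.le hx.2 hv.2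

lemma slope_le_leftSlope (hF : IsFlux F) {x v : ℝ} (hx : a ≤ x) (hxv : x < v) (hv : v ≤ b) :
    slope (convEnv F a b) x v ≤ leftSlope F a b v :=
  (convexOn_convEnv hF a b).slope_le_of_hasDerivWithinAt_Iio ⟨hx, hxv.le.trans hv⟩
    ⟨hx.trans hxv.le, hv⟩ hxv ((hasDerivWithinAt_leftSlope hF ⟨hx.trans_lt hxv, hv⟩).mono
      Iio_subset_Iic_self)

lemma leftSlope_le_of_forall (hF : IsFlux F) {v c : ℝ} (hv : v ∈ Ioc a b)
    (h : ∀ x, a ≤ x → x < v → slope (convEnv F a b) x v ≤ c) : leftSlope F a b v ≤ c := by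
  have h1 := (hasDerivWithinAt_leftSlope hF hv).mono (Iio_subset_Iic_self (a := v))
  rw [hasDerivWithinAt_iff_tendsto_slope' self_notMem_Iio] at h1
  refine le_of_tendsto h1 ?_
  filter_upwards [Ioo_mem_nhdsLT hv.1] with x hx
  rw [slope_comm]
  exact h x hx.1.le hx.2

lemma leftSlope_mono (hF : IsFlux F) {v w : ℝ} (hv : a < v) (hvw : v ≤ w) (hw : w ≤ b) :
    leftSlope F a b v ≤ leftSlope F a b w := by
  rcases hvw.eq_or_lt with rfl | hvw
  · rfl
  refine leftSlope_le_of_forall hF ⟨hv, hvw.le.trans hw⟩ fun x hx hxv => ?_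
  refine le_trans ?_ (slope_le_leftSlope hF hv.le hvw hw)
  simp only [slope_def_field]
  exact (convexOn_convEnv hF a b).slope_mono_adjacent ⟨hx, hxv.le.trans (hvw.le.trans hw)⟩
    ⟨hv.le.trans hvw.le, hw⟩ hxv hvw

/-! ### The Riemann solver -/

lemma riemann_mem (hab : a ≤ b) (c : ℝ) : riemann F a b c ∈ Icc a b := by
  rw [riemann, if_pos hab]
  have hb : BddAbove ({a} ∪ {v | v ∈ Ioc a b ∧ derivWithin (convEnv F a b) (Iic v) v ≤ c}) := by
    refine ⟨b, ?_⟩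
    rintro v (rfl | hv)
    exacts [hab, hv.1.2]
  refine ⟨le_csSup hb (Or.inl rfl), csSup_le ⟨a, Or.inl rfl⟩ ?_⟩
  rintro v (rfl | hv)
  exacts [hab, hv.1.2]

/-- The Riemann solver is the right continuous inverse of the slope of the envelope. -/
lemma le_riemann_iff (hF : IsFlux F) {w c : ℝ} (hw : w ∈ Ioc a b) :
    w ≤ riemann F a b c ↔ leftSlope F a b w ≤ c := by
  have hab : a ≤ b := hw.1.le.trans hw.2
  set R := riemann F a b c with hR
  rw [riemann, if_pos hab] at hR
  have hb : BddAbove ({a} ∪ {v | v ∈ Ioc a b ∧ derivWithin (convEnv F a b) (Iic v) v ≤ c}) := by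
    refine ⟨b, ?_⟩
    rintro v (rfl | hv)
    exacts [hab, hv.1.2]
  have key : ∀ v, a < v → v < R → leftSlope F a b v ≤ c := by
    intro v hv hvR
    obtain ⟨x, hx, hvx⟩ := exists_lt_of_lt_csSup ⟨a, Or.inl rfl⟩ (hR ▸ hvR)
    rcases hx with rfl | hx
    · exact absurd hv (not_lt.2 hvx.le)
    · exact (leftSlope_mono hF hv hvx.le hx.1.2).trans hx.2
  constructor
  · intro hwR
    rcases hwR.lt_or_eq with h | h
    · exact key w hw.1 h
    · refine leftSlope_le_of_forall hF hw fun x hx hxw => ?_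
      have hc := ((hasDerivWithinAt_leftSlope hF hw).continuousWithinAt).mono
        (Iio_subset_Iic_self (a := w))
      have ht : Filter.Tendsto (fun v => convEnv F a b v - convEnv F a b x) (nhdsWithin w (Iio w))
          (nhds (convEnv F a b w - convEnv F a b x)) := hc.tendsto.sub_const _
      have ht' : Filter.Tendsto (fun v => c * (v - x)) (nhdsWithin w (Iio w))
          (nhds (c * (w - x))) :=
        ((by fun_prop : Continuous fun v => c * (v - x)).tendsto w).mono_left nhdsWithin_le_nhds
      rw [slope_def_field, div_le_iff₀ (sub_pos.2 hxw)]
      refine le_of_tendsto_of_tendsto ht ht' ?_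
      filter_upwards [Ioo_mem_nhdsLT hxw] with v hv
      have h1 := (slope_le_leftSlope hF hx hv.1 (hv.2.le.trans hw.2)).trans
        (key v (hx.trans_lt hv.1) (h ▸ hv.2))
      rwa [slope_def_field, div_le_iff₀ (sub_pos.2 hv.1)] at h1
  · intro h
    rw [hR]
    exact le_csSup hb (Or.inr ⟨hw, h⟩)

lemma riemann_self (F : ℝ → ℝ) (a c : ℝ) : riemann F a a c = a := by
  have := riemann_mem (F := F) (le_refl a) c
  exact le_antisymm this.2 this.1

/-! ### Reflection of states -/

/-- The flux governing `-u` when `u` is governed by `f`. -/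
def reflect (f : ℝ → ℝ) (u : ℝ) : ℝ := -f (-u)

@[simp] lemma reflect_reflect (f : ℝ → ℝ) : reflect (reflect f) = f := by
  funext u; simp [reflect]

lemma convexOn_reflect {g : ℝ → ℝ} (hg : ConcaveOn ℝ (Icc a b) g) :
    ConvexOn ℝ (Icc (-b) (-a)) (reflect g) := by
  refine ⟨convex_Icc _ _, fun x hx y hy c d hc hd hcd => ?_⟩
  have := hg.2 (x := -x) (y := -y) ⟨by linarith [hx.2], by linarith [hx.1]⟩
    ⟨by linarith [hy.2], by linarith [hy.1]⟩ hc hd hcd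
  simp only [reflect, smul_eq_mul] at this ⊢
  rw [show -(c * x + d * y) = c * -x + d * -y by ring]
  linarith

lemma concaveOn_reflect {g : ℝ → ℝ} (hg : ConvexOn ℝ (Icc a b) g) :
    ConcaveOn ℝ (Icc (-b) (-a)) (reflect g) := by
  refine ⟨convex_Icc _ _, fun x hx y hy c d hc hd hcd => ?_⟩
  have := hg.2 (x := -x) (y := -y) ⟨by linarith [hx.2], by linarith [hx.1]⟩
    ⟨by linarith [hy.2], by linarith [hy.1]⟩ hc hd hcd
  simp only [reflect, smul_eq_mul] at this ⊢
  rw [show -(c * x + d * y) = c * -x + d * -y by ring]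
  linarith

lemma concEnv_eq_reflect (f : ℝ → ℝ) (a b u : ℝ) :
    concEnv f a b u = -convEnv (reflect f) (-b) (-a) (-u) := by
  rw [concEnv, convEnv, ← Real.sInf_neg]
  congr 1
  ext y
  simp only [Set.mem_neg, Set.mem_ofPred_eq]
  constructor
  · rintro ⟨g, hg, hgf, rfl⟩
    refine ⟨reflect g, convexOn_reflect hg, fun v hv => ?_, by simp [reflect]⟩
    have := hgf (-v) ⟨by linarith [hv.2], by linarith [hv.1]⟩
    simp only [reflect]
    linarith
  · rintro ⟨g, hg, hgf, h⟩
    refine ⟨reflect g, by simpa using concaveOn_reflect hg, fun v hv => ?_, by simp [reflect, h]⟩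
    have := hgf (-v) ⟨by linarith [hv.2], by linarith [hv.1]⟩
    simp only [reflect, neg_neg] at this ⊢
    linarith

lemma convEnv_eq_reflect (f : ℝ → ℝ) (a b u : ℝ) :
    convEnv f a b u = -concEnv (reflect f) (-b) (-a) (-u) := by
  rw [concEnv_eq_reflect]; simp

lemma concEnv_eq_reflect_fun (f : ℝ → ℝ) (a b : ℝ) :
    concEnv f a b = reflect (convEnv (reflect f) (-b) (-a)) := by
  funext u; exact concEnv_eq_reflect f a b u

lemma convEnv_eq_reflect_fun (f : ℝ → ℝ) (a b : ℝ) :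
    convEnv f a b = reflect (concEnv (reflect f) (-b) (-a)) := by
  funext u; exact convEnv_eq_reflect f a b u

lemma derivWithin_reflect (g : ℝ → ℝ) (s : Set ℝ) (v : ℝ) :
    derivWithin (reflect g) s v = derivWithin g (-s) (-v) := by
  have h : reflect g = fun u => -((fun x => g (-x)) u) := rfl
  rw [h, derivWithin.fun_neg, derivWithin_comp_neg]
  simp

lemma deriv_reflect (g : ℝ → ℝ) (v : ℝ) : deriv (reflect g) v = deriv g (-v) := by
  simpa using derivWithin_reflect g univ v

lemma riemann_reflect (f : ℝ → ℝ) (a b c : ℝ) :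
    riemann (reflect f) (-a) (-b) c = -riemann f a b c := by
  have key : ∀ (f : ℝ → ℝ) (a b : ℝ), b < a →
      riemann f a b c = -riemann (reflect f) (-a) (-b) c := by
    intro f a b hab
    rw [riemann, if_neg (not_le.2 hab), riemann, if_pos (neg_le_neg hab.le), ← Real.sInf_neg]
    congr 1
    ext v
    simp only [Set.mem_neg, Set.mem_union, Set.mem_singleton_iff, Set.mem_ofPred_eq, neg_inj,
      concEnv_eq_reflect_fun, derivWithin_reflect, Set.neg_Ici, Set.mem_Ioc, Set.mem_Ico,
      neg_lt_neg_iff, neg_le_neg_iff]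
    tauto
  rcases lt_trichotomy a b with h | rfl | h
  · rw [key _ _ _ (neg_lt_neg h)]; simp
  · simp [riemann_self]
  · rw [key _ _ _ h]; simp

lemma IsFlux.reflect (hF : IsFlux F) : IsFlux (reflect F) :=
  ⟨fun x y h => neg_le_neg (hF.mono (neg_le_neg h)), fun x y h => by
    have := hF.lip (-y) (-x) (neg_le_neg h)
    simp only [ScalarWaves.reflect]
    linarith⟩

lemma riemann_mem_of_ge (hab : b ≤ a) (c : ℝ) : riemann F a b c ∈ Icc b a := by
  have := riemann_mem (F := reflect F) (neg_le_neg hab) c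
  rw [riemann_reflect] at this
  exact ⟨by linarith [this.2], by linarith [this.1]⟩

end ScalarWaves

namespace ScalarWaves

/-! ### Locally step functions and the labels of their waves -/

/-- A right continuous function that is constant on a one-sided neighbourhood of each point. -/
def IsLocStep (v : ℝ → ℝ) : Prop :=
  ∀ x, ∃ δ > 0, (∀ y ∈ Ico x (x + δ), v y = v x) ∧ ∀ y ∈ Ioo (x - δ) x, v y = leftLim v x

variable {v : ℝ → ℝ} {x r w : ℝ}

lemma leftLim_eq_of_const {l δ : ℝ} (hδ : 0 < δ) (h : ∀ y ∈ Ioo (x - δ) x, v y = l) :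
    leftLim v x = l := by
  refine leftLim_eq_of_tendsto ?_
  refine tendsto_const_nhds.congr' ?_
  filter_upwards [Ioo_mem_nhdsLT (by linarith : x - δ < x)] with y hy
  exact (h y hy).symm

lemma isLocStep_of (h : ∀ x, ∃ l, ∃ δ > 0, (∀ y ∈ Ico x (x + δ), v y = v x) ∧
    ∀ y ∈ Ioo (x - δ) x, v y = l) : IsLocStep v := by
  intro x
  obtain ⟨l, δ, hδ, h1, h2⟩ := h x
  exact ⟨δ, hδ, h1, fun y hy => (h2 y hy).trans (leftLim_eq_of_const hδ h2).symm⟩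

lemma IsLocStep.comp (hv : IsLocStep v) (φ : ℝ → ℝ) : IsLocStep fun x => φ (v x) := by
  refine isLocStep_of fun x => ?_
  obtain ⟨δ, hδ, h1, h2⟩ := hv x
  exact ⟨φ (leftLim v x), δ, hδ, fun y hy => by simp [h1 y hy], fun y hy => by simp [h2 y hy]⟩

lemma IsLocStep.leftLim_comp (hv : IsLocStep v) (φ : ℝ → ℝ) (x : ℝ) :
    leftLim (fun x => φ (v x)) x = φ (leftLim v x) := by
  obtain ⟨δ, hδ, h1, h2⟩ := hv x
  exact leftLim_eq_of_const hδ fun y hy => by simp [h2 y hy]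

lemma IsLocStep.leftLim_neg (hv : IsLocStep v) (x : ℝ) : leftLim (-v) x = -leftLim v x :=
  hv.leftLim_comp (fun y => -y) x

lemma IsLocStep.sub {u : ℝ → ℝ} (hv : IsLocStep v) (hu : IsLocStep u) :
    IsLocStep (fun x => v x - u x) ∧
      ∀ x, leftLim (fun x => v x - u x) x = leftLim v x - leftLim u x := by
  have key : ∀ x, ∃ δ > 0, (∀ y ∈ Ico x (x + δ), v y - u y = v x - u x) ∧
      ∀ y ∈ Ioo (x - δ) x, v y - u y = leftLim v x - leftLim u x := by
    intro x
    obtain ⟨δ, hδ, h1, h2⟩ := hv x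
    obtain ⟨η, hη, h3, h4⟩ := hu x
    refine ⟨min δ η, lt_min hδ hη, fun y hy => ?_, fun y hy => ?_⟩
    · rw [h1 y ⟨hy.1, by linarith [hy.2, min_le_left δ η]⟩,
        h3 y ⟨hy.1, by linarith [hy.2, min_le_right δ η]⟩]
    · rw [h2 y ⟨by linarith [hy.1, min_le_left δ η], hy.2⟩,
        h4 y ⟨by linarith [hy.1, min_le_right δ η], hy.2⟩]
  refine ⟨isLocStep_of fun x => ?_, fun x => ?_⟩
  · obtain ⟨δ, hδ, h⟩ := key x
    exact ⟨_, δ, hδ, h⟩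
  · obtain ⟨δ, hδ, h⟩ := key x
    exact leftLim_eq_of_const hδ h.2

/-- A locally step function without jumps is constant. -/
lemma IsLocStep.eq_of_no_jump (hv : IsLocStep v) (h : ∀ x, leftLim v x = v x) (x y : ℝ) :
    v x = v y := by
  have : IsLocallyConstant v := by
    rw [IsLocallyConstant.iff_eventually_eq]
    intro x
    obtain ⟨δ, hδ, h1, h2⟩ := hv x
    filter_upwards [Ioo_mem_nhds (by linarith : x - δ < x) (by linarith : x < x + δ)] with y hy
    rcases lt_or_ge y x with hyx | hyx
    · rw [h2 y ⟨hy.1, hyx⟩, h x]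
    · exact h1 y ⟨hyx, hy.2⟩
  exact this.apply_eq_of_isPreconnected isPreconnected_univ (mem_univ x) (mem_univ y)

/-- Intermediate value property of locally step functions: a state above the value at `y` and not
above the left limit at `y'` is crossed upwards by a jump between `y` and `y'`. -/
lemma IsLocStep.exists_jump (hv : IsLocStep v) {y y' : ℝ} (hyy : y < y') (hw : v y < w)
    (hw' : w ≤ leftLim v y') : ∃ z ∈ Ioo y y', w ∈ Ioc (leftLim v z) (v z) := by
  set S := {z | y < z ∧ w ≤ v z} with hS
  have hb : BddBelow S := ⟨y, fun z hz => hz.1.le⟩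
  obtain ⟨δ, hδ, h1, h2⟩ := hv y
  obtain ⟨δ', hδ', h1', h2'⟩ := hv y'
  obtain ⟨z₀, hz₀, hz₀'⟩ := exists_between (max_lt hyy (by linarith : y' - δ' < y'))
  have hz₀S : z₀ ∈ S := ⟨(le_max_left _ _).trans_lt hz₀, by
    rw [h2' z₀ ⟨(le_max_right _ _).trans_lt hz₀, hz₀'⟩]; exact hw'⟩
  set z := sInf S with hz
  have hyz : y + δ ≤ z := by
    refine le_csInf ⟨z₀, hz₀S⟩ fun t ht => ?_
    by_contra! hlt
    have := h1 t ⟨ht.1.le, hlt⟩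
    have := ht.2
    linarith
  obtain ⟨η, hη, h3, h4⟩ := hv z
  refine ⟨z, ⟨by linarith, (csInf_le hb hz₀S).trans_lt hz₀'⟩, ?_, ?_⟩
  · obtain ⟨t, ht, ht'⟩ := exists_between (max_lt (by linarith : y < z) (by linarith : z - η < z))
    rw [← h4 t ⟨(le_max_right _ _).trans_lt ht, ht'⟩]
    by_contra! hle
    exact absurd (csInf_le hb (⟨(le_max_left _ _).trans_lt ht, hle⟩ : t ∈ S)) (not_le.2 ht')
  · obtain ⟨t, ht, ht'⟩ := exists_lt_of_csInf_lt ⟨z₀, hz₀S⟩ (by linarith : z < z + η)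
    rw [← h3 t ⟨csInf_le hb ht, ht'⟩]
    exact ht.2

/-! #### The variation function -/

lemma eVariationOn_neg (v : ℝ → ℝ) (s : Set ℝ) : eVariationOn (-v) s = eVariationOn v s := by
  simp [eVariationOn, edist_neg_neg]

lemma boundedVariationOn_neg (hb : BoundedVariationOn v univ) : BoundedVariationOn (-v) univ := by
  rw [BoundedVariationOn, eVariationOn_neg]; exact hb

lemma varUpTo_mono (hb : BoundedVariationOn v univ) : Monotone (varUpTo v) := fun _ _ hxy =>
  ENNReal.toReal_mono (hb.mono (subset_univ _)) (eVariationOn.mono v (Iic_subset_Iic.2 hxy))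

lemma varUpTo_le_totVar (hb : BoundedVariationOn v univ) (x : ℝ) : varUpTo v x ≤ totVar v :=
  ENNReal.toReal_mono hb (eVariationOn.mono v (subset_univ _))

lemma eVariationOn_eq_zero_of_const {s : Set ℝ} {l : ℝ} (h : ∀ y ∈ s, v y = l) :
    eVariationOn v s = 0 := by
  refine eVariationOn.constant_on ?_
  rintro _ ⟨a, ha, rfl⟩ _ ⟨b, hb, rfl⟩
  rw [h a ha, h b hb]

lemma eVariationOn_Iio_eq {y l : ℝ} (hy : y < x) (h : ∀ z ∈ Ico y x, v z = l) :
    (eVariationOn v (Iio x)).toReal = varUpTo v y := by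
  have := eVariationOn.union v (isGreatest_Iic (a := y)) (isLeast_Ico hy)
  rw [Iic_union_Ico_eq_Iio hy, eVariationOn_eq_zero_of_const (s := Ico y x) h, add_zero] at this
  rw [varUpTo, this]

lemma varUpTo_eq_of_const {y l : ℝ} (hy : x ≤ y) (h : ∀ z ∈ Icc x y, v z = l) :
    varUpTo v y = varUpTo v x := by
  have := eVariationOn.union v (isGreatest_Iic (a := x)) (isLeast_Icc hy)
  rw [Iic_union_Icc_eq_Iic hy, eVariationOn_eq_zero_of_const (s := Icc x y) h, add_zero] at this
  rw [varUpTo, varUpTo, this]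

lemma isLocStep_varUpTo (hv : IsLocStep v) : IsLocStep (varUpTo v) := by
  refine isLocStep_of fun x => ?_
  obtain ⟨δ, hδ, h1, h2⟩ := hv x
  exact ⟨(eVariationOn v (Iio x)).toReal, δ, hδ,
    fun y hy => varUpTo_eq_of_const hy.1 fun z hz => h1 z ⟨hz.1, hz.2.trans_lt hy.2⟩,
    fun y hy => (eVariationOn_Iio_eq hy.2 fun z hz => h2 z ⟨hy.1.trans_le hz.1, hz.2⟩).symm⟩

lemma leftLim_varUpTo (hv : IsLocStep v) (x : ℝ) :
    leftLim (varUpTo v) x = (eVariationOn v (Iio x)).toReal := by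
  obtain ⟨δ, hδ, h1, h2⟩ := hv x
  exact leftLim_eq_of_const hδ fun y hy =>
    (eVariationOn_Iio_eq hy.2 fun z hz => h2 z ⟨hy.1.trans_le hz.1, hz.2⟩).symm

/-- The variation function jumps by the absolute value of the jump. -/
lemma varUpTo_eq (hb : BoundedVariationOn v univ) (hv : IsLocStep v) (x : ℝ) :
    varUpTo v x = leftLim (varUpTo v) x + |v x - leftLim v x| := by
  rw [leftLim_varUpTo hv, varUpTo, hb.eVariationOn_Iic_eq_Iio_add_edist,
    ENNReal.toReal_add (hb.mono (subset_univ _)) (edist_ne_top _ _), edist_dist,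
    ENNReal.toReal_ofReal dist_nonneg, Real.dist_eq]

lemma exists_varUpTo_lt (hb : BoundedVariationOn v univ) (hr : 0 < r) :
    ∃ x, varUpTo v x < r := by
  have h := hb.tendsto_eVariationOn_Iic_zero
  simp only [univ_inter, Filter.principal_univ, top_inf_eq] at h
  obtain ⟨x, hx⟩ := (h.eventually_lt_const (ENNReal.ofReal_pos.2 hr)).exists
  exact ⟨x, by rw [varUpTo]; exact (ENNReal.lt_ofReal_iff_toReal_lt hx.ne_top).1 hx⟩

/-! #### Labels -/

/-- The wave with label `r` starts at `x` if and only if `r` lies in the jump of the variation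
function at `x`. -/
lemma initPos_eq_iff (hb : BoundedVariationOn v univ) (hv : IsLocStep v) (hr : 0 < r) :
    initPos v r = x ↔ leftLim (varUpTo v) x < r ∧ r ≤ varUpTo v x := by
  have uniq : ∀ x y, leftLim (varUpTo v) x < r ∧ r ≤ varUpTo v x →
      leftLim (varUpTo v) y < r ∧ r ≤ varUpTo v y → x ≤ y := by
    intro x y hx hy
    by_contra! hlt
    have := (varUpTo_mono hb).le_leftLim hlt
    linarith [hx.1, hy.2]
  by_cases hex : ∃ x, r ≤ varUpTo v x
  · rw [initPos, if_pos hex, WithTop.coe_inj]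
    set S := {x | r ≤ varUpTo v x} with hS
    obtain ⟨z, hz⟩ := exists_varUpTo_lt hb hr
    have hbdd : BddBelow S := ⟨z, fun y hy => by
      by_contra! hlt
      exact absurd (varUpTo_mono hb hlt.le) (not_le.2 (hz.trans_le hy))⟩
    have h0 : leftLim (varUpTo v) (sInf S) < r ∧ r ≤ varUpTo v (sInf S) := by
      obtain ⟨δ, hδ, h1, h2⟩ := isLocStep_varUpTo hv (sInf S)
      constructor
      · rw [← h2 (sInf S - δ / 2) ⟨by linarith, by linarith⟩]
        by_contra! hle
        have := csInf_le hbdd (show sInf S - δ / 2 ∈ S from hle)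
        linarith
      · obtain ⟨t, ht, ht'⟩ := exists_lt_of_csInf_lt hex (by linarith : sInf S < sInf S + δ)
        rw [← h1 t ⟨csInf_le hbdd ht, ht'⟩]
        exact ht
    exact ⟨fun h => h ▸ h0, fun h => le_antisymm (uniq _ _ h0 h) (uniq _ _ h h0)⟩
  · rw [initPos, if_neg hex]
    push Not at hex
    exact ⟨fun h => absurd h.symm (WithTop.coe_ne_top), fun h => absurd h.2 (not_le.2 (hex x))⟩

lemma initPos_mono (hb : BoundedVariationOn v univ) (hv : IsLocStep v) {r' : ℝ} (hr : 0 < r)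
    (hrr : r ≤ r') (h : initPos v r ≠ ⊤) (h' : initPos v r' ≠ ⊤) : initPos v r ≤ initPos v r' := by
  obtain ⟨x, hx⟩ := WithTop.ne_top_iff_exists.1 h
  obtain ⟨y, hy⟩ := WithTop.ne_top_iff_exists.1 h'
  have h1 := (initPos_eq_iff hb hv hr).1 hx.symm
  have h2 := (initPos_eq_iff hb hv (hr.trans_le hrr)).1 hy.symm
  rw [← hx, ← hy, WithTop.coe_le_coe]
  by_contra! hlt
  have := (varUpTo_mono hb).le_leftLim hlt
  linarith [h1.1, h2.2]

lemma initSign_eq (hx : initPos v r = x) : initSign v r = Real.sign (v x - leftLim v x) := by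
  rw [initSign, hx]; rfl

lemma initState_eq (hx : initPos v r = x) :
    initState v r = leftLim v x + initSign v r * (r - leftLim (varUpTo v) x) := by
  rw [initState, hx]; rfl

lemma initSign_eq_one_or (hb : BoundedVariationOn v univ) (hv : IsLocStep v) (hr : 0 < r)
    (hx : initPos v r = x) : initSign v r = 1 ∨ initSign v r = -1 := by
  have h := (initPos_eq_iff hb hv hr).1 hx
  have h2 := varUpTo_eq hb hv x
  rw [initSign_eq hx]
  have hne : v x - leftLim v x ≠ 0 := by
    intro h0
    rw [h0, abs_zero] at h2
    linarith [h.1, h.2]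
  rcases lt_or_gt_of_ne hne with h3 | h3
  · right; exact Real.sign_of_neg h3
  · left; exact Real.sign_of_pos h3

lemma initSign_eq_one_of_pos (h : 0 < initSign v r) : initSign v r = 1 := by
  rw [initSign] at h ⊢
  rcases Real.sign_apply_eq (v ((initPos v r).untopD 0) - leftLim v ((initPos v r).untopD 0))
    with h1 | h1 | h1
  · rw [h1] at h; linarith
  · rw [h1] at h; linarith
  · exact h1

lemma jump_pos_of_initSign (hx : initPos v r = x) (h : 0 < initSign v r) : leftLim v x < v x := by
  rw [initSign_eq hx] at h
  by_contra! hle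
  rcases hle.eq_or_lt with h1 | h1
  · simp [h1] at h
  · rw [Real.sign_of_neg (sub_neg.2 h1)] at h; linarith

lemma initState_mem (hb : BoundedVariationOn v univ) (hv : IsLocStep v) (hr : 0 < r)
    (hx : initPos v r = x) (hs : 0 < initSign v r) : initState v r ∈ Ioc (leftLim v x) (v x) := by
  have h := (initPos_eq_iff hb hv hr).1 hx
  have h2 := varUpTo_eq hb hv x
  have hj := jump_pos_of_initSign hx hs
  rw [abs_of_pos (sub_pos.2 hj)] at h2
  rw [initState_eq hx, initSign_eq_one_of_pos hs]
  constructor <;> linarith [h.1, h.2]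

lemma exists_initState (hb : BoundedVariationOn v univ) (hv : IsLocStep v)
    (hw : w ∈ Ioc (leftLim v x) (v x)) :
    ∃ r ∈ Ioc 0 (totVar v), 0 < initSign v r ∧ initPos v r = x ∧ initState v r = w ∧
      leftLim (varUpTo v) x < r ∧ r ≤ varUpTo v x ∧
      r = leftLim (varUpTo v) x + (w - leftLim v x) := by
  have h2 := varUpTo_eq hb hv x
  have hj : leftLim v x < v x := hw.1.trans_le hw.2
  rw [abs_of_pos (sub_pos.2 hj)] at h2
  have h0 : 0 ≤ leftLim (varUpTo v) x := by rw [leftLim_varUpTo hv]; exact ENNReal.toReal_nonneg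
  have hr : 0 < leftLim (varUpTo v) x + (w - leftLim v x) := by linarith [hw.1]
  have h1 : leftLim (varUpTo v) x < leftLim (varUpTo v) x + (w - leftLim v x) := by linarith [hw.1]
  have h3 : leftLim (varUpTo v) x + (w - leftLim v x) ≤ varUpTo v x := by linarith [hw.2]
  have hx : initPos v (leftLim (varUpTo v) x + (w - leftLim v x)) = x :=
    (initPos_eq_iff hb hv hr).2 ⟨h1, h3⟩
  have hs : initSign v (leftLim (varUpTo v) x + (w - leftLim v x)) = 1 := by
    rw [initSign_eq hx, Real.sign_of_pos (sub_pos.2 hj)]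
  refine ⟨_, ⟨hr, h3.trans (varUpTo_le_totVar hb x)⟩, by rw [hs]; exact one_pos, hx, ?_, h1, h3, rfl⟩
  rw [initState_eq hx, hs]
  ring

lemma initState_strict {r' : ℝ} (hx : initPos v r = x) (hx' : initPos v r' = x)
    (hs : 0 < initSign v r) (hs' : 0 < initSign v r') (hrr : r < r') :
    initState v r < initState v r' := by
  rw [initState_eq hx, initState_eq hx', initSign_eq_one_of_pos hs, initSign_eq_one_of_pos hs']
  linarith

lemma exists_bound_initState (hb : BoundedVariationOn v univ) (hv : IsLocStep v) :
    ∃ M, ∀ r ∈ Ioc 0 (totVar v), |initState v r| ≤ M := by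
  have hbd : ∀ x, |v x| ≤ |v 0| + totVar v := fun x => by
    have := hb.dist_le (mem_univ x) (mem_univ 0)
    rw [Real.dist_eq] at this
    have h2 := abs_sub_abs_le_abs_sub (v x) (v 0)
    rw [totVar]
    linarith
  have hbd' : ∀ x, |leftLim v x| ≤ |v 0| + totVar v := fun x => by
    obtain ⟨δ, hδ, -, h⟩ := hv x
    rw [← h (x - δ / 2) ⟨by linarith, by linarith⟩]
    exact hbd _
  refine ⟨|v 0| + totVar v + totVar v, fun r hr => ?_⟩
  rw [initState]
  set y := (initPos v r).untopD 0
  have h0 : 0 ≤ leftLim (varUpTo v) y := by rw [leftLim_varUpTo hv]; exact ENNReal.toReal_nonneg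
  have h1 : leftLim (varUpTo v) y ≤ totVar v :=
    ((varUpTo_mono hb).leftLim_le le_rfl).trans (varUpTo_le_totVar hb y)
  have h2 : |r - leftLim (varUpTo v) y| ≤ totVar v := abs_le.2 ⟨by linarith [hr.1], by linarith [hr.2]⟩
  have h3 : |initSign v r| ≤ 1 := by
    rw [initSign]
    rcases Real.sign_apply_eq (v ((initPos v r).untopD 0) - leftLim v ((initPos v r).untopD 0))
      with h | h | h <;> simp [h]
  refine (abs_add_le _ _).trans (add_le_add (hbd' y) ?_)
  rw [abs_mul]
  exact (mul_le_mul h3 h2 (abs_nonneg _) zero_le_one).trans (one_mul _).le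

/-! #### Reflection of the labels -/

lemma varUpTo_neg (v : ℝ → ℝ) : varUpTo (-v) = varUpTo v := by
  funext x; rw [varUpTo, eVariationOn_neg, varUpTo]

lemma totVar_neg (v : ℝ → ℝ) : totVar (-v) = totVar v := by
  rw [totVar, eVariationOn_neg, totVar]

lemma initPos_neg (v : ℝ → ℝ) (r : ℝ) : initPos (-v) r = initPos v r := by
  unfold initPos
  rw [varUpTo_neg]

lemma initSign_neg (hv : IsLocStep v) (r : ℝ) : initSign (-v) r = -initSign v r := by
  rw [initSign, initSign, initPos_neg, hv.leftLim_neg, ← Real.sign_neg]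
  congr 1
  simp only [Pi.neg_apply]
  ring

lemma initState_neg (hv : IsLocStep v) (r : ℝ) : initState (-v) r = -initState v r := by
  rw [initState, initState, initPos_neg, hv.leftLim_neg, varUpTo_neg, initSign_neg hv]
  ring

end ScalarWaves

namespace ScalarWaves

/-! ### The Glimm scheme -/

variable {f : ℝ → ℝ} {ε : ℝ} {v : ℝ → ℝ} {θ : ℕ → ℝ}

/-- The envelope of a differentiable flux is differentiable inside its interval, so that the speed of
a wave is the left derivative of the envelope. At a touching point the envelope is squeezed between
the flux and a supporting line. -/
lemma derivWithin_convEnv_eq (hF : IsFlux f) (hd : Differentiable ℝ f) {a b u : ℝ}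
    (hu : u ∈ Ioc a b) : derivWithin (convEnv f a b) (Icc a b) u = leftSlope f a b u := by
  have huc : u ∈ Icc a b := ⟨hu.1.le, hu.2⟩
  have hun : UniqueDiffWithinAt ℝ (Icc a b) u := uniqueDiffOn_Icc (hu.1.trans_le hu.2) u huc
  rcases hu.2.eq_or_lt with rfl | hub
  · exact ((hasDerivWithinAt_leftSlope hF hu).mono Icc_subset_Iic_self).derivWithin hun
  suffices ∃ k, HasDerivAt (convEnv f a b) k u by
    obtain ⟨k, hk⟩ := this
    rw [hk.hasDerivWithinAt.derivWithin hun, leftSlope,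
      hk.hasDerivWithinAt.derivWithin (uniqueDiffWithinAt_Iic u)]
  by_cases ht : Touches f a b u
  · obtain ⟨k, hk⟩ := ht.exists_support hF huc
    have hnh : Icc a b ∈ nhds u := Icc_mem_nhds hu.1 hub
    have hmin : IsLocalMin (fun x => f x - k * x) u := by
      filter_upwards [hnh] with x hx
      linarith [hk x hx]
    have hder : HasDerivAt (fun x => f x - k * x) (deriv f u - k) u := by
      have := (hd u).hasDerivAt.sub ((hasDerivAt_id u).const_mul k)
      rw [mul_one] at this
      exact this
    have hk0 := hmin.hasDerivAt_eq_zero hder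
    have hfk : HasDerivAt f k u := by
      rw [← sub_eq_zero.1 hk0]; exact (hd u).hasDerivAt
    refine ⟨k, ?_⟩
    rw [hasDerivAt_iff_isLittleO] at hfk ⊢
    refine (Asymptotics.IsBigO.of_bound 1 ?_).trans_isLittleO hfk
    filter_upwards [hnh] with x hx
    have h1 := convEnv_le hF hx
    have h2 := affine_le_convEnv (F := f) (a := a) (b := b) (k := k) (l := f u - k * u)
      (fun w hw => by linarith [hk w hw]) hx
    rw [ht.convEnv_eq hF huc, one_mul, Real.norm_eq_abs, Real.norm_eq_abs, smul_eq_mul,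
      abs_of_nonneg (by linarith), abs_of_nonneg (by linarith)]
    linarith
  · obtain ⟨e₁, e₂, k, l, -, h1, h2, -, -, ht₂, h⟩ :=
      convEnv_affine_of_gap hF hu.1 le_rfl hu.2 (by simp) ht
    exact ⟨k, deriv_of_affine h ⟨h1, lt_of_le_of_ne h2 fun h => ht (h ▸ ht₂)⟩⟩

/-! #### The initial datum -/

lemma boundedVariationOn_glimmDatum (hε : 0 < ε) (hb : BoundedVariationOn v univ) :
    BoundedVariationOn (glimmDatum ε v) univ := by
  refine ne_top_of_le_ne_top hb (eVariationOn.comp_le_of_monotoneOn v (fun x : ℝ => ⌊x / ε⌋ * ε) ?_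
    (mapsTo_univ _ _))
  intro x _ y _ hxy
  have : (⌊x / ε⌋ : ℝ) ≤ ⌊y / ε⌋ :=
    Int.cast_le.2 (Int.floor_le_floor (div_le_div_of_nonneg_right hxy hε.le))
  exact mul_le_mul_of_nonneg_right this hε.le

lemma glimmDatum_eq (hε : 0 < ε) {m : ℤ} {x : ℝ} (h1 : m * ε ≤ x) (h2 : x < (m + 1) * ε) :
    glimmDatum ε v x = v (m * ε) := by
  rw [glimmDatum, Int.floor_eq_iff.2 ⟨(le_div_iff₀ hε).2 h1, (div_lt_iff₀ hε).2 h2⟩]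

lemma glimmDatum_node (hε : 0 < ε) (m : ℤ) :
    (∀ y ∈ Ioo (m * ε - ε) (m * ε), glimmDatum ε v y = v ((m - 1 : ℤ) * ε)) ∧
      glimmDatum ε v (m * ε) = v (m * ε) := by
  refine ⟨fun y hy => glimmDatum_eq hε ?_ ?_, glimmDatum_eq hε le_rfl (by nlinarith)⟩
  · push_cast; linarith [hy.1]
  · push_cast; linarith [hy.2]

lemma leftLim_glimmDatum (hε : 0 < ε) (m : ℤ) :
    leftLim (glimmDatum ε v) (m * ε) = v ((m - 1 : ℤ) * ε) :=
  leftLim_eq_of_const hε (glimmDatum_node hε m).1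

lemma isLocStep_glimmDatum (hε : 0 < ε) (v : ℝ → ℝ) : IsLocStep (glimmDatum ε v) := by
  refine isLocStep_of fun x => ?_
  set m := ⌊x / ε⌋ with hm
  have h1 : m * ε ≤ x := (le_div_iff₀ hε).1 (Int.floor_le (x / ε))
  have h2 : x < (m + 1) * ε := (div_lt_iff₀ hε).1 (Int.lt_floor_add_one (x / ε))
  rcases h1.eq_or_lt with h | h
  · refine ⟨v ((m - 1 : ℤ) * ε), ε, hε, fun y hy => ?_, ?_⟩
    · rw [glimmDatum_eq hε h1 h2, glimmDatum_eq hε (h1.trans hy.1)]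
      linarith [hy.2]
    · rw [← h]; exact (glimmDatum_node hε m).1
  · refine ⟨v (m * ε), min (x - m * ε) ((m + 1) * ε - x), lt_min (by linarith) (by linarith),
      fun y hy => ?_, fun y hy => ?_⟩
    · rw [glimmDatum_eq hε h1 h2, glimmDatum_eq hε (h1.trans hy.1)]
      linarith [hy.2, min_le_right (x - m * ε) ((m + 1) * ε - x)]
    · refine glimmDatum_eq hε ?_ (hy.2.trans h2)
      linarith [hy.1, min_le_left (x - m * ε) ((m + 1) * ε - x)]

/-- The profile jumps only at the nodes. -/
lemma eq_node_of_jump (hε : 0 < ε) {x : ℝ} (hx : leftLim (glimmDatum ε v) x ≠ glimmDatum ε v x) :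
    x = ⌊x / ε⌋ * ε := by
  by_contra hne
  set m := ⌊x / ε⌋ with hm
  have h1 : m * ε ≤ x := (le_div_iff₀ hε).1 (Int.floor_le (x / ε))
  have h2 : x < (m + 1) * ε := (div_lt_iff₀ hε).1 (Int.lt_floor_add_one (x / ε))
  have h : m * ε < x := lt_of_le_of_ne h1 (Ne.symm hne)
  refine hx ?_
  rw [glimmDatum_eq hε h1 h2]
  refine leftLim_eq_of_const (sub_pos.2 h) fun y hy => glimmDatum_eq hε ?_ (hy.2.trans h2)
  linarith [hy.1]

/-- Positions of the waves at time `0`. -/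
lemma glimmNode_zero (hε : 0 < ε) (hb : BoundedVariationOn v univ) {s : ℝ} (hs : 0 < s) (m : ℤ) :
    glimmNode f ε v θ 0 s = m ↔ initPos (glimmDatum ε v) s = ((m * ε : ℝ) : WithTop ℝ) := by
  have hb' := boundedVariationOn_glimmDatum hε hb
  have hl := isLocStep_glimmDatum hε v
  rw [glimmNode]
  constructor
  · intro h
    rw [WithTop.map_eq_some_iff] at h
    obtain ⟨x, hx, rfl⟩ := h
    have hx' := (initPos_eq_iff hb' hl hs).1 hx
    rw [← eq_node_of_jump hε (v := v) (x := x)]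
    · exact hx
    · intro heq
      have := varUpTo_eq hb' hl x
      rw [heq, sub_self, abs_zero] at this
      linarith [hx'.1, hx'.2]
  · intro h
    rw [h, WithTop.map_coe, mul_div_cancel_right₀ _ hε.ne', Int.floor_intCast]

/-! #### Evolution of the waves -/

lemma glimmNode_of_succ {n : ℕ} {s : ℝ} (h : glimmNode f ε v θ (n + 1) s ≠ ⊤) :
    glimmNode f ε v θ n s ≠ ⊤ := by
  intro h0
  rw [glimmNode, if_pos h0] at h
  exact h rfl

lemma glimmNode_of_le {k n : ℕ} {s : ℝ} (hk : k ≤ n) (h : glimmNode f ε v θ n s ≠ ⊤) :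
    glimmNode f ε v θ k s ≠ ⊤ := by
  induction n, hk using Nat.le_induction with
  | base => exact h
  | succ n hk ih => exact ih (glimmNode_of_succ h)

lemma glimmNode_succ {n : ℕ} {s : ℝ} {m m' : ℤ} (hm : glimmNode f ε v θ n s = m) :
    glimmNode f ε v θ (n + 1) s = m' ↔
      m' = (if θ (n + 1) < glimmSpeedAt f ε v θ n m (glimmState ε v s) then m + 1 else m) ∧
      glimmSign ε v s = Real.sign (glimmValue f ε v θ (n + 1) m' -
        glimmValue f ε v θ (n + 1) (m' - 1)) ∧
      glimmSign ε v s * glimmValue f ε v θ (n + 1) (m' - 1) < glimmSign ε v s * glimmState ε v s ∧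
      glimmSign ε v s * glimmState ε v s ≤ glimmSign ε v s * glimmValue f ε v θ (n + 1) m' := by
  have h0 : (glimmNode f ε v θ n s).untopD 0 = m := by rw [hm]; rfl
  conv_lhs => rw [glimmNode]
  rw [if_neg (by simp [hm]), h0]
  dsimp only
  split_ifs with h1 h2 h3
  all_goals simp only [WithTop.coe_inj, false_iff, WithTop.top_ne_coe]
  · exact ⟨fun h => ⟨h.symm, h ▸ h2⟩, fun h => h.1.symm⟩
  · rintro ⟨rfl, h⟩; exact h2 h
  · exact ⟨fun h => ⟨h.symm, h ▸ h3⟩, fun h => h.1.symm⟩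
  · rintro ⟨rfl, h⟩; exact h3 h

lemma glimmSign_eq (hε : 0 < ε) (hb : BoundedVariationOn v univ) {n : ℕ} {s : ℝ} (hs : 0 < s) {m : ℤ}
    (hm : glimmNode f ε v θ n s = m) : glimmSign ε v s =
      Real.sign (glimmValue f ε v θ n m - glimmValue f ε v θ n (m - 1)) := by
  cases n with
  | zero =>
    rw [glimmSign, initSign_eq ((glimmNode_zero hε hb hs m).1 hm), leftLim_glimmDatum hε,
      (glimmDatum_node hε m).2]
    rfl
  | succ n =>
    obtain ⟨m₀, hm₀⟩ := WithTop.ne_top_iff_exists.1 (glimmNode_of_succ (hm.trans_ne WithTop.coe_ne_top))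
    exact ((glimmNode_succ hm₀.symm).1 hm).2.1

/-- The positive waves of the Glimm scheme. -/
def glimmPosWaves (ε : ℝ) (v : ℝ → ℝ) : Set ℝ := {s ∈ glimmWaves ε v | 0 < glimmSign ε v s}

lemma glimmSign_eq_one {s : ℝ} (hs : s ∈ glimmPosWaves ε v) : glimmSign ε v s = 1 :=
  initSign_eq_one_of_pos hs.2

lemma glimmState_mem (hε : 0 < ε) (hb : BoundedVariationOn v univ) {n : ℕ} {s : ℝ} {m : ℤ}
    (hs : s ∈ glimmPosWaves ε v) (hm : glimmNode f ε v θ n s = m) :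
    glimmState ε v s ∈ Ioc (glimmValue f ε v θ n (m - 1)) (glimmValue f ε v θ n m) := by
  cases n with
  | zero =>
    have := initState_mem (boundedVariationOn_glimmDatum hε hb) (isLocStep_glimmDatum hε v) hs.1.1
      ((glimmNode_zero hε hb hs.1.1 m).1 hm) hs.2
    rw [leftLim_glimmDatum hε, (glimmDatum_node hε m).2] at this
    exact this
  | succ n =>
    obtain ⟨m₀, hm₀⟩ := WithTop.ne_top_iff_exists.1 (glimmNode_of_succ (hm.trans_ne WithTop.coe_ne_top))
    have := ((glimmNode_succ hm₀.symm).1 hm).2.2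
    rwa [glimmSign_eq_one hs, one_mul, one_mul, one_mul] at this

/-- A positive wave stays at its node if its state lies below the sampled value, and moves to the
next node otherwise. -/
lemma glimmNode_succ_pos (hF : IsFlux f) (hd : Differentiable ℝ f) (hε : 0 < ε)
    (hb : BoundedVariationOn v univ) {n : ℕ} {s : ℝ} {m m' : ℤ}
    (hs : s ∈ glimmPosWaves ε v) (hm : glimmNode f ε v θ n s = m) :
    glimmNode f ε v θ (n + 1) s = m' ↔
      m' = (if glimmState ε v s ≤ glimmValue f ε v θ (n + 1) m then m else m + 1) ∧
      glimmState ε v s ∈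
        Ioc (glimmValue f ε v θ (n + 1) (m' - 1)) (glimmValue f ε v θ (n + 1) m') := by
  have hmem := glimmState_mem hε hb hs hm
  have hlt := hmem.1.trans_le hmem.2
  rw [glimmNode_succ hm, glimmSign_eq_one hs, one_mul, one_mul, one_mul]
  have h1 : glimmSpeedAt f ε v θ n m (glimmState ε v s) =
      leftSlope f (glimmValue f ε v θ n (m - 1)) (glimmValue f ε v θ n m) (glimmState ε v s) := by
    rw [glimmSpeedAt, if_pos hlt, derivWithin_convEnv_eq hF hd hmem]
  have h2 : glimmState ε v s ≤ glimmValue f ε v θ (n + 1) m ↔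
      ¬ θ (n + 1) < glimmSpeedAt f ε v θ n m (glimmState ε v s) := by
    rw [h1, not_lt, ← le_riemann_iff hF hmem, glimmValue]
  rw [if_congr h2 rfl rfl, ite_not]
  refine and_congr_right fun _ => ⟨fun h => ⟨h.2.1, h.2.2⟩, fun h => ⟨?_, h.1, h.2⟩⟩
  rw [Real.sign_of_pos (sub_pos.2 (h.1.trans_le h.2))]

/-- Waves keep their order, and those at a common node have increasing states. -/
lemma glimm_mono_strict (hF : IsFlux f) (hd : Differentiable ℝ f) (hε : 0 < ε)
    (hb : BoundedVariationOn v univ) (n : ℕ) {s s' : ℝ} (hs : s ∈ glimmPosWaves ε v)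
    (hs' : s' ∈ glimmPosWaves ε v) (hss : s < s') {m m' : ℤ} (hm : glimmNode f ε v θ n s = m)
    (hm' : glimmNode f ε v θ n s' = m') :
    m ≤ m' ∧ (m = m' → glimmState ε v s < glimmState ε v s') := by
  induction n generalizing m m' with
  | zero =>
    rw [glimmNode_zero hε hb hs.1.1] at hm
    rw [glimmNode_zero hε hb hs'.1.1] at hm'
    have := initPos_mono (boundedVariationOn_glimmDatum hε hb) (isLocStep_glimmDatum hε v) hs.1.1
      hss.le (hm.trans_ne WithTop.coe_ne_top) (hm'.trans_ne WithTop.coe_ne_top)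
    rw [hm, hm', WithTop.coe_le_coe, mul_le_mul_iff_left₀ hε, Int.cast_le] at this
    refine ⟨this, ?_⟩
    rintro rfl
    exact initState_strict hm hm' hs.2 hs'.2 hss
  | succ n ih =>
    obtain ⟨k, hk⟩ := WithTop.ne_top_iff_exists.1 (glimmNode_of_succ (hm.trans_ne WithTop.coe_ne_top))
    obtain ⟨k', hk'⟩ := WithTop.ne_top_iff_exists.1 (glimmNode_of_succ (hm'.trans_ne WithTop.coe_ne_top))
    obtain ⟨h1, h2⟩ := ih hk.symm hk'.symm
    obtain ⟨rfl, h3⟩ := (glimmNode_succ_pos hF hd hε hb hs hk.symm).1 hm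
    obtain ⟨rfl, h4⟩ := (glimmNode_succ_pos hF hd hε hb hs' hk'.symm).1 hm'
    rcases h1.eq_or_lt with rfl | h1
    · have := h2 rfl
      refine ⟨?_, fun _ => this⟩
      split_ifs with h5 h6 <;> first | omega | linarith
    · refine ⟨by split_ifs <;> omega, fun h => ?_⟩
      have hkk : k = k' - 1 := by split_ifs at h <;> omega
      have h5 := (glimmState_mem hε hb hs hk.symm).2
      have h6 := (glimmState_mem hε hb hs' hk'.symm).1
      rw [← hkk] at h6
      exact h5.trans_lt h6

/-- The positive waves at a node carry all the states between the values on its two sides. -/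
lemma glimm_fill (hF : IsFlux f) (hd : Differentiable ℝ f) (hε : 0 < ε)
    (hb : BoundedVariationOn v univ) (n : ℕ) {m : ℤ} {w : ℝ}
    (hw : w ∈ Ioc (glimmValue f ε v θ n (m - 1)) (glimmValue f ε v θ n m)) :
    ∃ s ∈ glimmPosWaves ε v, glimmNode f ε v θ n s = m ∧ glimmState ε v s = w := by
  induction n generalizing m with
  | zero =>
    have hb' := boundedVariationOn_glimmDatum hε hb
    have hl := isLocStep_glimmDatum hε v
    obtain ⟨r, hr, h1, h2, h3, -⟩ := exists_initState (x := m * ε) (w := w) hb' hl (by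
      rw [leftLim_glimmDatum hε, (glimmDatum_node hε m).2]; exact hw)
    exact ⟨r, ⟨hr, h1⟩, (glimmNode_zero hε hb hr.1 m).2 h2, h3⟩
  | succ n ih =>
    have hval : ∀ k, glimmValue f ε v θ (n + 1) k =
      riemann f (glimmValue f ε v θ n (k - 1)) (glimmValue f ε v θ n k) (θ (n + 1)) := fun _ => rfl
    rcases le_or_gt w (glimmValue f ε v θ n (m - 1)) with h | h
    · -- the state comes from the node on the left
      rcases le_or_gt (glimmValue f ε v θ n (m - 1 - 1)) (glimmValue f ε v θ n (m - 1)) with h' | h'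
      · have h1 := (riemann_mem (F := f) h' (θ (n + 1))).1
        rw [← hval] at h1
        obtain ⟨s, hs, hsm, rfl⟩ := ih (m := m - 1) ⟨h1.trans_lt hw.1, h⟩
        refine ⟨s, hs, (glimmNode_succ_pos hF hd hε hb hs hsm).2 ⟨?_, hw⟩, rfl⟩
        rw [if_neg (not_le.2 hw.1)]
        ring
      · have h1 := (riemann_mem_of_ge (F := f) h'.le (θ (n + 1))).1
        rw [← hval] at h1
        linarith [hw.1]
    · rcases le_or_gt (glimmValue f ε v θ n (m - 1)) (glimmValue f ε v θ n m) with h' | h'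
      · have h1 := (riemann_mem (F := f) h' (θ (n + 1))).2
        rw [← hval] at h1
        obtain ⟨s, hs, hsm, rfl⟩ := ih (m := m) ⟨h, hw.2.trans h1⟩
        refine ⟨s, hs, (glimmNode_succ_pos hF hd hε hb hs hsm).2 ⟨?_, hw⟩, rfl⟩
        rw [if_pos hw.2]
      · have h1 := (riemann_mem_of_ge (F := f) h'.le (θ (n + 1))).2
        rw [← hval] at h1
        linarith [hw.2]

lemma exists_int_jump {u : ℤ → ℝ} {w : ℝ} {y y' : ℤ} (hyy : y < y') (hw : u y < w)
    (hw' : w ≤ u (y' - 1)) : ∃ z ∈ Ioo y y', w ∈ Ioc (u (z - 1)) (u z) := by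
  obtain ⟨k, hk⟩ := Int.eq_ofNat_of_zero_le (by omega : 0 ≤ y' - 1 - y)
  have hex : ∃ j : ℕ, w ≤ u (y + j) := ⟨k, by rwa [← hk, show y + (y' - 1 - y) = y' - 1 by ring]⟩
  classical
  have h1 := Nat.find_spec hex
  have h2 : Nat.find hex ≤ k :=
    Nat.find_min' hex (by rwa [← hk, show y + (y' - 1 - y) = y' - 1 by ring])
  have h3 : Nat.find hex ≠ 0 := by
    intro h
    rw [h] at h1
    simp only [Nat.cast_zero, add_zero] at h1
    linarith
  have h4 := Nat.find_min hex (m := Nat.find hex - 1) (by omega)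
  refine ⟨y + Nat.find hex, ⟨by omega, by omega⟩, ?_, h1⟩
  rw [show y + (Nat.find hex : ℤ) - 1 = y + ((Nat.find hex - 1 : ℕ) : ℤ) by omega]
  exact not_le.1 h4

/-- The positive waves of the Glimm scheme form a system of waves. -/
lemma isWaveSystem_glimm (hF : IsFlux f) (hd : Differentiable ℝ f) (hε : 0 < ε)
    (hb : BoundedVariationOn v univ) (N : ℕ) :
    IsWaveSystem f N (glimmPosWaves ε v) (glimmNode f ε v θ) (glimmState ε v)
      (fun n m => glimmValue f ε v θ n (m - 1)) (glimmValue f ε v θ) where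
  continuous := hF.continuous
  alive_of_succ _ _ _ _ h := glimmNode_of_succ h
  mono n _ s hs s' hs' h h' hss := by
    rcases hss.eq_or_lt with rfl | hss
    · rfl
    obtain ⟨m, hm⟩ := WithTop.ne_top_iff_exists.1 h
    obtain ⟨m', hm'⟩ := WithTop.ne_top_iff_exists.1 h'
    rw [← hm, ← hm', WithTop.coe_le_coe]
    exact (glimm_mono_strict hF hd hε hb n hs hs' hss hm.symm hm'.symm).1
  mem n _ s hs m hm := glimmState_mem hε hb hs hm
  fill n _ m w hw := glimm_fill hF hd hε hb n hw
  strict n _ s hs s' hs' hss m hm hm' :=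
    (glimm_mono_strict hF hd hε hb n hs hs' hss hm hm').2 rfl
  exists_node n _ y y' w hyy hw hw' := exists_int_jump hyy hw hw'
  step n _ s hs s' hs' hss m hm hm' ha ha' hgap := by
    obtain ⟨k, hk⟩ := WithTop.ne_top_iff_exists.1 ha
    obtain ⟨k', hk'⟩ := WithTop.ne_top_iff_exists.1 ha'
    have h1 := glimmState_mem hε hb hs hm
    have h2 := glimmState_mem hε hb hs' hm'
    have h3 := leftSlope_eq_of_gap hF h1.1 ((glimm_mono_strict hF hd hε hb n hs hs' hss hm hm').2 rfl)
      h2.2 hgap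
    have h4 := ((glimmNode_succ_pos hF hd hε hb hs hm).1 hk.symm).1
    have h5 := ((glimmNode_succ_pos hF hd hε hb hs' hm').1 hk'.symm).1
    rw [← hk, ← hk', h4, h5, WithTop.coe_inj]
    refine if_congr ?_ rfl rfl
    rw [glimmValue, le_riemann_iff hF h1, le_riemann_iff hF h2, h3]
  bdd := by
    obtain ⟨M, hM⟩ := exists_bound_initState (boundedVariationOn_glimmDatum hε hb)
      (isLocStep_glimmDatum hε v)
    exact ⟨M, fun s hs => hM s hs.1⟩

/-! #### Positions at intermediate times -/

lemma floor_mul_div (hε : 0 < ε) (n : ℕ) : ⌊(n * ε : ℝ) / ε⌋₊ = n := by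
  rw [mul_div_cancel_right₀ _ hε.ne', Nat.floor_natCast]

lemma glimmPos_node (hε : 0 < ε) (n : ℕ) (s : ℝ) : glimmPos f ε v θ (n * ε) s =
    (glimmNode f ε v θ n s).map fun m : ℤ => (m * ε : ℝ) := by
  rw [glimmPos, floor_mul_div hε]
  simp

lemma glimmPos_ne_top (hε : 0 < ε) (n : ℕ) (s : ℝ) :
    glimmPos f ε v θ (n * ε) s ≠ ⊤ ↔ glimmNode f ε v θ n s ≠ ⊤ := by
  rw [glimmPos_node hε, Ne, WithTop.map_eq_top_iff]

/-- Between two multiples of `ε` the waves leaving different nodes do not meet. -/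
lemma haveInteracted_iff_met (hε : 0 < ε) {n : ℕ} {s s' : ℝ} (hs : glimmNode f ε v θ n s ≠ ⊤) :
    HaveInteracted (glimmPos f ε v θ) (n * ε) s s' ↔ Met (glimmNode f ε v θ) n s s' := by
  constructor
  · rintro ⟨τ, h0, hτ, h⟩
    have hk1 := Nat.floor_le (div_nonneg h0 hε.le)
    have hk2 := Nat.lt_floor_add_one (τ / ε)
    rw [le_div_iff₀ hε] at hk1
    rw [div_lt_iff₀ hε] at hk2
    have hkn : ⌊τ / ε⌋₊ ≤ n := by
      have := Nat.floor_le_floor (div_le_div_of_nonneg_right hτ hε.le)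
      rwa [floor_mul_div hε] at this
    refine ⟨_, hkn, ?_⟩
    rw [glimmPos, glimmPos] at h
    obtain ⟨m, hm⟩ := WithTop.ne_top_iff_exists.1 (glimmNode_of_le hkn hs)
    rw [← hm, WithTop.map_coe, eq_comm, WithTop.map_eq_some_iff] at h
    obtain ⟨m', hm', h⟩ := h
    rw [← hm, hm', WithTop.coe_inj]
    have h1 : |((m : ℝ) - m') * ε| < ε := by
      rw [abs_lt]
      split_ifs at h <;> constructor <;> linarith
    rw [abs_mul, abs_of_pos hε] at h1
    have h2 : |(m : ℝ) - m'| < 1 := by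
      by_contra! hle
      nlinarith
    have h3 : |m - m'| < 1 := by exact_mod_cast h2
    have := Int.abs_lt_one_iff.1 h3
    omega
  · rintro ⟨k, hk, h⟩
    refine ⟨k * ε, by positivity, ?_, ?_⟩
    · have : (k : ℝ) ≤ n := by exact_mod_cast hk
      exact mul_le_mul_of_nonneg_right this hε.le
    · rw [glimmPos_node hε, glimmPos_node hε, h]

lemma glimmSign_eq_of_met (hε : 0 < ε) (hb : BoundedVariationOn v univ) {n : ℕ} {s s' : ℝ}
    (hs : s ∈ glimmWaves ε v) (hs' : s' ∈ glimmWaves ε v) (ha : glimmNode f ε v θ n s ≠ ⊤)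
    (h : Met (glimmNode f ε v θ) n s s') : glimmSign ε v s = glimmSign ε v s' := by
  obtain ⟨k, hk, h⟩ := h
  obtain ⟨m, hm⟩ := WithTop.ne_top_iff_exists.1 (glimmNode_of_le hk ha)
  rw [glimmSign_eq hε hb hs.1 hm.symm, glimmSign_eq hε hb hs'.1 (h ▸ hm.symm)]

lemma commonHistory_glimm (hε : 0 < ε) (hb : BoundedVariationOn v univ) {n : ℕ} {s s' : ℝ}
    (hs : s ∈ glimmPosWaves ε v) :
    commonHistory (glimmWaves ε v) (glimmPos f ε v θ) (n * ε) s s' =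
      history (glimmPosWaves ε v) (glimmNode f ε v θ) n s s' := by
  ext p
  constructor
  · rintro ⟨⟨⟨h1, h2⟩, h3⟩, ⟨-, h4⟩⟩
    rw [glimmPos_ne_top hε] at h2
    rw [haveInteracted_iff_met hε h2] at h3 h4
    exact ⟨⟨h1, glimmSign_eq_of_met hε hb h1 hs.1 h2 h3 ▸ hs.2⟩, h2, h3, h4⟩
  · rintro ⟨h1, h2, h3, h4⟩
    refine ⟨⟨⟨h1.1, (glimmPos_ne_top hε n p).2 h2⟩, ?_⟩, ⟨⟨h1.1, (glimmPos_ne_top hε n p).2 h2⟩, ?_⟩⟩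
    · rwa [haveInteracted_iff_met hε h2]
    · rwa [haveInteracted_iff_met hε h2]

lemma separated_of_divided (hF : IsFlux f) (hd : Differentiable ℝ f) (hε : 0 < ε)
    (hb : BoundedVariationOn v univ) {n : ℕ} {p p' : ℝ} (hp : p ∈ glimmPosWaves ε v)
    (hp' : p' ∈ glimmPosWaves ε v) (ha : glimmNode f ε v θ n p ≠ ⊤) (hpp : p < p')
    (h : DividedInSolution (glimmPos f ε v θ) (glimmSpeed f ε v θ) (n * ε) p p') :
    Separated f (glimmNode f ε v θ) (glimmState ε v)
      (fun n m => glimmValue f ε v θ n (m - 1)) (glimmValue f ε v θ) n p p' := by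
  obtain ⟨m, hm⟩ := WithTop.ne_top_iff_exists.1 ha
  by_contra hsep
  unfold Separated at hsep
  push Not at hsep
  obtain ⟨h1, h2⟩ := hsep
  have hm' : glimmNode f ε v θ n p' = m := h1 ▸ hm.symm
  have h3 := glimmState_mem hε hb hp hm.symm
  have h4 := glimmState_mem hε hb hp' hm'
  have h5 := leftSlope_eq_of_gap hF h3.1
    ((glimm_mono_strict hF hd hε hb n hp hp' hpp hm.symm hm').2 rfl) h4.2 (h2 m hm.symm)
  refine h ?_
  rw [Prod.mk.injEq, glimmPos_node hε, glimmPos_node hε, ← hm, hm']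
  refine ⟨rfl, ?_⟩
  rw [glimmSpeed, glimmSpeed, floor_mul_div hε, ← hm, hm', WithTop.map_coe, WithTop.map_coe,
    glimmSpeedAt, glimmSpeedAt, if_pos (h3.1.trans_le h3.2), if_pos (h3.1.trans_le h3.2),
    derivWithin_convEnv_eq hF hd h3,
    derivWithin_convEnv_eq hF hd h4, h5]

/-- For positive waves of the Glimm scheme, the Riemann problem of the common history touches the
flux between divided waves. -/
lemma glimm_exists_touches (hF : IsFlux f) (hd : Differentiable ℝ f) (hε : 0 < ε)
    (hb : BoundedVariationOn v univ) {n : ℕ} {s s' p p' : ℝ}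
    (hs : s ∈ realWaves (glimmWaves ε v) (glimmPos f ε v θ) (n * ε))
    (hs' : s' ∈ realWaves (glimmWaves ε v) (glimmPos f ε v θ) (n * ε)) (hpos : 0 < glimmSign ε v s)
    (hint : HaveInteracted (glimmPos f ε v θ) (n * ε) s s')
    (hdiv : DividedInSolution (glimmPos f ε v θ) (glimmSpeed f ε v θ) (n * ε) s s')
    (hp : p ∈ commonHistory (glimmWaves ε v) (glimmPos f ε v θ) (n * ε) s s')
    (hp' : p' ∈ commonHistory (glimmWaves ε v) (glimmPos f ε v θ) (n * ε) s s') (hpp : p < p')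
    (hdivp : DividedInSolution (glimmPos f ε v θ) (glimmSpeed f ε v θ) (n * ε) p p') :
    let A := glimmState ε v '' commonHistory (glimmWaves ε v) (glimmPos f ε v θ) (n * ε) s s'
    ∃ y ∈ Ico (glimmState ε v p) (glimmState ε v p'), y ∈ Icc (sInf A) (sSup A) ∧
      Touches f (sInf A) (sSup A) y := by
  intro A
  have ha := (glimmPos_ne_top hε n s).1 hs.2
  have ha' := (glimmPos_ne_top hε n s').1 hs'.2
  rw [haveInteracted_iff_met hε ha] at hint
  have hsW : s ∈ glimmPosWaves ε v := ⟨hs.1, hpos⟩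
  have hsW' : s' ∈ glimmPosWaves ε v :=
    ⟨hs'.1, glimmSign_eq_of_met hε hb hs.1 hs'.1 ha hint ▸ hpos⟩
  have H := isWaveSystem_glimm (θ := θ) hF hd hε hb n
  have key : HistorySeparates f (glimmPosWaves ε v) (glimmNode f ε v θ) (glimmState ε v)
      (fun n m => glimmValue f ε v θ n (m - 1)) (glimmValue f ε v θ) n s s' := by
    rcases lt_trichotomy s s' with h | rfl | h
    · exact H.historySeparates le_rfl hsW hsW' ha ha' h hint
        (separated_of_divided hF hd hε hb hsW hsW' ha h hdiv)
    · exact absurd rfl hdiv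
    · have := H.historySeparates le_rfl hsW' hsW ha' ha h hint.symm
        (separated_of_divided hF hd hε hb hsW' hsW ha' h hdiv.symm)
      have hcomm : history (glimmPosWaves ε v) (glimmNode f ε v θ) n s' s =
          history (glimmPosWaves ε v) (glimmNode f ε v θ) n s s' := by
        ext q; simp only [history, mem_ofPred_eq]; tauto
      rwa [HistorySeparates, hcomm] at this
  have hA : A = glimmState ε v '' history (glimmPosWaves ε v) (glimmNode f ε v θ) n s s' := by
    rw [← commonHistory_glimm hε hb hsW]
  rw [commonHistory_glimm hε hb hsW] at hp hp'
  obtain ⟨y, hy, ht⟩ := key p hp p' hp' hpp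
    (separated_of_divided hF hd hε hb hp.1 hp'.1 hp.2.1 hpp hdivp)
  rw [hA]
  exact ⟨y, hy, ⟨(H.sInf_le hp).trans hy.1, hy.2.le.trans (H.le_sSup hp')⟩, ht⟩

/-! #### Reflection -/

lemma glimmValue_reflect (n : ℕ) (m : ℤ) :
    glimmValue (reflect f) ε (-v) θ n m = -glimmValue f ε v θ n m := by
  induction n generalizing m with
  | zero => rfl
  | succ n ih => rw [glimmValue, glimmValue, ih, ih, riemann_reflect]

lemma glimmDatum_neg (ε : ℝ) (v : ℝ → ℝ) : glimmDatum ε (-v) = -glimmDatum ε v := rfl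

lemma glimmSign_neg (hε : 0 < ε) (s : ℝ) : glimmSign ε (-v) s = -glimmSign ε v s := by
  rw [glimmSign, glimmDatum_neg, initSign_neg (isLocStep_glimmDatum hε v), glimmSign]

lemma glimmState_neg (hε : 0 < ε) (s : ℝ) : glimmState ε (-v) s = -glimmState ε v s := by
  rw [glimmState, glimmDatum_neg, initState_neg (isLocStep_glimmDatum hε v), glimmState]

lemma glimmSpeedAt_reflect (n : ℕ) (m : ℤ) (u : ℝ) :
    glimmSpeedAt (reflect f) ε (-v) θ n m (-u) = glimmSpeedAt f ε v θ n m u := by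
  rw [glimmSpeedAt, glimmSpeedAt, glimmValue_reflect, glimmValue_reflect]
  rcases lt_trichotomy (glimmValue f ε v θ n (m - 1)) (glimmValue f ε v θ n m) with h | h | h
  · rw [if_neg (by linarith), if_pos h, concEnv_eq_reflect_fun, derivWithin_reflect]
    simp
  · -- without a jump both speeds are derivatives within a single point
    rw [h, if_neg (lt_irrefl _), if_neg (lt_irrefl _), Icc_self, Icc_self]
    rw [derivWithin_zero_of_not_accPt, derivWithin_zero_of_not_accPt]
    · exact fun h => (Set.Infinite.of_accPt h) (Set.finite_singleton _)
    · exact fun h => (Set.Infinite.of_accPt h) (Set.finite_singleton _)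
  · rw [if_pos (by linarith), if_neg (by linarith), convEnv_eq_reflect_fun, derivWithin_reflect]
    simp

lemma glimmNode_reflect (hε : 0 < ε) (n : ℕ) (s : ℝ) :
    glimmNode (reflect f) ε (-v) θ n s = glimmNode f ε v θ n s := by
  induction n with
  | zero => rw [glimmNode, glimmNode, glimmDatum_neg, initPos_neg]
  | succ n ih =>
    rw [glimmNode, glimmNode, ih]
    dsimp only
    rw [glimmState_neg hε, glimmSpeedAt_reflect]
    simp only [glimmValue_reflect, glimmSign_neg hε, neg_mul_neg]
    rw [show ∀ a b : ℝ, -a - -b = -(a - b) by intros; ring, Real.sign_neg]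
    simp only [neg_inj]

lemma glimmPos_reflect (hε : 0 < ε) : glimmPos (reflect f) ε (-v) θ = glimmPos f ε v θ := by
  funext t s
  simp only [glimmPos, glimmNode_reflect hε, glimmState_neg hε, glimmSpeedAt_reflect]

lemma glimmSpeed_reflect (hε : 0 < ε) : glimmSpeed (reflect f) ε (-v) θ = glimmSpeed f ε v θ := by
  funext t s
  simp only [glimmSpeed, glimmNode_reflect hε, glimmState_neg hε, glimmSpeedAt_reflect]

lemma glimmWaves_neg (ε : ℝ) (v : ℝ → ℝ) : glimmWaves ε (-v) = glimmWaves ε v := by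
  rw [glimmWaves, glimmDatum_neg, totVar_neg, glimmWaves]

/-- A touching point of the reflected flux is a touching point of the concave envelope. -/
lemma concEnv_eq_of_touches (hF : IsFlux f) {A : Set ℝ} {y : ℝ}
    (hy : y ∈ Icc (sInf (-A)) (sSup (-A))) (h : Touches (reflect f) (sInf (-A)) (sSup (-A)) y) :
    concEnv f (sInf A) (sSup A) (-y) = f (-y) := by
  have h1 := h.convEnv_eq hF.reflect hy
  rw [Real.sInf_neg, Real.sSup_neg] at h1
  rw [concEnv_eq_reflect, neg_neg, h1, reflect, neg_neg]

/-- The Riemann problem of the common history of two divided waves of the Glimm scheme divides the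
divided waves of that history. -/
theorem glimmRiemannDivides (hF : IsFlux f) (hd : Differentiable ℝ f) (hε : 0 < ε)
    (hb : BoundedVariationOn v univ) {n : ℕ} {s s' p p' : ℝ}
    (hs : s ∈ realWaves (glimmWaves ε v) (glimmPos f ε v θ) (n * ε))
    (hs' : s' ∈ realWaves (glimmWaves ε v) (glimmPos f ε v θ) (n * ε))
    (hint : HaveInteracted (glimmPos f ε v θ) (n * ε) s s')
    (hdiv : DividedInSolution (glimmPos f ε v θ) (glimmSpeed f ε v θ) (n * ε) s s')
    (hp : p ∈ commonHistory (glimmWaves ε v) (glimmPos f ε v θ) (n * ε) s s')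
    (hp' : p' ∈ commonHistory (glimmWaves ε v) (glimmPos f ε v θ) (n * ε) s s')
    (hdivp : DividedInSolution (glimmPos f ε v θ) (glimmSpeed f ε v θ) (n * ε) p p') :
    GlimmRiemannDivides f ε v
      (glimmState ε v '' commonHistory (glimmWaves ε v) (glimmPos f ε v θ) (n * ε) s s') p p' := by
  have sgn : ∀ q ∈ commonHistory (glimmWaves ε v) (glimmPos f ε v θ) (n * ε) s s',
      glimmSign ε v q = glimmSign ε v s := by
    rintro q ⟨⟨⟨h1, h2⟩, h3⟩, -⟩
    rw [glimmPos_ne_top hε] at h2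
    rw [haveInteracted_iff_met hε h2] at h3
    exact glimmSign_eq_of_met hε hb h1 hs.1 h2 h3
  wlog hpp : p < p' generalizing p p'
  · have hne : p ≠ p' := by rintro rfl; exact hdivp rfl
    have := this hp' hp hdivp.symm (lt_of_le_of_ne (not_lt.1 hpp) hne.symm)
    unfold GlimmRiemannDivides at this ⊢
    rw [sgn p hp]
    rw [sgn p' hp'] at this
    split_ifs at this ⊢
    all_goals
      rintro ⟨c, d, h, h1, h2⟩
      exact this ⟨c, d, h, h2, h1⟩
  unfold GlimmRiemannDivides
  rw [sgn p hp]
  split_ifs with hpos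
  · obtain ⟨y, hy, hyI, ht⟩ := glimm_exists_touches hF hd hε hb hs hs' hpos hint hdiv hp hp' hpp hdivp
    rintro ⟨c, d, ⟨-, -, -, h⟩, h1, h2⟩
    exact (h y ⟨h1.1.trans_le hy.1, hy.2.trans_le h2.2⟩).ne (ht.convEnv_eq hF hyI)
  · have ha := (glimmPos_ne_top hε n s).1 hs.2
    have hsign : glimmSign ε v s = -1 := by
      obtain ⟨x, hx⟩ := WithTop.ne_top_iff_exists.1 (glimmNode_of_le (Nat.zero_le n) ha)
      refine (initSign_eq_one_or (boundedVariationOn_glimmDatum hε hb) (isLocStep_glimmDatum hε v)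
        hs.1.1 ((glimmNode_zero hε hb hs.1.1 x).1 hx.symm)).resolve_left fun h => hpos ?_
      rw [glimmSign, h]
      exact one_pos
    have hd' : Differentiable ℝ (reflect f) := by
      unfold reflect
      fun_prop
    have key := glimm_exists_touches (θ := θ) (n := n) (s := s) (s' := s') (p := p) (p' := p')
      hF.reflect hd' hε (boundedVariationOn_neg hb)
      (by rwa [glimmWaves_neg, glimmPos_reflect hε]) (by rwa [glimmWaves_neg, glimmPos_reflect hε])
      (by rw [glimmSign_neg hε, hsign]; norm_num) (by rwa [glimmPos_reflect hε])
      (by rwa [glimmPos_reflect hε, glimmSpeed_reflect hε])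
      (by rwa [glimmWaves_neg, glimmPos_reflect hε]) (by rwa [glimmWaves_neg, glimmPos_reflect hε])
      hpp (by rwa [glimmPos_reflect hε, glimmSpeed_reflect hε])
    simp only [glimmWaves_neg, glimmPos_reflect hε, glimmState_neg hε] at key
    obtain ⟨y, hy, hyI, ht⟩ := key
    rw [show ((fun s => -glimmState ε v s) '' _ : Set ℝ) = -(glimmState ε v ''
      commonHistory (glimmWaves ε v) (glimmPos f ε v θ) (n * ε) s s') by
        rw [← Set.image_neg_eq_neg, Set.image_image]] at hyI ht
    rintro ⟨c, d, ⟨-, -, -, h⟩, h1, h2⟩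
    exact (h (-y) ⟨by linarith [hy.2, h2.1], by linarith [hy.1, h1.2]⟩).ne
      (concEnv_eq_of_touches hF hyI ht).symm

end ScalarWaves

namespace ScalarWaves

/-! ### Piecewise affine fluxes -/

/-- A flux that is affine on each interval between consecutive points of `ε ℤ`. -/
structure IsGridFlux (F : ℝ → ℝ) (ε : ℝ) : Prop extends IsFlux F where
  affine : ∀ i : ℤ, ∃ k l, ∀ u ∈ Icc (i * ε : ℝ) ((i + 1) * ε), F u = k * u + l

/-- The real number `a` is a multiple of `ε`. -/
def InGrid (ε a : ℝ) : Prop := ∃ m : ℤ, a = m * ε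

variable {F f : ℝ → ℝ} {ε a b c : ℝ} {v w : ℝ → ℝ}

lemma pwAffine_of_mem (hε : 0 < ε) (i : ℤ) {u : ℝ} (hu : u ∈ Icc (i * ε : ℝ) ((i + 1) * ε)) :
    pwAffine f ε u = f (i * ε) + (f ((i + 1) * ε) - f (i * ε)) / ε * (u - i * ε) := by
  rcases hu.2.eq_or_lt with h | h
  · have hfl : ⌊u / ε⌋ = i + 1 := by
      rw [h, mul_div_cancel_right₀ _ hε.ne']
      exact_mod_cast Int.floor_intCast (i + 1)
    rw [pwAffine, hfl, h]
    push_cast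
    field_simp
    ring
  · rw [pwAffine, Int.floor_eq_iff.2 ⟨(le_div_iff₀ hε).2 hu.1, (div_lt_iff₀ hε).2 h⟩]

lemma monotone_pwAffine (hε : 0 < ε) (hf : Monotone f) : Monotone (pwAffine f ε) := by
  intro x y hxy
  have cell : ∀ x : ℝ, x ∈ Icc (⌊x / ε⌋ * ε : ℝ) ((⌊x / ε⌋ + 1) * ε) := fun x =>
    ⟨(le_div_iff₀ hε).1 (Int.floor_le _), ((div_lt_iff₀ hε).1 (Int.lt_floor_add_one _)).le⟩
  have slope : ∀ i : ℤ, 0 ≤ (f ((i + 1) * ε) - f (i * ε)) / ε := fun i =>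
    div_nonneg (sub_nonneg.2 (hf (by nlinarith))) hε.le
  have hij : ⌊x / ε⌋ ≤ ⌊y / ε⌋ := Int.floor_le_floor (div_le_div_of_nonneg_right hxy hε.le)
  have hx := cell x
  have hy := cell y
  rw [pwAffine_of_mem hε _ hx, pwAffine_of_mem hε _ hy]
  rcases hij.eq_or_lt with h | h
  · rw [h]
    have := mul_le_mul_of_nonneg_left (sub_le_sub_right hxy (⌊y / ε⌋ * ε)) (slope ⌊y / ε⌋)
    linarith
  · have h1 := mul_le_mul_of_nonneg_left (sub_le_sub_right hx.2 (⌊x / ε⌋ * ε)) (slope ⌊x / ε⌋)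
    have h2 : (f ((⌊x / ε⌋ + 1) * ε) - f (⌊x / ε⌋ * ε)) / ε * ((⌊x / ε⌋ + 1) * ε - ⌊x / ε⌋ * ε) =
        f ((⌊x / ε⌋ + 1) * ε) - f (⌊x / ε⌋ * ε) := by field_simp; ring
    have h3 := mul_nonneg (slope ⌊y / ε⌋) (sub_nonneg.2 hy.1)
    have h4 : f ((⌊x / ε⌋ + 1) * ε) ≤ f (⌊y / ε⌋ * ε) := by
      refine hf (mul_le_mul_of_nonneg_right ?_ hε.le)
      exact_mod_cast h
    linarith

lemma isGridFlux_pwAffine (hε : 0 < ε) (hf : IsFlux f) : IsGridFlux (pwAffine f ε) ε where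
  mono := monotone_pwAffine hε hf.mono
  lip x y hxy := by
    have h := monotone_pwAffine (f := fun u => u - f u) hε
      (fun x y hxy => by have := hf.lip x y hxy; linarith) hxy
    have e : ∀ u, pwAffine (fun u => u - f u) ε u = u - pwAffine f ε u := fun u => by
      rw [pwAffine, pwAffine]
      field_simp
      ring
    rw [e, e] at h
    linarith
  affine i := ⟨(f ((i + 1) * ε) - f (i * ε)) / ε,
    f (i * ε) - (f ((i + 1) * ε) - f (i * ε)) / ε * (i * ε), fun u hu => by
      rw [pwAffine_of_mem hε i hu]; ring⟩

lemma InGrid.neg (h : InGrid ε a) : InGrid ε (-a) := by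
  obtain ⟨m, rfl⟩ := h
  exact ⟨-m, by push_cast; ring⟩

lemma InGrid.add (h : InGrid ε a) (h' : InGrid ε b) : InGrid ε (a + b) := by
  obtain ⟨m, rfl⟩ := h
  obtain ⟨n, rfl⟩ := h'
  exact ⟨m + n, by push_cast; ring⟩

lemma InGrid.sub (h : InGrid ε a) (h' : InGrid ε b) : InGrid ε (a - b) := by
  rw [sub_eq_add_neg]; exact h.add h'.neg

/-- The endpoints of an interval of the grid do not separate the states of a cell. -/
lemma InGrid.lt_iff (hε : 0 < ε) (ha : InGrid ε a) (hb : InGrid ε b) {x : ℝ}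
    (hx : x ∈ Ioc (b - ε) b) : a < x ↔ a ≤ b - ε := by
  refine ⟨fun h => ?_, fun h => h.trans_lt hx.1⟩
  obtain ⟨m, rfl⟩ := ha
  obtain ⟨n, rfl⟩ := hb
  have h1 : (m : ℝ) < n := lt_of_mul_lt_mul_right (h.trans_le hx.2) hε.le
  have h2 : (m : ℝ) ≤ n - 1 := by
    have : m < n := by exact_mod_cast h1
    exact_mod_cast Int.le_sub_one_of_lt this
  nlinarith

lemma InGrid.le_iff (hε : 0 < ε) (ha : InGrid ε a) (hb : InGrid ε b) {x : ℝ}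
    (hx : x ∈ Ioc (b - ε) b) : x ≤ a ↔ b ≤ a := by
  rw [← not_lt, ha.lt_iff hε hb hx, not_le]
  refine ⟨fun h => ?_, fun h => by linarith⟩
  obtain ⟨m, rfl⟩ := ha
  obtain ⟨n, rfl⟩ := hb
  have h1 : (n : ℝ) - 1 < m := lt_of_mul_lt_mul_right (by linarith) hε.le
  have h2 : (n : ℝ) ≤ m := by
    have : n - 1 < m := by exact_mod_cast h1
    exact_mod_cast Int.sub_one_lt_iff.1 this
  exact mul_le_mul_of_nonneg_right h2 hε.le

lemma IsGridFlux.reflect (hF : IsGridFlux F ε) : IsGridFlux (reflect F) ε where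
  toIsFlux := hF.toIsFlux.reflect
  affine i := by
    obtain ⟨k, l, h⟩ := hF.affine (-i - 1)
    refine ⟨k, -l, fun u hu => ?_⟩
    have := h (-u) ⟨by push_cast; linarith [hu.2], by push_cast; linarith [hu.1]⟩
    rw [ScalarWaves.reflect, this]
    ring

/-- The envelope is affine on the cells of the grid. -/
lemma convEnv_affine_on_cell (hF : IsGridFlux F ε) (hε : 0 < ε) {u : ℝ} (hu : InGrid ε u)
    (h1 : a ≤ u - ε) (h2 : u ≤ b) :
    ∃ k l, ∀ x ∈ Icc (u - ε) u, convEnv F a b x = k * x + l := by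
  obtain ⟨m, rfl⟩ := hu
  obtain ⟨k, l, h⟩ := hF.affine (m - 1)
  refine convEnv_affine_of_affine hF.toIsFlux (k := k) (l := l) h1 (by linarith) h2 fun x hx => h x ?_
  push_cast
  rw [show ((m : ℝ) - 1) * ε = m * ε - ε by ring, show (m - 1 + 1) * ε = m * ε by ring]
  exact hx

lemma leftSlope_cell (hF : IsGridFlux F ε) (hε : 0 < ε) {u x : ℝ} (hu : InGrid ε u)
    (h1 : a ≤ u - ε) (h2 : u ≤ b) (hx : x ∈ Ioc (u - ε) u) :
    leftSlope F a b x = leftSlope F a b u := by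
  obtain ⟨k, l, h⟩ := convEnv_affine_on_cell hF hε hu h1 h2
  rw [leftSlope_of_affine h hx, leftSlope_of_affine h ⟨by linarith, le_rfl⟩]

lemma deriv_convEnv_cell (hF : IsGridFlux F ε) (hε : 0 < ε) {u x : ℝ} (hu : InGrid ε u)
    (h1 : a ≤ u - ε) (h2 : u ≤ b) (hx : x ∈ Ioc (u - ε) u) :
    deriv (convEnv F a b) (u - ε / 2) = leftSlope F a b x := by
  obtain ⟨k, l, h⟩ := convEnv_affine_on_cell hF hε hu h1 h2
  rw [leftSlope_of_affine h hx, (deriv_of_affine h ⟨by linarith, by linarith⟩).deriv]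

/-- Each real lies in exactly one cell `(u - ε, u]` of the grid. -/
lemma exists_cell (hε : 0 < ε) (x : ℝ) : ∃ u, InGrid ε u ∧ x ∈ Ioc (u - ε) u := by
  refine ⟨⌈x / ε⌉ * ε, ⟨_, rfl⟩, ?_, (div_le_iff₀ hε).1 (Int.le_ceil _)⟩
  have := (lt_div_iff₀ hε).1 (sub_lt_iff_lt_add.2 (Int.ceil_lt_add_one (x / ε)))
  linarith

/-! ### Fans of wavefronts -/

lemma leftSlope_nonneg (hF : IsFlux F) {x : ℝ} (hx : x ∈ Ioc a b) : 0 ≤ leftSlope F a b x := by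
  refine le_trans ?_ (slope_le_leftSlope hF le_rfl hx.1 hx.2)
  rw [slope_def_field]
  refine div_nonneg (sub_nonneg.2 ?_) (sub_nonneg.2 hx.1.le)
  have hab : a ≤ b := hx.1.le.trans hx.2
  rw [(touches_left F a b).convEnv_eq hF ⟨le_rfl, hab⟩]
  simpa using affine_le_convEnv (F := F) (a := a) (b := b) (k := 0) (l := F a)
    (fun w hw => by simpa using hF.mono hw.1) ⟨hx.1.le, hx.2⟩

lemma finite_slopes (hF : IsGridFlux F ε) (hε : 0 < ε) (ha : InGrid ε a) (hb : InGrid ε b) :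
    (leftSlope F a b '' Ioc a b).Finite := by
  obtain ⟨m, hm⟩ := id ha
  obtain ⟨n, hn⟩ := id hb
  refine ((Set.finite_Icc m n).image fun i : ℤ => leftSlope F a b (i * ε)).subset ?_
  rintro _ ⟨x, hx, rfl⟩
  obtain ⟨u, hu, hxu⟩ := exists_cell hε x
  have h1 := (ha.lt_iff hε hu hxu).1 hx.1
  have h2 := (hb.le_iff hε hu hxu).1 hx.2
  obtain ⟨i, rfl⟩ := id hu
  refine ⟨i, ⟨?_, ?_⟩, (leftSlope_cell hF hε hu h1 h2 hxu).symm⟩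
  · rw [hm] at h1
    exact_mod_cast le_of_mul_le_mul_right (by linarith : (m : ℝ) * ε ≤ i * ε) hε
  · rw [hn] at h2
    exact_mod_cast le_of_mul_le_mul_right h2 hε

lemma riemann_mono_speed (hF : IsFlux F) (hab : a ≤ b) {c c' : ℝ}
    (h : ∀ x ∈ Ioc a b, leftSlope F a b x ≤ c → leftSlope F a b x ≤ c') :
    riemann F a b c ≤ riemann F a b c' := by
  have hm := riemann_mem (F := F) hab c
  rcases hm.1.eq_or_lt with h' | h'
  · rw [← h']; exact (riemann_mem (F := F) hab c').1
  · have hx : riemann F a b c ∈ Ioc a b := ⟨h', hm.2⟩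
    exact (le_riemann_iff hF hx).2 (h _ hx ((le_riemann_iff hF hx).1 le_rfl))

lemma exists_gap {S : Set ℝ} (hS : S.Finite) (c : ℝ) :
    ∃ δ > 0, ∀ x ∈ S, x ∈ Ioo (c - δ) (c + δ) → x = c := by
  have h : (S \ {c})ᶜ ∈ nhds c :=
    (hS.subset sdiff_subset).isClosed.isOpen_compl.mem_nhds (by simp)
  obtain ⟨δ, hδ, hb⟩ := Metric.mem_nhds_iff.1 h
  refine ⟨δ, hδ, fun x hx hxc => ?_⟩
  by_contra hne
  rw [Real.ball_eq_Ioo] at hb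
  exact hb hxc ⟨hx, hne⟩

lemma isLocStep_riemann_of_le (hF : IsGridFlux F ε) (hε : 0 < ε) (ha : InGrid ε a)
    (hb : InGrid ε b) (hab : a ≤ b) : IsLocStep (riemann F a b) := by
  refine isLocStep_of fun c => ?_
  obtain ⟨δ, hδ, h⟩ := exists_gap (finite_slopes hF hε ha hb) c
  have mono : ∀ c c', c ≤ c' → riemann F a b c ≤ riemann F a b c' := fun c c' hcc =>
    riemann_mono_speed hF.toIsFlux hab fun x _ hx => hx.trans hcc
  refine ⟨riemann F a b (c - δ / 2), δ, hδ, fun y hy => le_antisymm ?_ (mono _ _ hy.1),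
    fun y hy => ?_⟩
  · refine riemann_mono_speed hF.toIsFlux hab fun x hx hxy => ?_
    by_contra! hlt
    exact hlt.ne' (h _ ⟨x, hx, rfl⟩ ⟨by linarith, hxy.trans_lt hy.2⟩)
  · have key : ∀ y y', y' ∈ Ioo (c - δ) c → y ∈ Ioo (c - δ) c →
        riemann F a b y ≤ riemann F a b y' := by
      intro y y' hy' hy
      refine riemann_mono_speed hF.toIsFlux hab fun x hx hxy => ?_
      by_contra! hlt
      have := h _ ⟨x, hx, rfl⟩ ⟨hy'.1.trans hlt, by linarith [hy.2]⟩
      linarith [hy.2]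
    have hm : c - δ / 2 ∈ Ioo (c - δ) c := ⟨by linarith, by linarith⟩
    exact le_antisymm (key _ _ hm hy) (key _ _ hy hm)

lemma riemann_eq_neg_reflect (F : ℝ → ℝ) (a b : ℝ) :
    riemann F a b = -riemann (reflect F) (-a) (-b) := by
  funext c
  rw [Pi.neg_apply, riemann_reflect, neg_neg]

lemma IsLocStep.neg (hv : IsLocStep v) : IsLocStep (-v) := hv.comp fun y => -y

lemma isLocStep_riemann (hF : IsGridFlux F ε) (hε : 0 < ε) (ha : InGrid ε a)
    (hb : InGrid ε b) : IsLocStep (riemann F a b) := by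
  rcases le_total a b with h | h
  · exact isLocStep_riemann_of_le hF hε ha hb h
  · rw [riemann_eq_neg_reflect]
    exact (isLocStep_riemann_of_le hF.reflect hε ha.neg hb.neg (neg_le_neg h)).neg

/-- The states of speed smaller than `c` are those up to the left limit of the fan at `c`. -/
lemma le_leftLim_riemann_iff (hF : IsGridFlux F ε) (hε : 0 < ε) (ha : InGrid ε a)
    (hb : InGrid ε b) {x c : ℝ} (hx : x ∈ Ioc a b) :
    x ≤ leftLim (riemann F a b) c ↔ leftSlope F a b x < c := by
  obtain ⟨δ, hδ, -, h⟩ := isLocStep_riemann hF hε ha hb c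
  constructor
  · intro hle
    rw [← h (c - δ / 2) ⟨by linarith, by linarith⟩, le_riemann_iff hF.toIsFlux hx] at hle
    linarith
  · intro hlt
    obtain ⟨c', h1, h2⟩ := exists_between (max_lt hlt (by linarith : c - δ < c))
    rw [← h c' ⟨(le_max_right _ _).trans_lt h1, h2⟩, le_riemann_iff hF.toIsFlux hx]
    exact (le_max_left _ _).trans h1.le

lemma leftLim_riemann_mem (hF : IsGridFlux F ε) (hε : 0 < ε) (ha : InGrid ε a)
    (hb : InGrid ε b) (c : ℝ) : ∃ c', c' < c ∧ leftLim (riemann F a b) c = riemann F a b c' := by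
  obtain ⟨δ, hδ, -, h⟩ := isLocStep_riemann hF hε ha hb c
  exact ⟨c - δ / 2, by linarith, (h (c - δ / 2) ⟨by linarith, by linarith⟩).symm⟩

lemma jump_riemann_of_mem (hF : IsGridFlux F ε) (hε : 0 < ε) (ha : InGrid ε a)
    (hb : InGrid ε b) {x : ℝ} (hx : x ∈ Ioc a b) :
    x ∈ Ioc (leftLim (riemann F a b) (leftSlope F a b x)) (riemann F a b (leftSlope F a b x)) := by
  refine ⟨not_le.1 fun h => ?_, (le_riemann_iff hF.toIsFlux hx).2 le_rfl⟩
  exact lt_irrefl _ ((le_leftLim_riemann_iff hF hε ha hb hx).1 h)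

lemma leftSlope_eq_of_mem_jump (hF : IsGridFlux F ε) (hε : 0 < ε) (ha : InGrid ε a)
    (hb : InGrid ε b) {x c : ℝ} (hx : x ∈ Ioc a b)
    (hxc : x ∈ Ioc (leftLim (riemann F a b) c) (riemann F a b c)) : leftSlope F a b x = c := by
  refine le_antisymm ((le_riemann_iff hF.toIsFlux hx).1 hxc.2) (not_lt.1 fun h => ?_)
  exact absurd ((le_leftLim_riemann_iff hF hε ha hb hx).2 h) (not_le.2 hxc.1)

lemma leftLim_riemann_le (hF : IsGridFlux F ε) (hε : 0 < ε) (ha : InGrid ε a)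
    (hb : InGrid ε b) (hab : a ≤ b) (c : ℝ) : leftLim (riemann F a b) c ≤ riemann F a b c := by
  obtain ⟨c', hc, h⟩ := leftLim_riemann_mem hF hε ha hb c
  rw [h]
  exact riemann_mono_speed hF.toIsFlux hab fun x _ hx => hx.trans hc.le

/-- Only upward jumps occur in the fan of an upward jump. -/
lemma lt_of_lt_jump (hF : IsGridFlux F ε) (hε : 0 < ε) (ha : InGrid ε a)
    (hb : InGrid ε b) {c : ℝ} (h : leftLim (riemann F a b) c < riemann F a b c) : a < b := by
  by_contra! hba
  have h1 := leftLim_riemann_le hF.reflect hε ha.neg hb.neg (neg_le_neg hba) c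
  rw [riemann_eq_neg_reflect F a b, (isLocStep_riemann hF.reflect hε ha.neg hb.neg).leftLim_neg] at h
  simp only [Pi.neg_apply] at h
  linarith

lemma finite_jumps_riemann (hF : IsGridFlux F ε) (hε : 0 < ε) (ha : InGrid ε a)
    (hb : InGrid ε b) : {c | leftLim (riemann F a b) c ≠ riemann F a b c}.Finite := by
  have key : ∀ {F a b}, IsGridFlux F ε → InGrid ε a → InGrid ε b → a ≤ b →
      {c | leftLim (riemann F a b) c ≠ riemann F a b c}.Finite := by
    intro F a b hF ha hb hab
    refine (finite_slopes hF hε ha hb).subset fun c hc => ?_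
    have h1 := leftLim_riemann_le hF hε ha hb hab c
    obtain ⟨c', -, h2⟩ := leftLim_riemann_mem hF hε ha hb c
    have hx : riemann F a b c ∈ Ioc a b :=
      ⟨((h2 ▸ (riemann_mem hab c').1).trans_lt (lt_of_le_of_ne h1 hc)), (riemann_mem hab c).2⟩
    exact ⟨_, hx, leftSlope_eq_of_mem_jump hF hε ha hb hx ⟨lt_of_le_of_ne h1 hc, le_rfl⟩⟩
  rcases le_total a b with h | h
  · exact key hF ha hb h
  · have := key hF.reflect ha.neg hb.neg (neg_le_neg h)
    refine this.subset fun c hc => ?_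
    rw [mem_ofPred_eq, riemann_eq_neg_reflect,
      (isLocStep_riemann hF.reflect hε ha.neg hb.neg).leftLim_neg] at hc
    exact fun h => hc (by rw [h]; rfl)

lemma inGrid_riemann (hF : IsGridFlux F ε) (hε : 0 < ε) (ha : InGrid ε a)
    (hb : InGrid ε b) (c : ℝ) : InGrid ε (riemann F a b c) := by
  have key : ∀ {F a b}, IsGridFlux F ε → InGrid ε a → InGrid ε b → a ≤ b →
      InGrid ε (riemann F a b c) := by
    intro F a b hF ha hb hab
    have hm := riemann_mem (F := F) hab c
    rcases hm.1.eq_or_lt with h | h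
    · rwa [← h]
    obtain ⟨u, hu, hxu⟩ := exists_cell hε (riemann F a b c)
    have h1 := (ha.lt_iff hε hu hxu).1 h
    have h2 := (hb.le_iff hε hu hxu).1 hm.2
    have h3 := (le_riemann_iff hF.toIsFlux ⟨h, hm.2⟩).1 (le_refl (riemann F a b c))
    rw [leftSlope_cell hF hε hu h1 h2 hxu, ← le_riemann_iff hF.toIsFlux ⟨by linarith, h2⟩] at h3
    rwa [← le_antisymm h3 hxu.2]
  rcases le_total a b with h | h
  · exact key hF ha hb h
  · rw [riemann_eq_neg_reflect]
    exact (key hF.reflect ha.neg hb.neg (neg_le_neg h)).neg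

/-- A fan without fronts of speed at least `c` takes its right state just before `c`. -/
lemma leftLim_riemann_eq_right (hF : IsGridFlux F ε) (hε : 0 < ε) (ha : InGrid ε a)
    (hb : InGrid ε b) (h : ∀ c', c ≤ c' → leftLim (riemann F a b) c' = riemann F a b c') :
    leftLim (riemann F a b) c = b := by
  have key : ∀ {F a b}, IsGridFlux F ε → InGrid ε a → InGrid ε b → a ≤ b →
      (∀ c', c ≤ c' → leftLim (riemann F a b) c' = riemann F a b c') →
      leftLim (riemann F a b) c = b := by
    intro F a b hF ha hb hab h
    obtain ⟨c₀, -, h2⟩ := leftLim_riemann_mem hF hε ha hb c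
    refine le_antisymm (h2 ▸ (riemann_mem hab c₀).2) (not_lt.1 fun hlt => ?_)
    have hbm : b ∈ Ioc a b := ⟨(h2 ▸ (riemann_mem (F := F) hab c₀).1).trans_lt hlt, le_rfl⟩
    have h3 := jump_riemann_of_mem hF hε ha hb hbm
    have h4 : c ≤ leftSlope F a b b :=
      not_lt.1 fun h4 => not_le.2 hlt ((le_leftLim_riemann_iff hF hε ha hb hbm).2 h4)
    exact (h3.1.trans_le h3.2).ne (h _ h4)
  rcases le_total a b with hab | hab
  · exact key hF ha hb hab h
  · have hl := (isLocStep_riemann hF.reflect hε ha.neg hb.neg)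
    rw [riemann_eq_neg_reflect, hl.leftLim_neg, key hF.reflect ha.neg hb.neg (neg_le_neg hab), neg_neg]
    intro c' hc'
    have := h c' hc'
    rw [riemann_eq_neg_reflect, hl.leftLim_neg, Pi.neg_apply, neg_inj] at this
    exact this

/-- A fan without fronts of speed smaller than `c` takes its left state just before `c`. -/
lemma leftLim_riemann_eq_left (hF : IsGridFlux F ε) (hε : 0 < ε) (ha : InGrid ε a)
    (hb : InGrid ε b) (h : ∀ c', c' < c → leftLim (riemann F a b) c' = riemann F a b c') :
    leftLim (riemann F a b) c = a := by
  have key : ∀ {F a b}, IsGridFlux F ε → InGrid ε a → InGrid ε b → a ≤ b →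
      (∀ c', c' < c → leftLim (riemann F a b) c' = riemann F a b c') →
      leftLim (riemann F a b) c = a := by
    intro F a b hF ha hb hab h
    obtain ⟨c₀, -, h2⟩ := leftLim_riemann_mem hF hε ha hb c
    refine le_antisymm (not_lt.1 fun hlt => ?_) (h2 ▸ (riemann_mem hab c₀).1)
    have hbm : leftLim (riemann F a b) c ∈ Ioc a b := ⟨hlt, h2 ▸ (riemann_mem hab c₀).2⟩
    have h3 := jump_riemann_of_mem hF hε ha hb hbm
    exact (h3.1.trans_le h3.2).ne (h _ ((le_leftLim_riemann_iff hF hε ha hb hbm).1 le_rfl))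
  rcases le_total a b with hab | hab
  · exact key hF ha hb hab h
  · have hl := (isLocStep_riemann hF.reflect hε ha.neg hb.neg)
    rw [riemann_eq_neg_reflect, hl.leftLim_neg, key hF.reflect ha.neg hb.neg (neg_le_neg hab), neg_neg]
    intro c' hc'
    have := h c' hc'
    rw [riemann_eq_neg_reflect, hl.leftLim_neg, Pi.neg_apply, neg_inj] at this
    exact this

lemma riemann_eq_left (hF : IsGridFlux F ε) (hε : 0 < ε) (ha : InGrid ε a)
    (hb : InGrid ε b) (h : ∀ c', c' ≤ c → leftLim (riemann F a b) c' = riemann F a b c') :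
    riemann F a b c = a := by
  rw [← h c le_rfl]
  exact leftLim_riemann_eq_left hF hε ha hb fun c' hc' => h c' hc'.le

lemma riemann_eq_right (hF : IsGridFlux F ε) (hε : 0 < ε) (ha : InGrid ε a)
    (hb : InGrid ε b) (h : ∀ c', c < c' → leftLim (riemann F a b) c' = riemann F a b c') :
    riemann F a b c = b := by
  -- just after `c` there is no front, so `c` may be replaced by a larger speed
  obtain ⟨δ, hδ, h1, -⟩ := isLocStep_riemann hF hε ha hb c
  rw [← h1 (c + δ / 2) ⟨by linarith, by linarith⟩, ← h (c + δ / 2) (by linarith)]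
  exact leftLim_riemann_eq_right hF hε ha hb fun c' hc' => h c' (by linarith)

lemma riemann_of_neg (hF : IsFlux F) (hc : c < 0) : riemann F a b c = a := by
  have key : ∀ {F a b}, IsFlux F → a ≤ b → riemann F a b c = a := by
    intro F a b hF hab
    have hm := riemann_mem (F := F) hab c
    refine le_antisymm (not_lt.1 fun hlt => ?_) hm.1
    have hx : riemann F a b c ∈ Ioc a b := ⟨hlt, hm.2⟩
    linarith [leftSlope_nonneg hF hx, (le_riemann_iff hF hx).1 le_rfl]
  rcases le_total a b with hab | hab
  · exact key hF hab
  · rw [riemann_eq_neg_reflect, Pi.neg_apply, key hF.reflect (neg_le_neg hab), neg_neg]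

/-- The values of the fan of an upward jump are touching points. -/
lemma touches_riemann (hF : IsFlux F) (hab : a ≤ b) (c : ℝ) : Touches F a b (riemann F a b c) := by
  have hm := riemann_mem (F := F) hab c
  by_contra ht
  rcases hm.1.eq_or_lt with h | h
  · rw [← h] at ht; exact ht (touches_left F a b)
  obtain ⟨e₁, e₂, k, l, -, h1, h2, h3, -, ht₂, haff⟩ :=
    convEnv_affine_of_gap hF h le_rfl hm.2 (by simp) ht
  have hlt : riemann F a b c < e₂ := lt_of_le_of_ne h2 fun h => ht (h ▸ ht₂)
  have h4 := (le_riemann_iff hF ⟨h, hm.2⟩).1 (le_refl (riemann F a b c))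
  rw [leftSlope_of_affine haff ⟨h1, h2⟩, ← leftSlope_of_affine haff ⟨h1.trans hlt, le_rfl⟩,
    ← le_riemann_iff hF ⟨h.trans hlt, h3⟩] at h4
  exact absurd h4 (not_le.2 hlt)

end ScalarWaves

namespace ScalarWaves

/-! ### Piecewise constant profiles -/

/-- A piecewise constant right continuous profile with finitely many jumps and with values in `ε ℤ`
which vanishes near `-∞`. -/
structure IsProfile (ε : ℝ) (w : ℝ → ℝ) : Prop where
  step : IsLocStep w
  finite : {x | leftLim w x ≠ w x}.Finite
  zero : ∃ X, ∀ x < X, w x = 0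
  grid : ∀ x, InGrid ε (w x)

variable {F : ℝ → ℝ} {ε τ z : ℝ} {v w : ℝ → ℝ}

lemma IsLocStep.leftLim_mem (hw : IsLocStep w) (x : ℝ) : ∃ y < x, leftLim w x = w y := by
  obtain ⟨δ, hδ, -, h⟩ := hw x
  exact ⟨x - δ / 2, by linarith, (h _ ⟨by linarith, by linarith⟩).symm⟩

lemma IsProfile.grid_left (hw : IsProfile ε w) (x : ℝ) : InGrid ε (leftLim w x) := by
  obtain ⟨y, -, h⟩ := hw.step.leftLim_mem x
  exact h ▸ hw.grid y

lemma isLocStep_sum {ι : Type*} (s : Finset ι) {g : ι → ℝ → ℝ} (h : ∀ i ∈ s, IsLocStep (g i)) :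
    IsLocStep (fun x => ∑ i ∈ s, g i x) ∧
      ∀ x, leftLim (fun x => ∑ i ∈ s, g i x) x = ∑ i ∈ s, leftLim (g i) x := by
  classical
  induction s using Finset.induction_on with
  | empty =>
    simp only [Finset.sum_empty]
    refine ⟨isLocStep_of fun x => ⟨0, 1, one_pos, fun _ _ => rfl, fun _ _ => rfl⟩, fun x => ?_⟩
    exact leftLim_eq_of_const one_pos fun _ _ => rfl
  | insert i s hi ih =>
    obtain ⟨h1, h2⟩ := ih fun j hj => h j (Finset.mem_insert_of_mem hj)
    have h3 := (h i (Finset.mem_insert_self i s)).sub h1.neg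
    have e : (fun x => ∑ j ∈ insert i s, g j x) =
        fun x => g i x - (-fun x => ∑ j ∈ s, g j x) x := by
      funext x
      rw [Finset.sum_insert hi, Pi.neg_apply, sub_neg_eq_add]
    rw [e]
    refine ⟨h3.1, fun x => ?_⟩
    rw [h3.2, h1.leftLim_neg, h2, sub_neg_eq_add, Finset.sum_insert hi]

lemma isLocStep_ite (ξ l : ℝ) : IsLocStep (fun x => if ξ ≤ x then l else 0) ∧
    ∀ x, leftLim (fun x => if ξ ≤ x then l else 0) x = if ξ < x then l else 0 := by
  have key : ∀ x, ∃ δ > 0, (∀ y ∈ Ico x (x + δ), (if ξ ≤ y then l else 0) = if ξ ≤ x then l else 0) ∧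
      ∀ y ∈ Ioo (x - δ) x, (if ξ ≤ y then l else 0) = if ξ < x then l else 0 := by
    intro x
    rcases lt_trichotomy ξ x with h | rfl | h
    · refine ⟨x - ξ, sub_pos.2 h, fun y hy => ?_, fun y hy => ?_⟩
      · rw [if_pos (h.le.trans hy.1), if_pos h.le]
      · rw [if_pos (by linarith [hy.1]), if_pos h]
    · refine ⟨1, one_pos, fun y hy => ?_, fun y hy => ?_⟩
      · rw [if_pos hy.1, if_pos le_rfl]
      · rw [if_neg (not_le.2 hy.2), if_neg (lt_irrefl _)]
    · refine ⟨ξ - x, sub_pos.2 h, fun y hy => ?_, fun y hy => ?_⟩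
      · rw [if_neg (not_le.2 (by linarith [hy.2])), if_neg (not_le.2 h)]
      · rw [if_neg (not_le.2 (by linarith [hy.2])), if_neg (not_lt.2 h.le)]
  refine ⟨isLocStep_of fun x => ?_, fun x => ?_⟩
  · obtain ⟨δ, hδ, h1, h2⟩ := key x
    exact ⟨_, δ, hδ, h1, h2⟩
  · obtain ⟨δ, hδ, h1, h2⟩ := key x
    exact leftLim_eq_of_const hδ h2

/-- A profile is the sum of its jumps. -/
lemma IsProfile.eq_sum (hw : IsProfile ε w) (x : ℝ) :
    w x = ∑ ξ ∈ hw.finite.toFinset, (if ξ ≤ x then w ξ - leftLim w ξ else 0) ∧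
    leftLim w x = ∑ ξ ∈ hw.finite.toFinset, (if ξ < x then w ξ - leftLim w ξ else 0) := by
  set D := hw.finite.toFinset with hD
  obtain ⟨h1, h2⟩ := isLocStep_sum D (g := fun ξ x => if ξ ≤ x then w ξ - leftLim w ξ else 0)
    fun ξ _ => (isLocStep_ite ξ (w ξ - leftLim w ξ)).1
  simp only [fun ξ => (isLocStep_ite ξ (w ξ - leftLim w ξ)).2] at h2
  have h3 := hw.step.sub h1
  -- both sides have the same jumps
  have hjump : ∀ x, w x - leftLim w x =
      ∑ ξ ∈ D, (if ξ ≤ x then w ξ - leftLim w ξ else 0) -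
      ∑ ξ ∈ D, (if ξ < x then w ξ - leftLim w ξ else 0) := by
    intro x
    rw [← Finset.sum_sub_distrib]
    have : ∀ ξ ∈ D, ((if ξ ≤ x then w ξ - leftLim w ξ else 0) -
        (if ξ < x then w ξ - leftLim w ξ else 0)) = if ξ = x then w x - leftLim w x else 0 := by
      intro ξ _
      rcases lt_trichotomy ξ x with h | rfl | h
      · rw [if_pos h.le, if_pos h, if_neg h.ne, sub_self]
      · simp
      · rw [if_neg (not_le.2 h), if_neg (not_lt.2 h.le), if_neg h.ne', sub_zero]
    rw [Finset.sum_congr rfl this, Finset.sum_ite_eq']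
    split_ifs with h
    · rfl
    · rw [hD, Set.Finite.mem_toFinset, mem_ofPred_eq, not_not] at h
      rw [h, sub_self]
  obtain ⟨X, hX⟩ := hw.zero
  obtain ⟨L, hL⟩ := D.bddBelow
  have h4 := h3.1.eq_of_no_jump (fun x => by rw [h3.2, h2]; linarith [hjump x]) x (min X L - 1)
  have h5 : ∑ ξ ∈ D, (if ξ ≤ min X L - 1 then w ξ - leftLim w ξ else 0) = 0 :=
    Finset.sum_eq_zero fun ξ hξ => if_neg (not_le.2 (by
      linarith [hL (Finset.mem_coe.2 hξ), min_le_right X L]))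
  rw [h5, hX (min X L - 1) (by linarith [min_le_left X L])] at h4
  have h6 := hjump x
  constructor <;> linarith

lemma IsProfile.eq_leftLim (hw : IsProfile ε w) {y y' : ℝ} (hyy : y < y')
    (h : ∀ ξ ∈ Ioo y y', leftLim w ξ = w ξ) : w y = leftLim w y' := by
  rw [(hw.eq_sum y).1, (hw.eq_sum y').2]
  refine Finset.sum_congr rfl fun ξ _ => ?_
  by_cases h1 : ξ ≤ y
  · rw [if_pos h1, if_pos (h1.trans_lt hyy)]
  · rw [if_neg h1]
    split_ifs with h2
    · rw [h ξ ⟨not_le.1 h1, h2⟩, sub_self]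
    · rfl

/-! ### Wavefronts issued from a profile -/

/-- The fan of wavefronts issued from the profile `w` at `ξ`. -/
noncomputable def fan (F w : ℝ → ℝ) (ξ : ℝ) : ℝ → ℝ := riemann F (leftLim w ξ) (w ξ)

/-- A wavefront of speed `c` is issued from the profile `w` at `ξ`. -/
def IsFront (F w : ℝ → ℝ) (ξ c : ℝ) : Prop := leftLim (fan F w ξ) c ≠ fan F w ξ c

lemma mem_frontsThrough {y : ℝ} {p : ℝ × ℝ} :
    p ∈ frontsThrough F w τ y ↔ IsFront F w p.1 p.2 ∧ p.1 + p.2 * τ = y := Iff.rfl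

section Fan

variable (hF : IsGridFlux F ε) (hε : 0 < ε) (hw : IsProfile ε w)
include hF hε hw

lemma isLocStep_fan (ξ : ℝ) : IsLocStep (fan F w ξ) :=
  isLocStep_riemann hF hε (hw.grid_left ξ) (hw.grid ξ)

lemma IsFront.jump {ξ c : ℝ} (h : IsFront F w ξ c) : leftLim w ξ ≠ w ξ := by
  intro h1
  refine h ?_
  obtain ⟨c', -, h2⟩ := (isLocStep_fan hF hε hw ξ).leftLim_mem c
  rw [h2, fan, h1, riemann_self, riemann_self]

lemma finite_fronts : {p : ℝ × ℝ | IsFront F w p.1 p.2}.Finite := by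
  refine (hw.finite.biUnion fun ξ _ => (finite_jumps_riemann hF hε (hw.grid_left ξ)
    (hw.grid ξ)).image fun c => (ξ, c)).subset ?_
  rintro ⟨ξ, c⟩ h
  exact mem_biUnion (h.jump hF hε hw) ⟨c, h, rfl⟩

lemma exists_front {ξ : ℝ} (h : leftLim w ξ ≠ w ξ) : ∃ c, IsFront F w ξ c := by
  by_contra! hno
  have h' : ∀ c, leftLim (riemann F (leftLim w ξ) (w ξ)) c = riemann F (leftLim w ξ) (w ξ) c :=
    fun c => not_not.1 (hno c)
  refine h ?_
  rw [← riemann_eq_left hF hε (hw.grid_left ξ) (hw.grid ξ) (c := 0) fun c _ => h' c]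
  exact riemann_eq_right hF hε (hw.grid_left ξ) (hw.grid ξ) fun c _ => h' c

lemma fan_eq_right {ξ c : ℝ} (h : ∀ c', IsFront F w ξ c' → c' ≤ c) : fan F w ξ c = w ξ :=
  riemann_eq_right hF hε (hw.grid_left ξ) (hw.grid ξ) fun c' hc' =>
    not_not.1 fun h' => not_le.2 hc' (h c' h')

lemma fan_eq_left {ξ c : ℝ} (h : ∀ c', IsFront F w ξ c' → c < c') : fan F w ξ c = leftLim w ξ :=
  riemann_eq_left hF hε (hw.grid_left ξ) (hw.grid ξ) fun c' hc' =>
    not_not.1 fun h' => not_le.2 (h c' h') hc'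

lemma leftLim_fan_eq_right {ξ c : ℝ} (h : ∀ c', IsFront F w ξ c' → c' < c) :
    leftLim (fan F w ξ) c = w ξ :=
  leftLim_riemann_eq_right hF hε (hw.grid_left ξ) (hw.grid ξ) fun c' hc' =>
    not_not.1 fun h' => not_le.2 (h c' h') hc'

lemma leftLim_fan_eq_left {ξ c : ℝ} (h : ∀ c', IsFront F w ξ c' → c ≤ c') :
    leftLim (fan F w ξ) c = leftLim w ξ :=
  leftLim_riemann_eq_left hF hε (hw.grid_left ξ) (hw.grid ξ) fun c' hc' =>
    not_not.1 fun h' => not_le.2 hc' (h c' h')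

end Fan

end ScalarWaves

namespace ScalarWaves

/-! ### Evolution of a profile -/

variable {F : ℝ → ℝ} {ε τ x y z c : ℝ} {v w : ℝ → ℝ}

lemma IsLocStep.comp_affine {g : ℝ → ℝ} (hg : IsLocStep g) (ξ : ℝ) (hτ : 0 < τ) :
    IsLocStep (fun x => g ((x - ξ) / τ)) ∧
      ∀ x, leftLim (fun x => g ((x - ξ) / τ)) x = leftLim g ((x - ξ) / τ) := by
  have key : ∀ x, ∃ δ > 0, (∀ y ∈ Ico x (x + δ), g ((y - ξ) / τ) = g ((x - ξ) / τ)) ∧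
      ∀ y ∈ Ioo (x - δ) x, g ((y - ξ) / τ) = leftLim g ((x - ξ) / τ) := by
    intro x
    obtain ⟨δ, hδ, h1, h2⟩ := hg ((x - ξ) / τ)
    have e : ∀ y, (y - ξ) / τ = (x - ξ) / τ + (y - x) / τ := fun y => by field_simp; ring
    refine ⟨δ * τ, mul_pos hδ hτ, fun y hy => h1 _ ?_, fun y hy => h2 _ ?_⟩
    · have h3 : 0 ≤ (y - x) / τ := div_nonneg (by linarith [hy.1]) hτ.le
      have h4 : (y - x) / τ < δ := (div_lt_iff₀ hτ).2 (by linarith [hy.2])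
      rw [e y]
      constructor <;> linarith
    · have h3 : (y - x) / τ < 0 := div_neg_of_neg_of_pos (by linarith [hy.2]) hτ
      have h4 : -δ < (y - x) / τ := (lt_div_iff₀ hτ).2 (by linarith [hy.1])
      rw [e y]
      constructor <;> linarith
  refine ⟨isLocStep_of fun x => ?_, fun x => ?_⟩
  · obtain ⟨δ, hδ, h1, h2⟩ := key x
    exact ⟨_, δ, hδ, h1, h2⟩
  · obtain ⟨δ, hδ, h1, h2⟩ := key x
    exact leftLim_eq_of_const hδ h2

lemma evolve_zero (F w : ℝ → ℝ) : evolve F w 0 = w := by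
  funext x
  rw [evolve, if_pos rfl]

lemma IsProfile.evolve_eq_sum (hw : IsProfile ε w) (hτ : 0 < τ) (x : ℝ) :
    evolve F w τ x = ∑ ξ ∈ hw.finite.toFinset, (fan F w ξ ((x - ξ) / τ) - leftLim w ξ) := by
  rw [evolve, if_neg hτ.ne']
  refine finsum_eq_sum_of_support_subset _ fun ξ hξ => ?_
  rw [Set.Finite.coe_toFinset, mem_ofPred_eq]
  intro h
  refine hξ ?_
  simp only [h, riemann_self, sub_self]

/-- The contributions of the jumps of a profile add up to the left limit at `y` plus the
contribution of the jump at `y`, if each jump on the left of `y` contributes itself and the jumps on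
the right contribute nothing. -/
lemma IsProfile.sum_eq (hw : IsProfile ε w) {g : ℝ → ℝ} (h1 : ∀ ξ < y, g ξ = w ξ - leftLim w ξ)
    (h2 : ∀ ξ, y < ξ → g ξ = 0) (h3 : leftLim w y = w y → g y = 0) :
    ∑ ξ ∈ hw.finite.toFinset, g ξ = leftLim w y + g y := by
  rw [(hw.eq_sum y).2]
  have : ∀ ξ ∈ hw.finite.toFinset, g ξ =
      (if ξ < y then w ξ - leftLim w ξ else 0) + if ξ = y then g y else 0 := by
    intro ξ _
    rcases lt_trichotomy ξ y with h | rfl | h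
    · rw [if_pos h, if_neg h.ne, h1 ξ h, add_zero]
    · simp
    · rw [if_neg (not_lt.2 h.le), if_neg h.ne', h2 ξ h, add_zero]
  rw [Finset.sum_congr rfl this, Finset.sum_add_distrib, Finset.sum_ite_eq']
  split_ifs with h
  · rfl
  · rw [Set.Finite.mem_toFinset, mem_ofPred_eq, not_not] at h
    rw [h3 h]

section Evolve

variable (hF : IsGridFlux F ε) (hε : 0 < ε) (hw : IsProfile ε w)
include hF hε hw

lemma isLocStep_evolve (hτ : 0 < τ) : IsLocStep (evolve F w τ) ∧ ∀ x, leftLim (evolve F w τ) x =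
    ∑ ξ ∈ hw.finite.toFinset, (leftLim (fan F w ξ) ((x - ξ) / τ) - leftLim w ξ) := by
  have h0 : evolve F w τ = fun x => ∑ ξ ∈ hw.finite.toFinset,
      (fan F w ξ ((x - ξ) / τ) - leftLim w ξ) := funext (hw.evolve_eq_sum hτ)
  have h1 := fun ξ => (isLocStep_fan hF hε hw ξ).comp_affine ξ hτ
  obtain ⟨h2, h3⟩ := isLocStep_sum hw.finite.toFinset
    (g := fun ξ x => fan F w ξ ((x - ξ) / τ) - leftLim w ξ) fun ξ _ => (h1 ξ).1.comp (· - leftLim w ξ)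
  rw [h0]
  refine ⟨h2, fun x => ?_⟩
  rw [h3]
  refine Finset.sum_congr rfl fun ξ _ => ?_
  rw [(h1 ξ).1.leftLim_comp (· - leftLim w ξ), (h1 ξ).2]

lemma exists_front_of_jump (hτ : 0 < τ) (h : leftLim (evolve F w τ) x ≠ evolve F w τ x) :
    ∃ ξ c, IsFront F w ξ c ∧ ξ + c * τ = x := by
  by_contra! hno
  refine h ?_
  rw [(isLocStep_evolve hF hε hw hτ).2, hw.evolve_eq_sum hτ]
  refine Finset.sum_congr rfl fun ξ _ => ?_
  congr 1
  by_contra h1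
  exact hno ξ _ h1 (by field_simp; ring)

lemma isProfile_evolve (hτ : 0 ≤ τ) : IsProfile ε (evolve F w τ) := by
  rcases hτ.eq_or_lt with rfl | hτ
  · rwa [evolve_zero]
  refine ⟨(isLocStep_evolve hF hε hw hτ).1, ?_, ?_, fun x => ?_⟩
  · refine ((finite_fronts hF hε hw).image fun p => p.1 + p.2 * τ).subset fun x hx => ?_
    obtain ⟨ξ, c, h1, h2⟩ := exists_front_of_jump hF hε hw hτ hx
    exact ⟨(ξ, c), h1, h2⟩
  · obtain ⟨L, hL⟩ := hw.finite.toFinset.bddBelow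
    refine ⟨L, fun x hx => ?_⟩
    rw [hw.evolve_eq_sum hτ]
    refine Finset.sum_eq_zero fun ξ hξ => ?_
    have := hL (Finset.mem_coe.2 hξ)
    rw [fan, riemann_of_neg hF.toIsFlux (div_neg_of_neg_of_pos (by linarith) hτ), sub_self]
  · rw [hw.evolve_eq_sum hτ]
    refine Finset.sum_induction _ (InGrid ε) (fun _ _ h h' => h.add h') ⟨0, by simp⟩ fun ξ _ => ?_
    exact (inGrid_riemann hF hε (hw.grid_left ξ) (hw.grid ξ) _).sub (hw.grid_left ξ)

/-- The value of the evolved profile at a point which separates the fronts issued from the left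
of `y` from those issued from its right. -/
lemma evolve_eq_fan (hτ : 0 < τ) (h1 : ∀ ξ < y, ∀ c, IsFront F w ξ c → ξ + c * τ ≤ z)
    (h2 : ∀ ξ, y < ξ → ∀ c, IsFront F w ξ c → z < ξ + c * τ) :
    evolve F w τ z = fan F w y ((z - y) / τ) := by
  rw [hw.evolve_eq_sum hτ, hw.sum_eq (y := y)]
  · ring
  · intro ξ hξ
    rw [fan_eq_right hF hε hw]
    intro c hc
    rw [le_div_iff₀ hτ]
    linarith [h1 ξ hξ c hc]
  · intro ξ hξ
    rw [fan_eq_left hF hε hw, sub_self]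
    intro c hc
    rw [div_lt_iff₀ hτ]
    linarith [h2 ξ hξ c hc]
  · intro h
    rw [fan, h, riemann_self, sub_self]

lemma leftLim_evolve_eq_fan (hτ : 0 < τ) (h1 : ∀ ξ < y, ∀ c, IsFront F w ξ c → ξ + c * τ < z)
    (h2 : ∀ ξ, y < ξ → ∀ c, IsFront F w ξ c → z ≤ ξ + c * τ) :
    leftLim (evolve F w τ) z = leftLim (fan F w y) ((z - y) / τ) := by
  rw [(isLocStep_evolve hF hε hw hτ).2, hw.sum_eq (y := y)]
  · ring
  · intro ξ hξ
    rw [leftLim_fan_eq_right hF hε hw]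
    intro c hc
    rw [lt_div_iff₀ hτ]
    linarith [h1 ξ hξ c hc]
  · intro ξ hξ
    rw [leftLim_fan_eq_left hF hε hw, sub_self]
    intro c hc
    rw [div_le_iff₀ hτ]
    linarith [h2 ξ hξ c hc]
  · intro h
    obtain ⟨c', -, h3⟩ := (isLocStep_fan hF hε hw y).leftLim_mem ((z - y) / τ)
    rw [h3, fan, h, riemann_self, sub_self]

end Evolve

/-! ### Wavefronts do not cross before they collide -/

/-- No wavefronts issued from `w` meet before the time `τ`. -/
def IsSafe (F w : ℝ → ℝ) (τ : ℝ) : Prop := 0 < τ ∧ ∀ τ' ∈ collisionDelays F w, τ ≤ τ'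

lemma mem_collisionDelays {y₁ y₂ c₁ c₂ : ℝ} (hy : y₁ < y₂) (h1 : IsFront F w y₁ c₁)
    (h2 : IsFront F w y₂ c₂) (hτ : 0 < τ) (h : y₁ + c₁ * τ = y₂ + c₂ * τ) :
    τ ∈ collisionDelays F w :=
  ⟨hτ, y₁ + c₁ * τ, (y₁, c₁), ⟨h1, rfl⟩, (y₂, c₂), ⟨h2, h.symm⟩, fun h => hy.ne (Prod.ext_iff.1 h).1⟩

/-- Fronts whose order at the time `τ` differs from the initial one would have met before. -/
lemma IsSafe.le {y₁ y₂ c₁ c₂ : ℝ} (hs : IsSafe F w τ) (hy : y₁ < y₂) (h1 : IsFront F w y₁ c₁)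
    (h2 : IsFront F w y₂ c₂) : y₁ + c₁ * τ ≤ y₂ + c₂ * τ := by
  by_contra! hlt
  have hc : 0 < c₁ - c₂ := by
    by_contra! hc
    nlinarith [hs.1]
  have hmeet : (y₂ - y₁) / (c₁ - c₂) * (c₁ - c₂) = y₂ - y₁ := div_mul_cancel₀ _ hc.ne'
  have h3 := hs.2 _ (mem_collisionDelays hy h1 h2 (div_pos (sub_pos.2 hy) hc) (by linarith))
  rw [le_div_iff₀ hc] at h3
  linarith

lemma IsSafe.lt {y₁ y₂ c₁ c₂ : ℝ} (hs : IsSafe F w τ) (hns : τ ∉ collisionDelays F w)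
    (hy : y₁ < y₂) (h1 : IsFront F w y₁ c₁) (h2 : IsFront F w y₂ c₂) :
    y₁ + c₁ * τ < y₂ + c₂ * τ :=
  lt_of_le_of_ne (hs.le hy h1 h2) fun h => hns (mem_collisionDelays hy h1 h2 hs.1 h)

section Safe

variable (hF : IsGridFlux F ε) (hε : 0 < ε) (hw : IsProfile ε w)
include hF hε hw

lemma finite_collisionDelays : (collisionDelays F w).Finite := by
  refine (((finite_fronts hF hε hw).prod (finite_fronts hF hε hw)).image
    fun q => (q.2.1 - q.1.1) / (q.1.2 - q.2.2)).subset ?_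
  rintro τ ⟨hτ, y, p, ⟨hp, hpy⟩, q, ⟨hq, hqy⟩, hne⟩
  refine ⟨(p, q), ⟨hp, hq⟩, ?_⟩
  have h1 : p.2 - q.2 ≠ 0 := by
    intro h
    refine hne (Prod.ext ?_ (by linarith))
    rw [show p.2 = q.2 by linarith] at hpy
    linarith
  dsimp only
  rw [div_eq_iff h1]
  linarith

lemma delay_mem (h : (collisionDelays F w).Nonempty) : delay F w ∈ collisionDelays F w :=
  h.csInf_mem (finite_collisionDelays hF hε hw)

omit hF hε hw in
lemma delay_nonneg : 0 ≤ delay F w := Real.sInf_nonneg fun _ h => h.1.le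

lemma isSafe_delay (h : (collisionDelays F w).Nonempty) : IsSafe F w (delay F w) :=
  ⟨(delay_mem hF hε hw h).1, fun _ h' => csInf_le (finite_collisionDelays hF hε hw).bddBelow h'⟩

variable (hs : IsSafe F w τ)
include hs

lemma evolve_eq_of_rightmost (h : IsFront F w y c) (hz : y + c * τ = z)
    (hr : ∀ ξ, y < ξ → ∀ c', IsFront F w ξ c' → ξ + c' * τ ≠ z) : evolve F w τ z = fan F w y c := by
  rw [evolve_eq_fan hF hε hw hs.1 (y := y), show (z - y) / τ = c by
    rw [div_eq_iff hs.1.ne']; linarith]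
  · exact fun ξ hξ c' hc' => hz ▸ hs.le hξ hc' h
  · exact fun ξ hξ c' hc' => lt_of_le_of_ne (hz ▸ hs.le hξ h hc') (hr ξ hξ c' hc').symm

lemma leftLim_evolve_eq_of_leftmost (h : IsFront F w y c) (hz : y + c * τ = z)
    (hl : ∀ ξ < y, ∀ c', IsFront F w ξ c' → ξ + c' * τ ≠ z) :
    leftLim (evolve F w τ) z = leftLim (fan F w y) c := by
  rw [leftLim_evolve_eq_fan hF hε hw hs.1 (y := y), show (z - y) / τ = c by
    rw [div_eq_iff hs.1.ne']; linarith]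
  · exact fun ξ hξ c' hc' => lt_of_le_of_ne (hz ▸ hs.le hξ hc' h) (hl ξ hξ c' hc')
  · exact fun ξ hξ c' hc' => hz ▸ hs.le hξ h hc'

/-- Two consecutive wavefronts that meet at `z` share the state between them. -/
lemma fan_eq_leftLim_fan {y₁ y₂ c₁ c₂ : ℝ} (hy : y₁ < y₂) (h1 : IsFront F w y₁ c₁)
    (h2 : IsFront F w y₂ c₂) (hz₁ : y₁ + c₁ * τ = z) (hz₂ : y₂ + c₂ * τ = z)
    (hno : ∀ ξ ∈ Ioo y₁ y₂, ∀ c, IsFront F w ξ c → ξ + c * τ ≠ z) :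
    fan F w y₁ c₁ = leftLim (fan F w y₂) c₂ := by
  rw [fan_eq_right hF hε hw, leftLim_fan_eq_left hF hε hw, hw.eq_leftLim hy]
  · intro ξ hξ
    by_contra hj
    obtain ⟨c, hc⟩ := exists_front hF hε hw hj
    exact hno ξ hξ c hc (le_antisymm (hz₂ ▸ hs.le hξ.2 hc h2) (hz₁ ▸ hs.le hξ.1 h1 hc))
  · intro c' hc'
    have := hs.le hy h1 hc'
    by_contra! hlt
    nlinarith [hs.1]
  · intro c' hc'
    have := hs.le hy hc' h2
    by_contra! hlt
    nlinarith [hs.1]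

/-- The states of an upward jump of the evolved profile are carried by the fronts that arrive at
the jump. -/
lemma exists_front_of_mem_jump {u : ℝ}
    (hu : u ∈ Ioc (leftLim (evolve F w τ) z) (evolve F w τ z)) :
    ∃ y c, IsFront F w y c ∧ y + c * τ = z ∧ u ∈ Ioc (leftLim (fan F w y) c) (fan F w y c) := by
  have hfin : (frontsThrough F w τ z).Finite :=
    (finite_fronts hF hε hw).subset fun p hp => (mem_frontsThrough.1 hp).1
  have hspeed : ∀ p ∈ frontsThrough F w τ z, ∀ q ∈ frontsThrough F w τ z, p.1 = q.1 → p = q := by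
    intro p hp q hq h
    refine Prod.ext h (mul_right_cancel₀ hs.1.ne' ?_)
    linarith [(mem_frontsThrough.1 hp).2, (mem_frontsThrough.1 hq).2]
  -- among the fronts arriving at `z` whose right state is at least `u`, take the leftmost
  obtain ⟨ξ, c₀, hc₀, hξ⟩ := exists_front_of_jump hF hε hw hs.1 (hu.1.trans_le hu.2).ne
  obtain ⟨⟨yr, cr⟩, hr, hrmax⟩ := hfin.exists_maximalFor Prod.fst _ ⟨(ξ, c₀), hc₀, hξ⟩
  have hright : u ≤ fan F w yr cr := by
    rw [← evolve_eq_of_rightmost hF hε hw hs hr.1 hr.2]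
    · exact hu.2
    · exact fun η hη c' hc' hz => absurd (hrmax (j := (η, c')) ⟨hc', hz⟩ hη.le) (not_le.2 hη)
  obtain ⟨⟨y, c⟩, ⟨⟨hf, hz⟩, huy⟩, hmin⟩ :=
    (hfin.subset (sep_subset _ fun p => u ≤ fan F w p.1 p.2)).exists_minimalFor Prod.fst _
      ⟨(yr, cr), hr, hright⟩
  refine ⟨y, c, hf, hz, ?_, huy⟩
  by_cases hl : ∃ p ∈ frontsThrough F w τ z, p.1 < y
  · obtain ⟨⟨y', c'⟩, ⟨⟨hf', hz'⟩, hlt⟩, hmax⟩ :=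
      (hfin.subset (sep_subset _ fun p : ℝ × ℝ => p.1 < y)).exists_maximalFor Prod.fst _ hl
    rw [← fan_eq_leftLim_fan hF hε hw hs hlt hf' hf hz' hz fun η hη c hc hηz =>
      absurd (hmax (j := (η, c)) ⟨⟨hc, hηz⟩, hη.2⟩ hη.1.le) (not_le.2 hη.1)]
    by_contra! hle
    exact absurd (hmin (j := (y', c')) ⟨⟨hf', hz'⟩, hle⟩ hlt.le) (not_le.2 hlt)
  · push Not at hl
    rw [← leftLim_evolve_eq_of_leftmost hF hε hw hs hf hz fun η hη c' hc' hηz =>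
      absurd (hl (η, c') ⟨hc', hηz⟩) (not_le.2 hη)]
    exact hu.1

end Safe

end ScalarWaves

namespace ScalarWaves

/-! ### Wavefront tracking: the waves at the collision times -/

variable {F : ℝ → ℝ} {ε x y y' r r' u : ℝ} {v : ℝ → ℝ} {n : ℕ}

lemma InGrid.eq_of_abs_lt (hε : 0 < ε) {a b : ℝ} (ha : InGrid ε a) (hb : InGrid ε b)
    (h : |a - b| < ε) : a = b := by
  obtain ⟨m, rfl⟩ := ha
  obtain ⟨k, rfl⟩ := hb
  rw [← sub_mul, abs_mul, abs_of_pos hε] at h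
  have h1 : |(m : ℝ) - k| < 1 := by
    by_contra! hle
    nlinarith
  have h2 : |m - k| < 1 := by exact_mod_cast h1
  rw [show m = k by have := Int.abs_lt_one_iff.1 h2; omega]

lemma IsFrontDatum.isLocStep (hε : 0 < ε) (hv : IsFrontDatum ε v) : IsLocStep v := by
  refine isLocStep_of fun x => ?_
  have h1 := hv.rightCont x
  have h2 := hv.boundedVar.tendsto_leftLim x
  obtain ⟨δ₁, hδ₁, h1⟩ := Metric.continuousWithinAt_iff.1 h1 ε hε
  obtain ⟨δ₂, hδ₂, h2⟩ := Metric.tendsto_nhdsWithin_nhds.1 h2 (ε / 2) (half_pos hε)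
  have h1' : ∀ y ∈ Ico x (x + δ₁), v y = v x := fun y hy => by
    refine InGrid.eq_of_abs_lt hε (hv.values y) (hv.values x) (h1 hy.1 ?_)
    rw [Real.dist_eq, abs_of_nonneg (by linarith [hy.1])]
    linarith [hy.2]
  have h2' : ∀ y ∈ Ioo (x - δ₂) x, |v y - leftLim v x| < ε / 2 := fun y hy => by
    refine h2 hy.2 ?_
    rw [Real.dist_eq, abs_of_neg (by linarith [hy.2])]
    linarith [hy.1]
  refine ⟨v (x - δ₂ / 2), min δ₁ δ₂, lt_min hδ₁ hδ₂,
    fun y hy => h1' y ⟨hy.1, hy.2.trans_le (by linarith [min_le_left δ₁ δ₂])⟩, fun y hy => ?_⟩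
  refine InGrid.eq_of_abs_lt hε (hv.values y) (hv.values _) ?_
  have h3 := h2' y ⟨by linarith [hy.1, min_le_right δ₁ δ₂], hy.2⟩
  have h4 := h2' (x - δ₂ / 2) ⟨by linarith, by linarith⟩
  rw [abs_lt] at h3 h4 ⊢
  constructor <;> linarith

lemma IsFrontDatum.isProfile (hε : 0 < ε) (hv : IsFrontDatum ε v) : IsProfile ε v where
  step := hv.isLocStep hε
  finite := by
    by_contra hinf
    have hsub : {x | leftLim v x ≠ v x} ⊆ tsupport v := by
      intro x hx
      by_contra hxs
      obtain ⟨δ, hδ, h⟩ := Metric.eventually_nhds_iff.1 (notMem_tsupport_iff_eventuallyEq.1 hxs)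
      refine hx ?_
      rw [leftLim_eq_of_const (l := 0) hδ fun y hy => ?_]
      · exact (h (by rwa [dist_self])).symm
      · exact h (by rw [Real.dist_eq, abs_of_neg (by linarith [hy.2])]; linarith [hy.1])
    obtain ⟨x, -, hx⟩ := Set.Infinite.exists_accPt_of_subset_isCompact hinf hv.compactSupport hsub
    obtain ⟨δ, hδ, h1, h2⟩ := hv.isLocStep hε x
    obtain ⟨y, ⟨hyU, hyj⟩, hne⟩ := accPt_iff_nhds.1 hx _
      (Ioo_mem_nhds (by linarith : x - δ < x) (by linarith : x < x + δ))
    refine hyj ?_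
    rcases lt_or_gt_of_ne hne with h | h
    · rw [leftLim_eq_of_const (l := leftLim v x) (δ := y - (x - δ)) (by linarith [hyU.1]) fun z hz =>
        h2 z ⟨by linarith [hz.1], hz.2.trans h⟩, h2 y ⟨hyU.1, h⟩]
    · rw [leftLim_eq_of_const (l := v x) (δ := y - x) (by linarith) fun z hz =>
        h1 z ⟨by linarith [hz.1], hz.2.trans hyU.2⟩, h1 y ⟨h.le, hyU.2⟩]
  zero := by
    obtain ⟨X, hX⟩ := hv.compactSupport.isCompact.bddBelow
    exact ⟨X, fun x hx => image_eq_zero_of_notMem_tsupport fun h => not_le.2 hx (hX h)⟩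
  grid := hv.values

lemma IsFrontDatum.neg (hv : IsFrontDatum ε v) : IsFrontDatum ε (-v) where
  compactSupport := hv.compactSupport.neg
  rightCont x := (hv.rightCont x).neg
  boundedVar := boundedVariationOn_neg hv.boundedVar
  values x := InGrid.neg (hv.values x)

section Datum

variable (hε : 0 < ε) (hv : IsFrontDatum ε v)
include hε hv

lemma inGrid_varUpTo (x : ℝ) : InGrid ε (varUpTo v x) := by
  have hs := isLocStep_varUpTo (hv.isLocStep hε)
  have hp := hv.isProfile hε
  obtain ⟨X, hX⟩ := hp.zero
  -- the fractional part of the variation does not jump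
  have h := (hs.comp fun a => Int.fract (a / ε)).eq_of_no_jump (fun x => by
    rw [hs.leftLim_comp fun a => Int.fract (a / ε), varUpTo_eq hv.boundedVar (hv.isLocStep hε) x]
    obtain ⟨m, hm⟩ := (hp.grid x).sub (hp.grid_left x)
    rw [hm, abs_mul, abs_of_pos hε, add_div, mul_div_cancel_right₀ _ hε.ne', ← Int.cast_abs,
      Int.fract_add_intCast]) x (X - 1)
  have h0 : varUpTo v (X - 1) = 0 := by
    rw [varUpTo, eVariationOn_eq_zero_of_const (l := 0) fun y hy => hX y (by linarith [mem_Iic.1 hy])]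
    rfl
  simp only [h0, zero_div, Int.fract_zero] at h
  rw [Int.fract_eq_iff] at h
  obtain ⟨-, -, m, hm⟩ := h
  exact ⟨m, by rw [sub_zero, div_eq_iff hε.ne'] at hm; exact hm⟩

lemma inGrid_leftLim_varUpTo (x : ℝ) : InGrid ε (leftLim (varUpTo v) x) := by
  obtain ⟨y, -, h⟩ := (isLocStep_varUpTo (hv.isLocStep hε)).leftLim_mem x
  exact h ▸ inGrid_varUpTo hε hv y

omit hv in
lemma mem_cell (hr : 0 < r) : r ∈ Ioc (⌈r / ε⌉₊ * ε - ε) (⌈r / ε⌉₊ * ε) := by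
  have h1 := Nat.ceil_lt_add_one (div_pos hr hε).le
  have h2 := Nat.le_ceil (r / ε)
  rw [div_le_iff₀ hε] at h2
  rw [← sub_lt_iff_lt_add, lt_div_iff₀ hε] at h1
  exact ⟨by linarith, h2⟩

/-- The labels of a cell have the same position because the variation takes values in `ε ℤ`. -/
lemma initPos_cell (hr : 0 < r) : initPos v (⌈r / ε⌉₊ * ε) = initPos v r := by
  have hm := mem_cell hε hr
  have hr' : 0 < ⌈r / ε⌉₊ * ε := hr.trans_le hm.2
  have hg : InGrid ε (⌈r / ε⌉₊ * ε) := ⟨⌈r / ε⌉₊, by push_cast; rfl⟩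
  have hm' : (⌈r / ε⌉₊ * ε : ℝ) ∈ Ioc (⌈r / ε⌉₊ * ε - ε) (⌈r / ε⌉₊ * ε) := ⟨by linarith, le_rfl⟩
  have key : ∀ x : ℝ, initPos v (⌈r / ε⌉₊ * ε) = x ↔ initPos v r = x := fun x => by
    rw [initPos_eq_iff hv.boundedVar (hv.isLocStep hε) hr,
      initPos_eq_iff hv.boundedVar (hv.isLocStep hε) hr',
      (inGrid_leftLim_varUpTo hε hv x).lt_iff hε hg hm,
      (inGrid_leftLim_varUpTo hε hv x).lt_iff hε hg hm',
      (inGrid_varUpTo hε hv x).le_iff hε hg hm, (inGrid_varUpTo hε hv x).le_iff hε hg hm']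
  by_cases h : initPos v r = ⊤
  · by_contra h'
    obtain ⟨x, hx⟩ := WithTop.ne_top_iff_exists.1 (h ▸ h')
    exact absurd ((key x).1 hx.symm) (h ▸ WithTop.top_ne_coe)
  · obtain ⟨x, hx⟩ := WithTop.ne_top_iff_exists.1 h
    rw [← hx, key, hx]

lemma frontSign_cell (hr : 0 < r) : frontSign ε v ⌈r / ε⌉₊ = initSign v r := by
  rw [frontSign, initSign, initSign, initPos_cell hε hv hr]

lemma frontState_cell (hr : 0 < r) (hs : 0 < initSign v r) :
    frontState ε v ⌈r / ε⌉₊ = initState v r + (⌈r / ε⌉₊ * ε - r) := by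
  have h : initSign v (⌈r / ε⌉₊ * ε) = 1 := by
    rw [← initSign_eq_one_of_pos hs]; exact frontSign_cell hε hv hr
  rw [frontState, initState, initState, initPos_cell hε hv hr, h, initSign_eq_one_of_pos hs]
  ring

lemma initState_mem_cell (hr : 0 < r) (hs : 0 < initSign v r) :
    initState v r ∈ Ioc (frontState ε v ⌈r / ε⌉₊ - ε) (frontState ε v ⌈r / ε⌉₊) := by
  have hm := mem_cell hε hr
  rw [frontState_cell hε hv hr hs]
  constructor <;> linarith [hm.1, hm.2]

lemma inGrid_frontState {s : ℕ} (hs : 0 < frontSign ε v s) : InGrid ε (frontState ε v s) := by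
  rw [frontState, initState, initSign_eq_one_of_pos hs, one_mul]
  exact ((hv.isProfile hε).grid_left _).add
    (InGrid.sub ⟨s, by push_cast; rfl⟩ (inGrid_leftLim_varUpTo hε hv _))

end Datum

/-- The real labels of the positive waves. The wave `s` of wavefront tracking corresponds to the
labels in `((s - 1) ε, s ε]`. -/
def frontPosWaves (ε : ℝ) (v : ℝ → ℝ) : Set ℝ :=
  {r | 0 < r ∧ ⌈r / ε⌉₊ ∈ frontWaves ε v ∧ 0 < initSign v r}

/-- Position at the `n`-th collision time of the wave with the real label `r`. -/
noncomputable def labelPos (F : ℝ → ℝ) (ε : ℝ) (v : ℝ → ℝ) (n : ℕ) (r : ℝ) : WithTop ℝ :=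
  frontPosAt F ε v n ⌈r / ε⌉₊

lemma collisionDelays_nonempty (h : frontTime F v (n + 1) ≠ ⊤) :
    (collisionDelays F (frontProfile F v n)).Nonempty := by
  by_contra h'
  exact h (by rw [frontTime, if_neg h'])

lemma frontTime_of_succ (h : frontTime F v (n + 1) ≠ ⊤) : frontTime F v n ≠ ⊤ := by
  intro h'
  rw [frontTime, if_pos (collisionDelays_nonempty h), h', top_add] at h
  exact h rfl

lemma frontPosAt_of_succ {s : ℕ} (h : frontPosAt F ε v (n + 1) s ≠ ⊤) :
    frontPosAt F ε v n s ≠ ⊤ := by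
  intro h'
  rw [frontPosAt, if_pos h'] at h
  exact h rfl

section Tracking

variable (hF : IsGridFlux F ε) (hε : 0 < ε) (hv : IsFrontDatum ε v)
include hF hε hv

lemma isProfile_frontProfile (n : ℕ) : IsProfile ε (frontProfile F v n) := by
  induction n with
  | zero => exact hv.isProfile hε
  | succ n ih => exact isProfile_evolve hF hε ih delay_nonneg

/-- The speed of a positive wave at a jump of the profile `w` that contains its state. -/
lemma frontSpeedAt_eq {w : ℝ → ℝ} (hw : IsProfile ε w) (hr : r ∈ frontPosWaves ε v)
    (h : initState v r ∈ Ioc (leftLim w y) (w y)) :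
    frontSpeedAt F ε w y (frontState ε v ⌈r / ε⌉₊) =
      leftSlope F (leftLim w y) (w y) (initState v r) := by
  have hm := initState_mem_cell hε hv hr.1 hr.2.2
  have hu := inGrid_frontState hε hv (s := ⌈r / ε⌉₊) (by rw [frontSign_cell hε hv hr.1]; exact hr.2.2)
  rw [frontSpeedAt, if_pos (h.1.trans_le h.2)]
  exact deriv_convEnv_cell hF hε hu (((hw.grid_left y).lt_iff hε hu hm).1 h.1)
    (((hw.grid y).le_iff hε hu hm).1 h.2) hm

omit hv in
lemma isFront_leftSlope {w : ℝ → ℝ} (hw : IsProfile ε w) (h : u ∈ Ioc (leftLim w y) (w y)) :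
    IsFront F w y (leftSlope F (leftLim w y) (w y) u) ∧
      u ∈ Ioc (leftLim (fan F w y) (leftSlope F (leftLim w y) (w y) u))
        (fan F w y (leftSlope F (leftLim w y) (w y) u)) := by
  have := jump_riemann_of_mem hF hε (hw.grid_left y) (hw.grid y) h
  exact ⟨(this.1.trans_le this.2).ne, this⟩

/-- A positive wave moves with its front and survives if the jump where it arrives contains its
state, which is the case if no other front arrives there. -/
lemma labelPos_succ (hn : frontTime F v (n + 1) ≠ ⊤) (hr : r ∈ frontPosWaves ε v)
    (hy : labelPos F ε v n r = y)
    (h : initState v r ∈ Ioc (leftLim (frontProfile F v n) y) (frontProfile F v n y)) :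
    labelPos F ε v (n + 1) r = x ↔
      y + leftSlope F (leftLim (frontProfile F v n) y) (frontProfile F v n y) (initState v r) *
        delay F (frontProfile F v n) = x ∧
      initState v r ∈ Ioc (leftLim (frontProfile F v (n + 1)) x) (frontProfile F v (n + 1) x) := by
  have hw := isProfile_frontProfile hF hε hv n
  have hw' := isProfile_frontProfile hF hε hv (n + 1)
  have hm := initState_mem_cell hε hv hr.1 hr.2.2
  have hsign : frontSign ε v ⌈r / ε⌉₊ = 1 := by
    rw [frontSign_cell hε hv hr.1, initSign_eq_one_of_pos hr.2.2]
  have hu := inGrid_frontState hε hv (s := ⌈r / ε⌉₊) (by rw [hsign]; exact one_pos)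
  have hsafe := isSafe_delay hF hε hw (collisionDelays_nonempty hn)
  rw [labelPos] at hy
  rw [labelPos, frontPosAt, if_neg (by rw [hy]; exact WithTop.coe_ne_top)]
  dsimp only
  rw [hy, WithTop.untopD_coe, frontSpeedAt_eq hF hε hv hw hr h, hsign, one_mul, one_mul, one_mul]
  set c := leftSlope F (leftLim (frontProfile F v n) y) (frontProfile F v n y) (initState v r) with hc
  obtain ⟨hfront, hjump⟩ := isFront_leftSlope hF hε hw h
  rw [← hc] at hfront hjump
  set z := y + c * delay F (frontProfile F v n) with hz
  have hcell : (leftLim (frontProfile F v (n + 1)) z ≤ frontState ε v ⌈r / ε⌉₊ - ε ∧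
      frontState ε v ⌈r / ε⌉₊ ≤ frontProfile F v (n + 1) z) ↔
      initState v r ∈ Ioc (leftLim (frontProfile F v (n + 1)) z) (frontProfile F v (n + 1) z) := by
    rw [mem_Ioc, (hw'.grid_left z).lt_iff hε hu hm, (hw'.grid z).le_iff hε hu hm]
  have hsingle : ¬ (frontsThrough F (frontProfile F v n) (delay F (frontProfile F v n)) z).Nontrivial →
      initState v r ∈ Ioc (leftLim (frontProfile F v (n + 1)) z) (frontProfile F v (n + 1) z) := by
    intro hnt
    have huniq := not_nontrivial_iff.1 hnt
    have hmem : ((y, c) : ℝ × ℝ) ∈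
      frontsThrough F (frontProfile F v n) (delay F (frontProfile F v n)) z := ⟨hfront, rfl⟩
    rw [frontProfile, evolve_eq_of_rightmost hF hε hw hsafe hfront hz.symm,
      leftLim_evolve_eq_of_leftmost hF hε hw hsafe hfront hz.symm]
    · exact hjump
    · intro ξ hξ c' hc' hz'
      exact hξ.ne (Prod.ext_iff.1 (huniq (x := (ξ, c')) ⟨hc', hz'⟩ hmem)).1
    · intro ξ hξ c' hc' hz'
      exact hξ.ne' (Prod.ext_iff.1 (huniq (x := (ξ, c')) ⟨hc', hz'⟩ hmem)).1
  split_ifs with hcond <;> rw [hcell] at hcond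
  · refine ⟨fun h => absurd h WithTop.top_ne_coe, fun ⟨h1, h2⟩ => absurd (h1 ▸ h2) hcond.2⟩
  · rw [WithTop.coe_inj]
    refine ⟨fun h => ⟨h, h ▸ ?_⟩, fun h => h.1⟩
    by_cases hnt : (frontsThrough F (frontProfile F v n) (delay F (frontProfile F v n)) z).Nontrivial
    · exact not_not.1 fun h' => hcond ⟨hnt, h'⟩
    · exact hsingle hnt

omit hF in
lemma labelPos_zero (hr : 0 < r) : labelPos F ε v 0 r = initPos v r := by
  rw [labelPos, frontPosAt, initPos_cell hε hv hr]

lemma label_mem (hn : frontTime F v n ≠ ⊤) (hr : r ∈ frontPosWaves ε v)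
    (hy : labelPos F ε v n r = y) :
    initState v r ∈ Ioc (leftLim (frontProfile F v n) y) (frontProfile F v n y) := by
  induction n generalizing y with
  | zero =>
    rw [labelPos_zero hε hv hr.1] at hy
    exact initState_mem hv.boundedVar (hv.isLocStep hε) hr.1 hy hr.2.2
  | succ n ih =>
    have ha : labelPos F ε v n r ≠ ⊤ :=
      frontPosAt_of_succ (by rw [← labelPos, hy]; exact WithTop.coe_ne_top)
    obtain ⟨y₀, hy₀⟩ := WithTop.ne_top_iff_exists.1 ha
    exact ((labelPos_succ hF hε hv hn hr hy₀.symm (ih (frontTime_of_succ hn) hy₀.symm)).1 hy).2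

/-- The positive waves at a point carry all the states of the jump there. -/
lemma label_fill (hn : frontTime F v n ≠ ⊤)
    (hu : u ∈ Ioc (leftLim (frontProfile F v n) y) (frontProfile F v n y)) :
    ∃ r ∈ frontPosWaves ε v, labelPos F ε v n r = y ∧ initState v r = u := by
  induction n generalizing y with
  | zero =>
    obtain ⟨r, hr, h1, h2, h3, h4, h5, -⟩ := exists_initState hv.boundedVar (hv.isLocStep hε) hu
    refine ⟨r, ⟨hr.1, ⟨Nat.ceil_pos.2 (div_pos hr.1 hε), ?_⟩, h1⟩, ?_, h3⟩
    · refine le_trans ?_ (varUpTo_le_totVar hv.boundedVar y)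
      exact ((inGrid_varUpTo hε hv y).le_iff hε ⟨⌈r / ε⌉₊, by push_cast; rfl⟩ (mem_cell hε hr.1)).1 h5
    · rw [labelPos_zero hε hv hr.1, h2]
  | succ n ih =>
    have hw := isProfile_frontProfile hF hε hv n
    obtain ⟨y₀, c, -, hz, hj⟩ := exists_front_of_mem_jump hF hε hw
      (isSafe_delay hF hε hw (collisionDelays_nonempty hn)) hu
    have hlt := lt_of_lt_jump hF hε (hw.grid_left y₀) (hw.grid y₀) (hj.1.trans_le hj.2)
    obtain ⟨c', -, hc'⟩ := (isLocStep_fan hF hε hw y₀).leftLim_mem c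
    have hu₀ : u ∈ Ioc (leftLim (frontProfile F v n) y₀) (frontProfile F v n y₀) :=
      ⟨((riemann_mem hlt.le c').1.trans_eq hc'.symm).trans_lt hj.1,
        hj.2.trans (riemann_mem hlt.le c).2⟩
    obtain ⟨r, hr, hy, rfl⟩ := ih (frontTime_of_succ hn) hu₀
    refine ⟨r, hr, (labelPos_succ hF hε hv hn hr hy hu₀).2 ⟨?_, hu⟩, rfl⟩
    rw [leftSlope_eq_of_mem_jump hF hε (hw.grid_left y₀) (hw.grid y₀) hu₀ hj, hz]

variable (hbin : BinaryCollisions F v)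
include hbin

/-- Waves keep their order. Two waves that meet after having left different points belong to
consecutive fronts, because only two fronts meet. -/
lemma label_mono_strict (hn : frontTime F v n ≠ ⊤) (hr : r ∈ frontPosWaves ε v)
    (hr' : r' ∈ frontPosWaves ε v) (hrr : r < r') (hy : labelPos F ε v n r = y)
    (hy' : labelPos F ε v n r' = y') : y ≤ y' ∧ (y = y' → initState v r < initState v r') := by
  induction n generalizing y y' with
  | zero =>
    rw [labelPos_zero hε hv hr.1] at hy
    rw [labelPos_zero hε hv hr'.1] at hy'
    have h1 := initPos_mono hv.boundedVar (hv.isLocStep hε) hr.1 hrr.le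
      (by rw [hy]; exact WithTop.coe_ne_top) (by rw [hy']; exact WithTop.coe_ne_top)
    rw [hy, hy', WithTop.coe_le_coe] at h1
    exact ⟨h1, fun h => initState_strict hy (h ▸ hy') hr.2.2 hr'.2.2 hrr⟩
  | succ n ih =>
    have hn' := frontTime_of_succ hn
    have hw := isProfile_frontProfile hF hε hv n
    have hsafe := isSafe_delay hF hε hw (collisionDelays_nonempty hn)
    obtain ⟨y₀, hy₀⟩ := WithTop.ne_top_iff_exists.1 (frontPosAt_of_succ (F := F) (v := v) (n := n)
      (s := ⌈r / ε⌉₊) (by rw [← labelPos, hy]; exact WithTop.coe_ne_top))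
    obtain ⟨y₀', hy₀'⟩ := WithTop.ne_top_iff_exists.1 (frontPosAt_of_succ (F := F) (v := v) (n := n)
      (s := ⌈r' / ε⌉₊) (by rw [← labelPos, hy']; exact WithTop.coe_ne_top))
    have hm := label_mem hF hε hv hn' hr hy₀.symm
    have hm' := label_mem hF hε hv hn' hr' hy₀'.symm
    obtain ⟨hz, -⟩ := (labelPos_succ hF hε hv hn hr hy₀.symm hm).1 hy
    obtain ⟨hz', -⟩ := (labelPos_succ hF hε hv hn hr' hy₀'.symm hm').1 hy'
    obtain ⟨h1, h2⟩ := ih hn' hy₀.symm hy₀'.symm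
    rcases h1.eq_or_lt with rfl | hlt
    · have h3 := leftSlope_mono hF.toIsFlux hm.1 (h2 rfl).le hm'.2
      have h4 := mul_le_mul_of_nonneg_right h3 hsafe.1.le
      exact ⟨by linarith, fun _ => h2 rfl⟩
    · obtain ⟨hf, hj⟩ := isFront_leftSlope hF hε hw hm
      obtain ⟨hf', hj'⟩ := isFront_leftSlope hF hε hw hm'
      have h3 := hsafe.le hlt hf hf'
      refine ⟨by linarith, ?_⟩
      rintro rfl
      refine hj.2.trans_lt (lt_of_le_of_lt (le_of_eq ?_) hj'.1)
      refine fan_eq_leftLim_fan hF hε hw hsafe hlt hf hf' hz hz' fun ξ hξ c hc hξz => ?_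
      obtain ⟨z, h2z, h1z⟩ := hbin n hn
      have e1 : (y₀, _) ∈ frontsThrough F _ _ y := ⟨hf, hz⟩
      have e2 : (y₀', _) ∈ frontsThrough F _ _ y := ⟨hf', hz'⟩
      have e3 : (ξ, c) ∈ frontsThrough F _ _ y := ⟨hc, hξz⟩
      by_cases hyz : y = z
      · rw [← hyz, ncard_eq_two] at h2z
        obtain ⟨p, q, -, hpq⟩ := h2z
        rw [hpq] at e1 e2 e3
        have key : ∀ a ∈ ({p, q} : Set (ℝ × ℝ)), a.1 = p.1 ∨ a.1 = q.1 := by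
          rintro a (rfl | rfl)
          exacts [Or.inl rfl, Or.inr rfl]
        have k1 := key _ e1
        have k2 := key _ e2
        have k3 := key _ e3
        dsimp only at k1 k2 k3
        rcases k1 with k1 | k1 <;> rcases k2 with k2 | k2 <;> rcases k3 with k3 | k3 <;>
          linarith [hξ.1, hξ.2]
      · exact hξ.1.ne (Prod.ext_iff.1 (h1z y hyz e1 e3)).1

/-- The positive waves of wavefront tracking form a system of waves. -/
lemma isWaveSystem_front {N : ℕ} (hN : frontTime F v N ≠ ⊤) :
    IsWaveSystem F N (frontPosWaves ε v) (labelPos F ε v) (initState v)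
      (fun n => leftLim (frontProfile F v n)) (frontProfile F v) := by
  have live : ∀ n ≤ N, frontTime F v n ≠ ⊤ := by
    intro n hn
    induction N, hn using Nat.le_induction with
    | base => exact hN
    | succ N hn ih => exact ih (frontTime_of_succ hN)
  constructor
  · exact hF.toIsFlux.continuous
  · exact fun n _ r _ h => frontPosAt_of_succ h
  · intro n hn r hr r' hr' h h' hrr
    rcases hrr.eq_or_lt with rfl | hrr
    · rfl
    obtain ⟨m, hm⟩ := WithTop.ne_top_iff_exists.1 h
    obtain ⟨m', hm'⟩ := WithTop.ne_top_iff_exists.1 h'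
    rw [← hm, ← hm', WithTop.coe_le_coe]
    exact (label_mono_strict hF hε hv hbin (live n hn) hr hr' hrr hm.symm hm'.symm).1
  · exact fun n hn r hr y hy => label_mem hF hε hv (live n hn) hr hy
  · exact fun n hn y u hu => label_fill hF hε hv (live n hn) hu
  · exact fun n hn r hr r' hr' hrr y hy hy' =>
      (label_mono_strict hF hε hv hbin (live n hn) hr hr' hrr hy hy').2 rfl
  · exact fun n _ y y' u hyy hu hu' => (isProfile_frontProfile hF hε hv n).step.exists_jump hyy hu hu'
  · intro n hn r hr r' hr' hrr y hy hy' ha ha' hgap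
    have hn₀ := live n hn.le
    obtain ⟨z, hz⟩ := WithTop.ne_top_iff_exists.1 ha
    obtain ⟨z', hz'⟩ := WithTop.ne_top_iff_exists.1 ha'
    have h1 := label_mem hF hε hv hn₀ hr hy
    have h2 := label_mem hF hε hv hn₀ hr' hy'
    have h3 := leftSlope_eq_of_gap hF.toIsFlux h1.1
      ((label_mono_strict hF hε hv hbin hn₀ hr hr' hrr hy hy').2 rfl) h2.2 hgap
    have h4 := ((labelPos_succ hF hε hv (live _ hn) hr hy h1).1 hz.symm).1
    have h5 := ((labelPos_succ hF hε hv (live _ hn) hr' hy' h2).1 hz'.symm).1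
    rw [← hz, ← hz', ← h4, ← h5, h3]
  · obtain ⟨M, hM⟩ := exists_bound_initState hv.boundedVar (hv.isLocStep hε)
    exact ⟨M, fun r hr => hM r ⟨hr.1, (mem_cell hε hr.1).2.trans hr.2.1.2⟩⟩

end Tracking

end ScalarWaves

namespace ScalarWaves

/-! ### Wavefront tracking: reflection -/

variable {F : ℝ → ℝ} {ε τ x y y' c r : ℝ} {v w : ℝ → ℝ} {n j k s s' : ℕ}

lemma fan_reflect (hw : IsLocStep w) (ξ : ℝ) : fan (reflect F) (-w) ξ = -fan F w ξ := by
  funext c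
  rw [fan, hw.leftLim_neg, Pi.neg_apply, Pi.neg_apply, riemann_reflect, fan]

lemma evolve_reflect (hw : IsLocStep w) (τ : ℝ) : evolve (reflect F) (-w) τ = -evolve F w τ := by
  funext x
  change evolve (reflect F) (-w) τ x = -evolve F w τ x
  rw [evolve, evolve]
  split_ifs
  · rfl
  · rw [← finsum_neg_distrib]
    refine finsum_congr fun ξ => ?_
    have := congrFun (fan_reflect (F := F) hw ξ) ((x - ξ) / τ)
    rw [Pi.neg_apply] at this
    change fan (reflect F) (-w) ξ ((x - ξ) / τ) - leftLim (-w) ξ =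
      -(fan F w ξ ((x - ξ) / τ) - leftLim w ξ)
    rw [this, hw.leftLim_neg]
    ring

section Reflect

variable (hF : IsGridFlux F ε) (hε : 0 < ε)
include hF hε

lemma isFront_reflect (hw : IsProfile ε w) {ξ : ℝ} :
    IsFront (reflect F) (-w) ξ c ↔ IsFront F w ξ c := by
  rw [IsFront, IsFront, fan_reflect hw.step, (isLocStep_fan hF hε hw ξ).leftLim_neg, Pi.neg_apply,
    Ne, neg_inj]

lemma frontsThrough_reflect (hw : IsProfile ε w) :
    frontsThrough (reflect F) (-w) = frontsThrough F w := by
  funext τ y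
  ext p
  rw [mem_frontsThrough, mem_frontsThrough, isFront_reflect hF hε hw]

lemma delay_reflect (hw : IsProfile ε w) :
    collisionDelays (reflect F) (-w) = collisionDelays F w ∧ delay (reflect F) (-w) = delay F w := by
  have h : collisionDelays (reflect F) (-w) = collisionDelays F w := by
    rw [collisionDelays, frontsThrough_reflect hF hε hw, collisionDelays]
  exact ⟨h, by rw [delay, h, delay]⟩

variable (hv : IsFrontDatum ε v)
include hv

lemma frontProfile_reflect (n : ℕ) : frontProfile (reflect F) (-v) n = -frontProfile F v n := by
  induction n with
  | zero => rfl
  | succ n ih =>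
    have hw := isProfile_frontProfile hF hε hv n
    rw [frontProfile, ih, (delay_reflect hF hε hw).2, evolve_reflect hw.step, frontProfile]

lemma frontTime_reflect (n : ℕ) : frontTime (reflect F) (-v) n = frontTime F v n := by
  induction n with
  | zero => rfl
  | succ n ih =>
    have hw := delay_reflect hF hε (isProfile_frontProfile hF hε hv n)
    rw [frontTime, frontTime, frontProfile_reflect hF hε hv, hw.1, hw.2, ih]

lemma frontStages_reflect (t : ℝ) : frontStages (reflect F) (-v) t = frontStages F v t := by
  simp only [frontStages, frontTime_reflect hF hε hv]

lemma binaryCollisions_reflect (h : BinaryCollisions F v) : BinaryCollisions (reflect F) (-v) := by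
  intro n hn
  have hw := isProfile_frontProfile hF hε hv n
  rw [frontTime_reflect hF hε hv] at hn
  rw [frontProfile_reflect hF hε hv, (delay_reflect hF hε hw).2, frontsThrough_reflect hF hε hw]
  exact h n hn

omit hF hε hv in
lemma frontWaves_neg : frontWaves ε (-v) = frontWaves ε v := by
  rw [frontWaves, totVar_neg, frontWaves]

omit hF in
lemma frontSign_neg (s : ℕ) : frontSign ε (-v) s = -frontSign ε v s := by
  rw [frontSign, initSign_neg (hv.isLocStep hε), frontSign]

omit hF in
lemma frontState_neg (s : ℕ) : frontState ε (-v) s = -frontState ε v s := by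
  rw [frontState, initState_neg (hv.isLocStep hε), frontState]

omit hF hε hv in
lemma frontSpeedAt_reflect (hw : IsLocStep w) (h : leftLim w y ≠ w y) (u : ℝ) :
    frontSpeedAt (reflect F) ε (-w) y (-u) = frontSpeedAt F ε w y u := by
  rw [frontSpeedAt, frontSpeedAt, hw.leftLim_neg, Pi.neg_apply]
  rcases lt_or_gt_of_ne h with h | h
  · rw [if_neg (by linarith), if_pos h, concEnv_eq_reflect_fun, deriv_reflect]
    simp only [neg_neg]
    rw [show -(-u + ε / 2) = u - ε / 2 by ring]
    congr 2
    funext x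
    simp [reflect]
  · rw [if_pos (by linarith), if_neg (by linarith), convEnv_eq_reflect_fun, deriv_reflect]
    simp only [neg_neg]
    rw [show -(-u - ε / 2) = u + ε / 2 by ring]
    congr 2
    funext x
    simp [reflect]

omit hF hv in
lemma ceil_mul_div (s : ℕ) : ⌈(s * ε : ℝ) / ε⌉₊ = s := by
  rw [mul_div_cancel_right₀ _ hε.ne', Nat.ceil_natCast]

omit hF hv in
lemma mul_mem_frontPosWaves (hs : s ∈ frontWaves ε v) (h : 0 < frontSign ε v s) :
    (s * ε : ℝ) ∈ frontPosWaves ε v :=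
  ⟨mul_pos (by exact_mod_cast hs.1) hε, by rwa [ceil_mul_div hε], h⟩

omit hF hv in
lemma labelPos_mul (s : ℕ) : labelPos F ε v n (s * ε) = frontPosAt F ε v n s := by
  rw [labelPos, ceil_mul_div hε]

omit hF hε hv in
lemma frontPosAt_of_le (hkn : k ≤ n) (h : frontPosAt F ε v n s ≠ ⊤) : frontPosAt F ε v k s ≠ ⊤ := by
  induction n, hkn using Nat.le_induction with
  | base => exact h
  | succ n hkn ih => exact ih (frontPosAt_of_succ h)

omit hF in
lemma frontSign_eq (hs : s ∈ frontWaves ε v) (ha : frontPosAt F ε v n s ≠ ⊤) :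
    frontSign ε v s = 1 ∨ frontSign ε v s = -1 := by
  obtain ⟨x, hx⟩ := WithTop.ne_top_iff_exists.1 (frontPosAt_of_le (Nat.zero_le n) ha)
  exact initSign_eq_one_or hv.boundedVar (hv.isLocStep hε)
    (mul_pos (by exact_mod_cast hs.1) hε) hx.symm

/-- The positions of the waves are unchanged by the reflection, and a wave sits at a jump of its
sign. -/
lemma frontPosAt_reflect_and_jump (hn : frontTime F v n ≠ ⊤) (hs : s ∈ frontWaves ε v) :
    frontPosAt (reflect F) ε (-v) n s = frontPosAt F ε v n s ∧
      ∀ y : ℝ, frontPosAt F ε v n s = y →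
        frontSign ε v s = 1 ∧ leftLim (frontProfile F v n) y < frontProfile F v n y ∨
        frontSign ε v s = -1 ∧ frontProfile F v n y < leftLim (frontProfile F v n) y := by
  have hw := isProfile_frontProfile hF hε hv n
  have jump : frontPosAt (reflect F) ε (-v) n s = frontPosAt F ε v n s →
      ∀ y : ℝ, frontPosAt F ε v n s = y →
        frontSign ε v s = 1 ∧ leftLim (frontProfile F v n) y < frontProfile F v n y ∨
        frontSign ε v s = -1 ∧ frontProfile F v n y < leftLim (frontProfile F v n) y := by
    intro he y hy
    rcases frontSign_eq hε hv hs (n := n) (F := F) (by rw [hy]; exact WithTop.coe_ne_top) with h | h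
    · have := label_mem hF hε hv hn (mul_mem_frontPosWaves hε hs (by rw [h]; exact one_pos))
        (by rwa [labelPos_mul hε])
      exact Or.inl ⟨h, this.1.trans_le this.2⟩
    · have := label_mem hF.reflect hε hv.neg (by rwa [frontTime_reflect hF hε hv])
        (mul_mem_frontPosWaves hε (s := s) (by rwa [frontWaves_neg])
        (by rw [frontSign_neg hε hv, h]; norm_num)) (by rwa [labelPos_mul hε, he])
      have := this.1.trans_le this.2
      rw [frontProfile_reflect hF hε hv, hw.step.leftLim_neg] at this
      exact Or.inr ⟨h, neg_lt_neg_iff.1 this⟩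
  suffices frontPosAt (reflect F) ε (-v) n s = frontPosAt F ε v n s from ⟨this, jump this⟩
  clear jump hw
  induction n with
  | zero => rw [frontPosAt, frontPosAt, initPos_neg]
  | succ n ih =>
    have hn' := frontTime_of_succ hn
    have hw := isProfile_frontProfile hF hε hv n
    have hw' := isProfile_frontProfile hF hε hv (n + 1)
    have hd := (delay_reflect hF hε hw).2
    rw [frontPosAt, frontPosAt, ih hn']
    by_cases ha : frontPosAt F ε v n s = ⊤
    · rw [if_pos ha, if_pos ha]
    rw [if_neg ha, if_neg ha]
    obtain ⟨y, hy⟩ := WithTop.ne_top_iff_exists.1 ha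
    have hj : leftLim (frontProfile F v n) y ≠ frontProfile F v n y := by
      rcases frontSign_eq hε hv hs ha with h | h
      · have := label_mem hF hε hv hn' (mul_mem_frontPosWaves hε hs (by rw [h]; exact one_pos))
          (by rw [labelPos_mul hε, hy])
        exact (this.1.trans_le this.2).ne
      · have := label_mem hF.reflect hε hv.neg (by rwa [frontTime_reflect hF hε hv])
          (mul_mem_frontPosWaves hε (s := s) (by rwa [frontWaves_neg])
          (by rw [frontSign_neg hε hv, h]; norm_num)) (by rw [labelPos_mul hε, ih hn', hy])
        have := this.1.trans_le this.2
        rw [frontProfile_reflect hF hε hv, hw.step.leftLim_neg] at this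
        exact (neg_lt_neg_iff.1 this).ne'
    rw [← hy]
    dsimp only
    have hz : ∀ u, y + frontSpeedAt (reflect F) ε (-frontProfile F v n) y (-u) *
        delay F (frontProfile F v n) =
        y + frontSpeedAt F ε (frontProfile F v n) y u * delay F (frontProfile F v n) := fun u => by
      rw [frontSpeedAt_reflect hw.step hj]
    rw [WithTop.untopD_coe]
    congr 1
    · simp only [frontProfile_reflect hF hε hv, hd, frontsThrough_reflect hF hε hw,
        frontState_neg hε hv, frontSign_neg hε hv, hz, hw'.step.leftLim_neg, Pi.neg_apply,
        neg_mul_neg]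
    · rw [frontProfile_reflect hF hε hv, hd, frontState_neg hε hv, hz]

lemma frontPosAt_reflect (hn : frontTime F v n ≠ ⊤) (hs : s ∈ frontWaves ε v) :
    frontPosAt (reflect F) ε (-v) n s = frontPosAt F ε v n s :=
  (frontPosAt_reflect_and_jump hF hε hv hn hs).1

lemma jump_of_wave (hn : frontTime F v n ≠ ⊤) (hs : s ∈ frontWaves ε v)
    (hy : frontPosAt F ε v n s = y) :
    frontSign ε v s = 1 ∧ leftLim (frontProfile F v n) y < frontProfile F v n y ∨
      frontSign ε v s = -1 ∧ frontProfile F v n y < leftLim (frontProfile F v n) y :=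
  (frontPosAt_reflect_and_jump hF hε hv hn hs).2 y hy

/-- Every wave moves along a wavefront. -/
lemma isFront_frontSpeedAt (hn : frontTime F v n ≠ ⊤) (hs : s ∈ frontWaves ε v)
    (hy : frontPosAt F ε v n s = y) : IsFront F (frontProfile F v n) y
      (frontSpeedAt F ε (frontProfile F v n) y (frontState ε v s)) := by
  have key : ∀ {F v}, IsGridFlux F ε → IsFrontDatum ε v → frontTime F v n ≠ ⊤ →
      s ∈ frontWaves ε v → frontPosAt F ε v n s = y → 0 < frontSign ε v s →
      IsFront F (frontProfile F v n) y
        (frontSpeedAt F ε (frontProfile F v n) y (frontState ε v s)) := by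
    intro F v hF hv hn hs hy hsign
    have hr := mul_mem_frontPosWaves hε hs hsign
    have hw := isProfile_frontProfile hF hε hv n
    have hm := label_mem hF hε hv hn hr (by rwa [labelPos_mul hε])
    have := frontSpeedAt_eq hF hε hv hw hr hm
    rw [ceil_mul_div hε] at this
    rw [this]
    exact (isFront_leftSlope hF hε hw hm).1
  rcases jump_of_wave hF hε hv hn hs hy with ⟨h, h'⟩ | ⟨h, h'⟩
  · exact key hF hv hn hs hy (by rw [h]; exact one_pos)
  · have hw := isProfile_frontProfile hF hε hv n
    have := key hF.reflect hv.neg (by rwa [frontTime_reflect hF hε hv]) (by rwa [frontWaves_neg])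
      (by rwa [frontPosAt_reflect hF hε hv hn hs]) (by rw [frontSign_neg hε hv, h]; norm_num)
    rwa [frontProfile_reflect hF hε hv, isFront_reflect hF hε hw, frontState_neg hε hv,
      frontSpeedAt_reflect hw.step h'.ne'] at this

end Reflect

end ScalarWaves

namespace ScalarWaves

/-! ### Wavefront tracking: positions between the collision times -/

variable {F : ℝ → ℝ} {ε t τ x y y' c r r' : ℝ} {v w : ℝ → ℝ} {n j k s s' : ℕ}

/-- The real number that equals the `n`-th collision time, if there are at least `n` collisions. -/
noncomputable def realTime (F v : ℝ → ℝ) (n : ℕ) : ℝ := (frontTime F v n).untopD 0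

lemma coe_realTime (h : frontTime F v n ≠ ⊤) : (realTime F v n : WithTop ℝ) = frontTime F v n := by
  obtain ⟨a, ha⟩ := WithTop.ne_top_iff_exists.1 h
  rw [realTime, ← ha]
  rfl

lemma frontTime_le_succ (n : ℕ) : frontTime F v n ≤ frontTime F v (n + 1) := by
  rw [frontTime]
  split_ifs
  · refine le_add_of_nonneg_right ?_
    exact_mod_cast delay_nonneg (F := F) (w := frontProfile F v n)
  · exact le_top

lemma monotone_frontTime : Monotone (frontTime F v) := monotone_nat_of_le_succ frontTime_le_succ

lemma frontStages_eq (hj : j ∈ frontStages F v t) : frontStages F v t = {j} := by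
  ext k
  refine ⟨fun hk => ?_, fun h => h ▸ hj⟩
  rcases lt_trichotomy k j with h | h | h
  · exact absurd (hk.2.trans_le (monotone_frontTime (F := F) (v := v) h)) (not_lt.2 hj.1)
  · exact h
  · exact absurd (hj.2.trans_le (monotone_frontTime (F := F) (v := v) h)) (not_lt.2 hk.1)

lemma sInf_frontStages (hj : j ∈ frontStages F v t) : sInf (frontStages F v t) = j := by
  rw [frontStages_eq hj, csInf_singleton]

lemma frontTime_ne_top (hj : j ∈ frontStages F v t) : frontTime F v j ≠ ⊤ :=
  (hj.1.trans_lt (WithTop.coe_lt_top t)).ne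

/-- A stage exists at all earlier times. -/
lemma exists_stage (hj : j ∈ frontStages F v t) (h0 : 0 ≤ τ) (hτ : τ ≤ t) :
    ∃ k ≤ j, k ∈ frontStages F v τ := by
  classical
  have hex : ∃ k, (τ : WithTop ℝ) < frontTime F v (k + 1) :=
    ⟨j, (WithTop.coe_le_coe.2 hτ).trans_lt hj.2⟩
  refine ⟨Nat.find hex, Nat.find_min' hex ((WithTop.coe_le_coe.2 hτ).trans_lt hj.2), ?_,
    Nat.find_spec hex⟩
  rcases hk : Nat.find hex with _ | k
  · rw [frontTime]
    exact_mod_cast h0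
  · exact not_lt.1 (Nat.find_min hex (m := k) (by omega))

lemma elapsed_nonneg (hj : j ∈ frontStages F v t) : 0 ≤ t - realTime F v j := by
  have h := hj.1
  rw [← coe_realTime (frontTime_ne_top hj), WithTop.coe_le_coe] at h
  linarith

lemma frontPos_of_stage (hj : j ∈ frontStages F v t) (s : ℕ) :
    frontPos F ε v t s = (frontPosAt F ε v j s).map fun y =>
      y + frontSpeedAt F ε (frontProfile F v j) y (frontState ε v s) * (t - realTime F v j) := by
  rw [frontPos, if_pos ⟨j, hj⟩, frontElapsed, sInf_frontStages hj]
  rfl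

lemma frontSolution_of_stage (hj : j ∈ frontStages F v t) :
    frontSolution F v t = evolve F (frontProfile F v j) (t - realTime F v j) := by
  funext x
  rw [frontSolution, frontElapsed, sInf_frontStages hj]
  rfl

lemma exists_stage_of_alive (h : frontPos F ε v t s ≠ ⊤) :
    ∃ j, j ∈ frontStages F v t ∧ frontPosAt F ε v j s ≠ ⊤ := by
  by_cases hne : (frontStages F v t).Nonempty
  · obtain ⟨j, hj⟩ := hne
    rw [frontPos_of_stage hj, Ne, WithTop.map_eq_top_iff] at h
    exact ⟨j, hj, h⟩
  · rw [frontPos, if_neg hne] at h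
    exact absurd rfl h

section Elapsed

variable (hF : IsGridFlux F ε) (hε : 0 < ε) (hv : IsFrontDatum ε v)
include hF hε hv

lemma elapsed_lt (hj : j ∈ frontStages F v t) :
    ∀ τ' ∈ collisionDelays F (frontProfile F v j), t - realTime F v j < τ' := by
  intro τ' hτ'
  have h := hj.2
  rw [frontTime, if_pos ⟨τ', hτ'⟩, ← coe_realTime (frontTime_ne_top hj), ← WithTop.coe_add,
    WithTop.coe_lt_coe] at h
  have := (isSafe_delay hF hε (isProfile_frontProfile hF hε hv j) ⟨τ', hτ'⟩).2 τ' hτ'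
  linarith

/-- Between collisions distinct fronts stay apart. -/
lemma front_lt_of_stage (hj : j ∈ frontStages F v t) {y₁ y₂ c₁ c₂ : ℝ} (hy : y₁ < y₂)
    (h1 : IsFront F (frontProfile F v j) y₁ c₁) (h2 : IsFront F (frontProfile F v j) y₂ c₂) :
    y₁ + c₁ * (t - realTime F v j) < y₂ + c₂ * (t - realTime F v j) := by
  have h := elapsed_lt hF hε hv hj
  rcases (elapsed_nonneg hj).eq_or_lt with he | he
  · rw [← he]; linarith
  · exact IsSafe.lt ⟨he, fun τ' hτ' => (h τ' hτ').le⟩ (fun hm => lt_irrefl _ (h _ hm)) hy h1 h2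

/-- Between collisions the solution has at the position of a front the jump of that front. -/
lemma frontSolution_eq_fan (hj : j ∈ frontStages F v t) (he : 0 < t - realTime F v j)
    (h : IsFront F (frontProfile F v j) y c) :
    leftLim (frontSolution F v t) (y + c * (t - realTime F v j)) =
        leftLim (fan F (frontProfile F v j) y) c ∧
      frontSolution F v t (y + c * (t - realTime F v j)) = fan F (frontProfile F v j) y c := by
  have hw := isProfile_frontProfile hF hε hv j
  have hs : IsSafe F (frontProfile F v j) (t - realTime F v j) :=
    ⟨he, fun τ' hτ' => (elapsed_lt hF hε hv hj τ' hτ').le⟩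
  rw [frontSolution_of_stage hj]
  exact ⟨leftLim_evolve_eq_of_leftmost hF hε hw hs h rfl fun ξ hξ c' hc' =>
      (front_lt_of_stage hF hε hv hj hξ hc' h).ne,
    evolve_eq_of_rightmost hF hε hw hs h rfl fun ξ hξ c' hc' =>
      (front_lt_of_stage hF hε hv hj hξ h hc').ne'⟩

lemma isProfile_frontSolution (hj : j ∈ frontStages F v t) : IsProfile ε (frontSolution F v t) := by
  rw [frontSolution_of_stage hj]
  exact isProfile_evolve hF hε (isProfile_frontProfile hF hε hv j) (elapsed_nonneg hj)

lemma jump_frontSolution (hj : j ∈ frontStages F v t) (h : IsFront F (frontProfile F v j) y c) :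
    leftLim (frontSolution F v t) (y + c * (t - realTime F v j)) ≠
      frontSolution F v t (y + c * (t - realTime F v j)) := by
  rcases (elapsed_nonneg hj).eq_or_lt with he | he
  · rw [frontSolution_of_stage hj, ← he, evolve_zero, mul_zero, add_zero]
    exact h.jump hF hε (isProfile_frontProfile hF hε hv j)
  · obtain ⟨h1, h2⟩ := frontSolution_eq_fan hF hε hv hj he h
    rw [h1, h2]
    exact h

/-- Waves meet only at the collision times. -/
lemma haveInteracted_front_iff (hj : j ∈ frontStages F v t) (hs : s ∈ frontWaves ε v)
    (hs' : s' ∈ frontWaves ε v) (ha : frontPosAt F ε v j s ≠ ⊤) :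
    HaveInteracted (frontPos F ε v) t s s' ↔
      ∃ k ≤ j, frontPosAt F ε v k s = frontPosAt F ε v k s' := by
  constructor
  · rintro ⟨τ, h0, hτ, h⟩
    obtain ⟨k, hkj, hk⟩ := exists_stage hj h0 hτ
    refine ⟨k, hkj, ?_⟩
    rw [frontPos_of_stage hk, frontPos_of_stage hk] at h
    obtain ⟨y, hy⟩ := WithTop.ne_top_iff_exists.1 (frontPosAt_of_le hkj ha)
    rw [← hy, WithTop.map_coe, eq_comm, WithTop.map_eq_some_iff] at h
    obtain ⟨y', hy', h⟩ := h
    have hk' := frontTime_ne_top hk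
    have hf := isFront_frontSpeedAt hF hε hv hk' hs hy.symm
    have hf' := isFront_frontSpeedAt hF hε hv hk' hs' hy'
    rw [← hy, hy', WithTop.coe_inj]
    rcases lt_trichotomy y y' with hlt | heq | hlt
    · exact absurd h (front_lt_of_stage hF hε hv hk hlt hf hf').ne'
    · exact heq
    · exact absurd h (front_lt_of_stage hF hε hv hk hlt hf' hf).ne
  · rintro ⟨k, hkj, h⟩
    have hk' : frontTime F v k ≠ ⊤ := fun hk =>
      frontTime_ne_top hj (top_le_iff.1 (hk ▸ monotone_frontTime hkj))
    have hmono := monotone_frontTime (F := F) (v := v)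
    have h0 : (0 : WithTop ℝ) ≤ frontTime F v k := hmono (Nat.zero_le k)
    have hkt := (hmono hkj).trans hj.1
    have hstage : k ∈ frontStages F v (realTime F v k) := by
      refine ⟨(coe_realTime hk').ge, ?_⟩
      rw [coe_realTime hk', frontTime]
      split_ifs with hne
      · have := (isSafe_delay hF hε (isProfile_frontProfile hF hε hv k) hne).1
        rw [← coe_realTime hk', ← WithTop.coe_add, WithTop.coe_lt_coe]
        linarith
      · exact lt_top_iff_ne_top.2 hk'
    rw [← coe_realTime hk'] at h0 hkt
    refine ⟨realTime F v k, by exact_mod_cast h0, WithTop.coe_le_coe.1 hkt, ?_⟩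
    rw [frontPos_of_stage hstage, frontPos_of_stage hstage, h]
    simp

lemma frontSign_eq_of_interacted (hj : j ∈ frontStages F v t) (hs : s ∈ frontWaves ε v)
    (hs' : s' ∈ frontWaves ε v) (ha : frontPosAt F ε v j s ≠ ⊤)
    (h : HaveInteracted (frontPos F ε v) t s s') : frontSign ε v s = frontSign ε v s' := by
  obtain ⟨k, hkj, h⟩ := (haveInteracted_front_iff hF hε hv hj hs hs' ha).1 h
  have hk' : frontTime F v k ≠ ⊤ := fun hk =>
    frontTime_ne_top hj (top_le_iff.1 (hk ▸ monotone_frontTime hkj))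
  obtain ⟨y, hy⟩ := WithTop.ne_top_iff_exists.1 (frontPosAt_of_le hkj ha)
  rcases jump_of_wave hF hε hv hk' hs hy.symm with ⟨h1, h2⟩ | ⟨h1, h2⟩ <;>
    rcases jump_of_wave hF hε hv hk' hs' (h ▸ hy.symm) with ⟨h3, h4⟩ | ⟨h3, h4⟩
  · rw [h1, h3]
  · exact absurd h2 h4.not_gt
  · exact absurd h2 h4.not_gt
  · rw [h1, h3]

lemma realTime_reflect (n : ℕ) : realTime (reflect F) (-v) n = realTime F v n := by
  rw [realTime, frontTime_reflect hF hε hv, realTime]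

lemma frontPos_reflect (hs : s ∈ frontWaves ε v) (t : ℝ) :
    frontPos (reflect F) ε (-v) t s = frontPos F ε v t s := by
  by_cases hne : (frontStages F v t).Nonempty
  · obtain ⟨j, hj⟩ := hne
    have hj' : j ∈ frontStages (reflect F) (-v) t := by rwa [frontStages_reflect hF hε hv]
    have hn := frontTime_ne_top hj
    rw [frontPos_of_stage hj, frontPos_of_stage hj', frontPosAt_reflect hF hε hv hn hs]
    by_cases ha : frontPosAt F ε v j s = ⊤
    · rw [ha, WithTop.map_top, WithTop.map_top]
    obtain ⟨y, hy⟩ := WithTop.ne_top_iff_exists.1 ha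
    have hw := isProfile_frontProfile hF hε hv j
    have hjump := (isFront_frontSpeedAt hF hε hv hn hs hy.symm).jump hF hε hw
    rw [← hy, WithTop.map_coe, WithTop.map_coe, frontProfile_reflect hF hε hv,
      frontState_neg hε hv, frontSpeedAt_reflect hw.step hjump,
      realTime_reflect hF hε hv]
  · rw [frontPos, frontPos, frontStages_reflect hF hε hv, if_neg hne, if_neg hne]

lemma frontSpeed_reflect (hs : s ∈ frontWaves ε v) (t : ℝ) :
    frontSpeed (reflect F) ε (-v) t s = frontSpeed F ε v t s := by
  rw [frontSpeed, frontSpeed, frontPos_reflect hF hε hv hs]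
  by_cases ha : frontPos F ε v t s = ⊤
  · rw [ha, WithTop.map_top, WithTop.map_top]
  obtain ⟨j, hj, hpos⟩ := exists_stage_of_alive ha
  have hj' : j ∈ frontStages (reflect F) (-v) t := by rwa [frontStages_reflect hF hε hv]
  obtain ⟨y, hy⟩ := WithTop.ne_top_iff_exists.1 hpos
  have hw := isProfile_frontProfile hF hε hv j
  have hjump := jump_frontSolution hF hε hv hj
    (isFront_frontSpeedAt hF hε hv (frontTime_ne_top hj) hs hy.symm)
  have hsol : frontSolution (reflect F) (-v) t = -frontSolution F v t := by
    rw [frontSolution_of_stage hj, frontSolution_of_stage hj', frontProfile_reflect hF hε hv,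
      evolve_reflect hw.step, realTime_reflect hF hε hv]
  rw [frontPos_of_stage hj, ← hy, WithTop.map_coe, WithTop.map_coe, WithTop.map_coe, hsol,
    frontState_neg hε hv,
    frontSpeedAt_reflect (isProfile_frontSolution hF hε hv hj).step hjump]

variable (hbin : BinaryCollisions F v)
include hbin

/-- Waves of the same front have the same speed at all times up to the next collision. -/
lemma separated_of_divided_front (hj : j ∈ frontStages F v t) (hs : s ∈ frontWaves ε v)
    (hs' : s' ∈ frontWaves ε v) (hpos : 0 < frontSign ε v s) (hpos' : 0 < frontSign ε v s')
    (hss : s < s') (ha : frontPosAt F ε v j s ≠ ⊤)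
    (h : DividedInSolution (frontPos F ε v) (frontSpeed F ε v) t s s') :
    Separated F (labelPos F ε v) (initState v) (fun n => leftLim (frontProfile F v n))
      (frontProfile F v) j (s * ε) (s' * ε) := by
  by_contra hsep
  unfold Separated at hsep
  push Not at hsep
  obtain ⟨h1, hgap⟩ := hsep
  obtain ⟨y, hy⟩ := WithTop.ne_top_iff_exists.1 ha
  have hn := frontTime_ne_top hj
  have hr := mul_mem_frontPosWaves hε hs hpos
  have hr' := mul_mem_frontPosWaves hε hs' hpos'
  have hp : labelPos F ε v j (s * ε) = y := by rw [labelPos_mul hε, hy]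
  have hp' : labelPos F ε v j (s' * ε) = y := h1 ▸ hp
  have hss' : (s * ε : ℝ) < s' * ε := mul_lt_mul_of_pos_right (by exact_mod_cast hss) hε
  have hw := isProfile_frontProfile hF hε hv j
  have hm := label_mem hF hε hv hn hr hp
  have hm' := label_mem hF hε hv hn hr' hp'
  have hlt := (label_mono_strict hF hε hv hbin hn hr hr' hss' hp hp').2 rfl
  have hslope := leftSlope_eq_of_gap hF.toIsFlux hm.1 hlt hm'.2 (hgap y hp)
  have hspeed := frontSpeedAt_eq hF hε hv hw hr hm
  have hspeed' := frontSpeedAt_eq hF hε hv hw hr' hm'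
  rw [ceil_mul_div hε] at hspeed hspeed'
  rw [labelPos_mul hε] at hp hp'
  obtain ⟨hfront, hmem⟩ := isFront_leftSlope hF hε hw hm
  have hmem' := (isFront_leftSlope hF hε hw hm').2
  rw [← hslope] at hspeed' hmem'
  set c := leftSlope F (leftLim (frontProfile F v j) y) (frontProfile F v j y) (initState v (s * ε))
  set e := t - realTime F v j with he
  have hx : frontPos F ε v t s = ((y + c * e : ℝ) : WithTop ℝ) := by
    rw [frontPos_of_stage hj, hp, WithTop.map_coe, hspeed]
  have hx' : frontPos F ε v t s' = ((y + c * e : ℝ) : WithTop ℝ) := by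
    rw [frontPos_of_stage hj, hp', WithTop.map_coe, hspeed']
  refine h ?_
  rw [Prod.mk.injEq, frontSpeed, frontSpeed, hx, hx', WithTop.map_coe, WithTop.map_coe]
  refine ⟨rfl, congrArg _ ?_⟩
  rcases (elapsed_nonneg hj).eq_or_lt with he0 | he0
  · rw [frontSolution_of_stage hj, ← he0, evolve_zero, he, ← he0, mul_zero, add_zero, hspeed, hspeed']
  · have hsol := isProfile_frontSolution hF hε hv hj
    obtain ⟨e1, e2⟩ := frontSolution_eq_fan hF hε hv hj he0 hfront
    rw [← he] at e1 e2
    rw [← e1, ← e2] at hmem hmem'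
    have k1 := frontSpeedAt_eq hF hε hv hsol hr hmem
    have k2 := frontSpeedAt_eq hF hε hv hsol hr' hmem'
    rw [ceil_mul_div hε] at k1 k2
    rw [k1, k2]
    refine leftSlope_eq_of_gap hF.toIsFlux hmem.1 hlt hmem'.2 fun u hu htouch => hgap y ?_ u hu ?_
    · rw [labelPos_mul hε, hp]
    -- both end points of the jump of the front are touching points of the jump at the node
    · have hab := (hm.1.trans_le hm.2).le
      have tb := touches_riemann hF.toIsFlux hab c
      obtain ⟨c', -, hc'⟩ := (isLocStep_fan hF hε hw y).leftLim_mem c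
      have ta := touches_riemann hF.toIsFlux hab c'
      rw [e1, e2] at htouch hmem hmem'
      rw [hc'] at htouch hmem hmem'
      exact Touches.glue ta tb (riemann_mem hab c').1 htouch (hmem.1.le.trans hu.1)
        (hu.2.le.trans hmem'.2)

end Elapsed

end ScalarWaves

namespace ScalarWaves

/-! ### Wavefront tracking: the Riemann problem of a common history -/

variable {F : ℝ → ℝ} {ε t r : ℝ} {v : ℝ → ℝ} {j s s' p p' : ℕ}

lemma commonHistory_congr {ι : Type} {W : Set ι} {x x' : ℝ → ι → WithTop ℝ} {s s' : ι}
    (h : ∀ s ∈ W, ∀ t, x t s = x' t s) (hs : s ∈ W) (hs' : s' ∈ W) :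
    commonHistory W x t s s' = commonHistory W x' t s s' := by
  ext p
  simp only [commonHistory, interactedWith, realWaves, HaveInteracted, mem_inter_iff,
    mem_ofPred_eq]
  by_cases hp : p ∈ W
  · simp only [h p hp, h s hs, h s' hs']
  · simp only [hp, false_and]

section History

variable (hF : IsGridFlux F ε) (hε : 0 < ε) (hv : IsFrontDatum ε v)
include hF hε hv

lemma mem_history_iff (hj : j ∈ frontStages F v t) (hs : s ∈ frontWaves ε v)
    (hs' : s' ∈ frontWaves ε v) (hpos : 0 < frontSign ε v s) (hr : 0 < r) :
    r ∈ history (frontPosWaves ε v) (labelPos F ε v) j (s * ε) (s' * ε) ↔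
      ⌈r / ε⌉₊ ∈ commonHistory (frontWaves ε v) (frontPos F ε v) t s s' := by
  have alive : ∀ q, frontPos F ε v t q ≠ ⊤ ↔ frontPosAt F ε v j q ≠ ⊤ := fun q => by
    rw [frontPos_of_stage hj, Ne, WithTop.map_eq_top_iff]
  simp only [history, Met, labelPos_mul hε, mem_ofPred_eq]
  constructor
  · rintro ⟨hrW, ha, h1, h2⟩
    exact ⟨⟨⟨hrW.2.1, (alive _).2 ha⟩, (haveInteracted_front_iff hF hε hv hj hrW.2.1 hs ha).2 h1⟩,
      ⟨⟨hrW.2.1, (alive _).2 ha⟩, (haveInteracted_front_iff hF hε hv hj hrW.2.1 hs' ha).2 h2⟩⟩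
  · rintro ⟨⟨⟨hW, ha⟩, h1⟩, ⟨-, h2⟩⟩
    rw [alive] at ha
    have hsign := frontSign_eq_of_interacted hF hε hv hj hW hs ha h1
    rw [← hsign, frontSign_cell hε hv hr] at hpos
    exact ⟨⟨hr, hW, hpos⟩, ha, (haveInteracted_front_iff hF hε hv hj hW hs ha).1 h1,
      (haveInteracted_front_iff hF hε hv hj hW hs' ha).1 h2⟩

lemma frontSign_of_mem_commonHistory (hs : s ∈ frontWaves ε v)
    (hp : p ∈ commonHistory (frontWaves ε v) (frontPos F ε v) t s s') :
    frontSign ε v p = frontSign ε v s := by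
  obtain ⟨⟨⟨hW, ha⟩, h⟩, -⟩ := hp
  obtain ⟨j, hj, ha⟩ := exists_stage_of_alive ha
  exact frontSign_eq_of_interacted hF hε hv hj hW hs ha h

/-- The cells of the common history of positive waves are filled by the states of its labels. -/
lemma frontInterval_commonHistory (hj : j ∈ frontStages F v t) (hs : s ∈ frontWaves ε v)
    (hs' : s' ∈ frontWaves ε v) (hpos : 0 < frontSign ε v s) :
    frontInterval ε v (commonHistory (frontWaves ε v) (frontPos F ε v) t s s') =
      initState v '' history (frontPosWaves ε v) (labelPos F ε v) j (s * ε) (s' * ε) := by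
  ext u
  rw [frontInterval, mem_iUnion₂]
  constructor
  · rintro ⟨q, hq, hu⟩
    have hqpos : 0 < frontSign ε v q := by
      rwa [frontSign_of_mem_commonHistory hF hε hv hs hq]
    rw [if_pos hqpos] at hu
    have hq1 : (1 : ℝ) ≤ q := by exact_mod_cast hq.1.1.1.1
    have hr : 0 < q * ε - (frontState ε v q - u) := by nlinarith [hu.1]
    have hceil : ⌈(q * ε - (frontState ε v q - u)) / ε⌉₊ = q := by
      rw [Nat.ceil_eq_iff (by have := Nat.one_le_cast.1 hq1; omega)]
      rw [lt_div_iff₀ hε, div_le_iff₀ hε, Nat.cast_sub (Nat.one_le_cast.1 hq1)]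
      push_cast
      constructor <;> linarith [hu.1, hu.2]
    refine ⟨_, (mem_history_iff hF hε hv hj hs hs' hpos hr).2 (by rwa [hceil]), ?_⟩
    have := frontState_cell hε hv hr (by rwa [← frontSign_cell hε hv hr, hceil])
    rw [hceil] at this
    linarith
  · rintro ⟨r, hr, rfl⟩
    have hr0 := hr.1.1
    refine ⟨⌈r / ε⌉₊, (mem_history_iff hF hε hv hj hs hs' hpos hr0).1 hr, ?_⟩
    rw [if_pos (by rw [frontSign_cell hε hv hr0]; exact hr.1.2.2)]
    exact initState_mem_cell hε hv hr0 hr.1.2.2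

/-- For positive waves of wavefront tracking, the Riemann problem of the common history touches the
flux between divided waves. -/
lemma front_exists_touches (hbin : BinaryCollisions F v)
    (hs : s ∈ realWaves (frontWaves ε v) (frontPos F ε v) t)
    (hs' : s' ∈ realWaves (frontWaves ε v) (frontPos F ε v) t) (hpos : 0 < frontSign ε v s)
    (hint : HaveInteracted (frontPos F ε v) t s s')
    (hdiv : DividedInSolution (frontPos F ε v) (frontSpeed F ε v) t s s')
    (hp : p ∈ commonHistory (frontWaves ε v) (frontPos F ε v) t s s')
    (hp' : p' ∈ commonHistory (frontWaves ε v) (frontPos F ε v) t s s') (hpp : p < p')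
    (hdivp : DividedInSolution (frontPos F ε v) (frontSpeed F ε v) t p p') :
    let A := frontInterval ε v (commonHistory (frontWaves ε v) (frontPos F ε v) t s s')
    ∃ y ∈ Ico (frontState ε v p) (frontState ε v p'), y ∈ Icc (sInf A) (sSup A) ∧
      Touches F (sInf A) (sSup A) y := by
  intro A
  obtain ⟨j, hj, ha⟩ := exists_stage_of_alive hs.2
  have ha' : frontPosAt F ε v j s' ≠ ⊤ := by
    have := hs'.2
    rwa [frontPos_of_stage hj, Ne, WithTop.map_eq_top_iff] at this
  have hpos' : 0 < frontSign ε v s' :=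
    frontSign_eq_of_interacted hF hε hv hj hs.1 hs'.1 ha hint ▸ hpos
  have H := isWaveSystem_front hF hε hv hbin (frontTime_ne_top hj)
  have hm : Met (labelPos F ε v) j (s * ε) (s' * ε) := by
    simp only [Met, labelPos_mul hε]
    exact (haveInteracted_front_iff hF hε hv hj hs.1 hs'.1 ha).1 hint
  have hW := mul_mem_frontPosWaves hε hs.1 hpos
  have hW' := mul_mem_frontPosWaves hε hs'.1 hpos'
  have hal : labelPos F ε v j (s * ε) ≠ ⊤ := by rwa [labelPos_mul hε]
  have hal' : labelPos F ε v j (s' * ε) ≠ ⊤ := by rwa [labelPos_mul hε]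
  have hlt : ∀ {q q' : ℕ}, q < q' → (q * ε : ℝ) < q' * ε := fun h =>
    mul_lt_mul_of_pos_right (by exact_mod_cast h) hε
  have key : HistorySeparates F (frontPosWaves ε v) (labelPos F ε v) (initState v)
      (fun n => leftLim (frontProfile F v n)) (frontProfile F v) j (s * ε) (s' * ε) := by
    rcases lt_trichotomy s s' with h | rfl | h
    · exact H.historySeparates le_rfl hW hW' hal hal' (hlt h) hm
        (separated_of_divided_front hF hε hv hbin hj hs.1 hs'.1 hpos hpos' h ha hdiv)
    · exact absurd rfl hdiv
    · have := H.historySeparates le_rfl hW' hW hal' hal (hlt h) hm.symm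
        (separated_of_divided_front hF hε hv hbin hj hs'.1 hs.1 hpos' hpos h ha' hdiv.symm)
      have hcomm : history (frontPosWaves ε v) (labelPos F ε v) j (s' * ε) (s * ε) =
          history (frontPosWaves ε v) (labelPos F ε v) j (s * ε) (s' * ε) := by
        ext q; simp only [history, mem_ofPred_eq]; tauto
      rwa [HistorySeparates, hcomm] at this
  have hA : A = initState v '' history (frontPosWaves ε v) (labelPos F ε v) j (s * ε) (s' * ε) :=
    frontInterval_commonHistory hF hε hv hj hs.1 hs'.1 hpos
  have hmem : ∀ {q}, q ∈ commonHistory (frontWaves ε v) (frontPos F ε v) t s s' →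
      (q * ε : ℝ) ∈ history (frontPosWaves ε v) (labelPos F ε v) j (s * ε) (s' * ε) := by
    intro q hq
    have hq0 : 0 < q := hq.1.1.1.1
    rw [mem_history_iff hF hε hv hj hs.1 hs'.1 hpos (mul_pos (by exact_mod_cast hq0) hε),
      ceil_mul_div hε]
    exact hq
  have hsign := frontSign_of_mem_commonHistory hF hε hv hs.1 hp
  have hsign' := frontSign_of_mem_commonHistory hF hε hv hs.1 hp'
  obtain ⟨y, hy, ht⟩ := key _ (hmem hp) _ (hmem hp') (hlt hpp)
    (separated_of_divided_front hF hε hv hbin hj hp.1.1.1 hp'.1.1.1 (hsign ▸ hpos) (hsign' ▸ hpos) hpp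
      (by rw [← labelPos_mul hε]; exact (hmem hp).2.1) hdivp)
  rw [hA]
  exact ⟨y, hy, ⟨(H.sInf_le (hmem hp)).trans hy.1, hy.2.le.trans (H.le_sSup (hmem hp'))⟩, ht⟩

/-- The Riemann problem of the common history of two divided waves of wavefront tracking divides the
divided waves of that history. -/
theorem frontRiemannDivides (hbin : BinaryCollisions F v)
    (hs : s ∈ realWaves (frontWaves ε v) (frontPos F ε v) t)
    (hs' : s' ∈ realWaves (frontWaves ε v) (frontPos F ε v) t)
    (hint : HaveInteracted (frontPos F ε v) t s s')
    (hdiv : DividedInSolution (frontPos F ε v) (frontSpeed F ε v) t s s')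
    (hp : p ∈ commonHistory (frontWaves ε v) (frontPos F ε v) t s s')
    (hp' : p' ∈ commonHistory (frontWaves ε v) (frontPos F ε v) t s s')
    (hdivp : DividedInSolution (frontPos F ε v) (frontSpeed F ε v) t p p') :
    FrontRiemannDivides F ε v
      (frontInterval ε v (commonHistory (frontWaves ε v) (frontPos F ε v) t s s')) p p' := by
  have sgn : ∀ q ∈ commonHistory (frontWaves ε v) (frontPos F ε v) t s s',
      frontSign ε v q = frontSign ε v s := fun q hq =>
    frontSign_of_mem_commonHistory hF hε hv hs.1 hq
  wlog hpp : p < p' generalizing p p'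
  · have hne : p ≠ p' := by rintro rfl; exact hdivp rfl
    have := this hp' hp hdivp.symm (lt_of_le_of_ne (not_lt.1 hpp) hne.symm)
    unfold FrontRiemannDivides at this ⊢
    rw [sgn p hp]
    rw [sgn p' hp'] at this
    split_ifs at this ⊢
    all_goals
      rintro ⟨J, h, h1, h2⟩
      exact this ⟨J, h, h2, h1⟩
  unfold FrontRiemannDivides
  rw [sgn p hp]
  split_ifs with hpos
  · obtain ⟨y, hy, hyI, ht⟩ := front_exists_touches hF hε hv hbin hs hs' hpos hint hdiv hp hp' hpp hdivp
    rintro ⟨J, ⟨-, hJ, -, h⟩, h1, h2⟩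
    obtain ⟨b, hb, hb'⟩ := exists_between (max_lt hy.2 (sub_lt_self (frontState ε v p') hε))
    have h3 : y ∈ J := hJ.out (h1 ⟨by linarith, by linarith⟩ : frontState ε v p - ε / 2 ∈ J)
      (h2 ⟨(le_max_right _ _).trans_lt hb, hb'⟩)
      ⟨by linarith [hy.1], (le_max_left _ _).trans hb.le⟩
    exact (h y h3).ne (ht.convEnv_eq hF.toIsFlux hyI)
  · have hsign : frontSign ε v s = -1 := by
      obtain ⟨j, -, ha⟩ := exists_stage_of_alive hs.2
      refine (frontSign_eq hε hv hs.1 ha).resolve_left fun h => hpos ?_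
      rw [h]
      exact one_pos
    have hx := fun q (hq : q ∈ frontWaves ε v) => frontPos_reflect hF hε hv hq
    have hσ := fun q (hq : q ∈ frontWaves ε v) => frontSpeed_reflect hF hε hv hq
    have hcomm := commonHistory_congr (t := t) hx hs.1 hs'.1
    have key := front_exists_touches (t := t) (s := s) (s' := s') (p := p) (p' := p')
      hF.reflect hε hv.neg (binaryCollisions_reflect hF hε hv hbin)
      (by rw [frontWaves_neg]; exact ⟨hs.1, by rw [hx s hs.1]; exact hs.2⟩)
      (by rw [frontWaves_neg]; exact ⟨hs'.1, by rw [hx s' hs'.1]; exact hs'.2⟩)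
      (by rw [frontSign_neg hε hv, hsign]; norm_num)
      (by simpa only [HaveInteracted, hx s hs.1, hx s' hs'.1] using hint)
      (by simpa only [DividedInSolution, hx s hs.1, hx s' hs'.1, hσ s hs.1, hσ s' hs'.1] using hdiv)
      (by rwa [frontWaves_neg, hcomm]) (by rwa [frontWaves_neg, hcomm]) hpp
      (by simpa only [DividedInSolution, hx p hp.1.1.1, hx p' hp'.1.1.1, hσ p hp.1.1.1,
        hσ p' hp'.1.1.1] using hdivp)
    have hA : frontInterval ε (-v) (commonHistory (frontWaves ε v) (frontPos F ε v) t s s') =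
        -frontInterval ε v (commonHistory (frontWaves ε v) (frontPos F ε v) t s s') := by
      rw [frontInterval, frontInterval, iUnion_neg]
      refine iUnion_congr fun q => ?_
      rw [iUnion_neg]
      refine iUnion_congr fun hq => ?_
      have hq' : frontSign ε v q = -1 := (sgn q hq).trans hsign
      rw [frontSign_neg hε hv, frontState_neg hε hv, hq', if_pos (by norm_num), if_neg (by norm_num),
        neg_Ico]
      congr 1
      ring
    rw [frontWaves_neg, hcomm] at key
    simp only [hA, frontState_neg hε hv] at key
    obtain ⟨y, hy, hyI, ht⟩ := key
    rintro ⟨J, ⟨-, hJ, -, h⟩, h1, h2⟩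
    obtain ⟨b, hb, hb'⟩ := exists_between
      (lt_min (by linarith [hy.2] : frontState ε v p' < -y) (lt_add_of_pos_right (frontState ε v p') hε))
    have h3 : -y ∈ J := hJ.out (h2 ⟨hb, hb'.trans_le (min_le_right _ _)⟩)
      (h1 ⟨by linarith, by linarith⟩ : frontState ε v p + ε / 2 ∈ J)
      ⟨hb'.le.trans (min_le_left _ _), by linarith [hy.1]⟩
    exact (h (-y) h3).ne (concEnv_eq_of_touches hF.toIsFlux hyI ht).symm

end History

/-- A differentiable flux with speeds in `(0, 1)` has chords with slopes in `[0, 1]`. -/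
lemma isFlux_of_deriv {f : ℝ → ℝ} (hd : Differentiable ℝ f)
    (hf' : ∀ u, 0 < deriv f u ∧ deriv f u < 1) : IsFlux f where
  mono := monotone_of_deriv_nonneg hd fun u => (hf' u).1.le
  lip x y hxy := by
    have h : Monotone fun u => u - f u := by
      refine monotone_of_deriv_nonneg (differentiable_id.sub hd) fun u => ?_
      rw [deriv_fun_sub differentiableAt_fun_id (hd u), deriv_id'']
      linarith [(hf' u).2]
    have := h hxy
    dsimp only at this
    linarith

end ScalarWaves

theorem mainTheorem7 (f : ℝ → ℝ) (hf : ContDiff ℝ 2 f)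
    (hf' : ∀ u, 0 < deriv f u ∧ deriv f u < 1) (ε : ℝ) (hε : 0 < ε) :
    -- wavefront tracking
    (∀ v : ℝ → ℝ, IsFrontDatum ε v → BinaryCollisions (pwAffine f ε) v →
      ∀ t : ℝ, 0 ≤ t →
      ∀ s ∈ realWaves (frontWaves ε v) (frontPos (pwAffine f ε) ε v) t,
      ∀ s' ∈ realWaves (frontWaves ε v) (frontPos (pwAffine f ε) ε v) t,
        HaveInteracted (frontPos (pwAffine f ε) ε v) t s s' →
        DividedInSolution (frontPos (pwAffine f ε) ε v) (frontSpeed (pwAffine f ε) ε v) t s s' →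
        ∀ p ∈ commonHistory (frontWaves ε v) (frontPos (pwAffine f ε) ε v) t s s',
        ∀ p' ∈ commonHistory (frontWaves ε v) (frontPos (pwAffine f ε) ε v) t s s',
          DividedInSolution (frontPos (pwAffine f ε) ε v) (frontSpeed (pwAffine f ε) ε v) t p p' →
          FrontRiemannDivides (pwAffine f ε) ε v
            (frontInterval ε v
              (commonHistory (frontWaves ε v) (frontPos (pwAffine f ε) ε v) t s s')) p p') ∧
    -- Glimm scheme
    (∀ v : ℝ → ℝ, BoundedVariationOn v Set.univ →
      (∀ x, ContinuousWithinAt v (Set.Ici x) x) →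
      ∀ θ : ℕ → ℝ, (∀ n, θ n ∈ Set.Icc (0 : ℝ) 1) →
      ∀ n : ℕ,
      ∀ s ∈ realWaves (glimmWaves ε v) (glimmPos f ε v θ) (n * ε),
      ∀ s' ∈ realWaves (glimmWaves ε v) (glimmPos f ε v θ) (n * ε),
        HaveInteracted (glimmPos f ε v θ) (n * ε) s s' →
        DividedInSolution (glimmPos f ε v θ) (glimmSpeed f ε v θ) (n * ε) s s' →
        ∀ p ∈ commonHistory (glimmWaves ε v) (glimmPos f ε v θ) (n * ε) s s',
        ∀ p' ∈ commonHistory (glimmWaves ε v) (glimmPos f ε v θ) (n * ε) s s',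
          DividedInSolution (glimmPos f ε v θ) (glimmSpeed f ε v θ) (n * ε) p p' →
          GlimmRiemannDivides f ε v
            (glimmState ε v '' commonHistory (glimmWaves ε v) (glimmPos f ε v θ) (n * ε) s s')
            p p') := by
  have hd : Differentiable ℝ f := hf.differentiable (by norm_num)
  have hF : IsFlux f := isFlux_of_deriv hd hf'
  exact ⟨fun v hv hbin t _ s hs s' hs' hint hdiv p hp p' hp' hdivp =>
      frontRiemannDivides (isGridFlux_pwAffine hε hF) hε hv hbin hs hs' hint hdiv hp hp' hdivp,
    fun v hv _ θ _ n s hs s' hs' hint hdiv p hp p' hp' hdivp =>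
      glimmRiemannDivides hF hd hε hv hs hs' hint hdiv hp hp' hdivp⟩
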